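/- **Theorem (Geometric interpretation of $H^3(\Phi,\mathbb Z)$).** Let $M,N$ be smooth finite-dimensional manifolds (Hausdorff, second countable, without boundary) and let $\Phi:M\to N$ be a smooth map. *Definitions.* A gerbe $\mathcal G=(L,\theta)$ on an open cover $\{V_j\}_{j\in J}$ of $N$ consists of Hermitian line bundles $L_{jj'}$ on $V_{jj'}=V_j\cap V_{j'}$ and unitary sections $\theta_{jj'j''}$ of $(\delta L)_{jj'j''}=L_{j'j''}\otimes L_{jj''}^{-1}\otimes L_{jj'}$ on the triple intersections such that $\delta\theta=1$ on the quadruple intersections. A quasi-line bundle $\mathcal L=(E,\psi)$ for a gerbe $(L,\theta)$ on a cover $\{U_i\}$ consists of Hermitian line bundles $E_i$ on $U_i$ and unitary sections $\psi_{ii'}$ of $(\delta E)_{ii'}^{-1}\otimes L_{ii'}$, where $(\delta E)_{ii'}=E_{i'}\otimes E_i^{-1}$, such that $\delta\psi=\theta$. Given open covers $\{V_j\}_{j\in J}$ of $N$, $\{U_i\}_{i\in I}$ of $M$ and a map $r:I\to J$ with $\Phi(U_i)\subseteq V_{r(i)}$, a relative gerbe for $\Phi$ on these covers is a pair $(\mathcal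 L,\mathcal G)$, where $\mathcal G$ is a gerbe on $\{V_j\}$ and $\mathcal L$ is a quasi-line bundle for the pull-back $\Phi^*\mathcal G=(\Phi^*L_{r(i)r(i')},\Phi^*\theta)$ on $\{U_i\}$. The isomorphism classes of relative gerbes on given covers form an abelian group under the tensor product, and $Ger(\Phi)$ denotes the direct limit of these groups over all such pairs of covers under refinement. $Ger_0(\Phi)\subseteq Ger(\Phi)$ consists of the classes of the $(\mathcal L,\mathcal G)$ such that $\mathcal G$ admits a quasi-line bundle $\mathcal L'$ for which the line bundle $\mathcal L\otimes\Phi^*\mathcal L'^{-1}$ on $M$ admits a unitary section; call such $(\mathcal L,\mathcal G)$ trivial. Two relative gerbes are equivalent if, after restriction to a common refinement of their covers, the tensor product of the first with the dual of the second is trivial. $H^3(\Phi,\mathbb Z)$ is the degree-3 cohomology of the mapping cone $\check C^{n-1}(M,\mathbb Z)\oplus\check C^{n}(N,\mathbb Z)$, $d(\alpha,\beta)=(\Phi^*\beta-\delta\alpha,\delta\beta)$, of the Čech complexes with coefficients in the constant sheaf $\mathbb Z$ (direct limit over all pairs of covers as above). *Statement.* $Ger_0(\Phi)$ is a subgroup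 of $Ger(\Phi)$, and there is a short exact sequence of abelian groups $$0\longrightarrow Ger_0(\Phi)\hookrightarrow Ger(\Phi)\xrightarrow{\ \kappa\ }H^3(\Phi,\mathbb Z)\longrightarrow 0 .$$ The map $\kappa$ is given by the relative Dixmier–Douady class: after passing to a sufficiently fine pair of covers one can choose unitary sections $\sigma_{jj'}$ of $L_{jj'}$ and $\lambda_i$ of $E_i$ and smooth real cochains $a$ on $M$ and $b$ on $N$ with $\exp(2\pi\sqrt{-1}\,b)=t:=(\delta\sigma)\theta^{-1}$ and $\exp(2\pi\sqrt{-1}\,a)=s:=\psi^{-1}\big((\delta\lambda)^{-1}\otimes\Phi^*\sigma\big)$; and for every such choice $$\kappa(\mathcal L,\mathcal G)=[d(a,b)]=[(\Phi^*b-\delta a,\ \delta b)]\in H^3(\Phi,\mathbb Z),$$ the image of $[(s,t)]\in H^2(\Phi,\underline{U(1)})$ under the isomorphism given by the exponential sequence. Moreover a relative gerbe satisfies $\kappa(\mathcal L,\mathcal G)=0$ if and only if its restriction to some refinement of the covers is trivial; two relative gerbes have the same image under $\kappa$ if and only if they are equivalent; and every element of $H^3(\Phi,\mathbb Z)$ is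 the class of a relative gerbe. Hence $H^3(\Phi,\mathbb Z)$ classifies relative gerbes up to equivalence. -/

import Mathlib

open scoped Manifold ContDiff InnerProductSpace TensorProduct ComplexConjugate
open TopologicalSpace (Opens)

universe u

noncomputable section

namespace RelativeGerbe

/-! ### Hermitian lines -/

/-- A Hermitian line: a one-dimensional complex inner product space. -/
structure HermitianLine where
  carrier : Type
  [normedAddCommGroup : NormedAddCommGroup carrier]
  [innerProductSpace : InnerProductSpace ℂ carrier]
  finrank_eq : Module.finrank ℂ carrier = 1

namespace HermitianLine

attribute [instance] HermitianLine.normedAddCommGroup HermitianLine.innerProductSpace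

instance : CoeSort HermitianLine Type := ⟨HermitianLine.carrier⟩

instance (A : HermitianLine) : FiniteDimensional ℂ A :=
  Module.finite_of_finrank_eq_succ A.finrank_eq

instance (A : HermitianLine) : CompleteSpace A := FiniteDimensional.complete ℂ A

variable (A B C A' B' C' : HermitianLine)

/-- The trivial line `ℂ`. -/
def trivial : HermitianLine where
  carrier := ℂ
  finrank_eq := Module.finrank_self ℂ

/-- The tensor product of two Hermitian lines. -/
def tensor : HermitianLine where
  carrier := A ⊗[ℂ] B
  finrank_eq := by rw [Module.finrank_tensorProduct, A.finrank_eq, B.finrank_eq]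

/-- The Hermitian structure dual to that of `V`; it induces the usual (operator) norm. -/
abbrev dualInnerProductSpace (V : Type) [NormedAddCommGroup V] [InnerProductSpace ℂ V]
    [CompleteSpace V] : InnerProductSpace ℂ (StrongDual ℂ V) where
  inner f g := inner ℂ ((InnerProductSpace.toDual ℂ V).symm g)
    ((InnerProductSpace.toDual ℂ V).symm f)
  norm_sq_eq_re_inner f := by
    rw [← norm_sq_eq_re_inner, LinearIsometryEquiv.norm_map]
  conj_inner_symm f g := inner_conj_symm _ _
  add_left f g h := by simp only [map_add, inner_add_right]
  smul_left f g r := by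
    rw [LinearIsometryEquiv.map_smulₛₗ, inner_smul_right]

/-- The dual `A⁻¹ = A*` of a Hermitian line. -/
def dual : HermitianLine where
  carrier := StrongDual ℂ A
  innerProductSpace := dualInnerProductSpace A
  finrank_eq := by
    refine (LinearMap.toContinuousLinearMap (𝕜 := ℂ) (E := A) (F' := ℂ)).finrank_eq.symm.trans ?_
    exact (Subspace.dual_finrank_eq (K := ℂ) (V := A)).trans A.finrank_eq

variable {A B C A' B' C'}

/-- The pure tensor `a ⊗ b`. -/
def tmul (a : A) (b : B) : A.tensor B := a ⊗ₜ[ℂ] b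

/-- The covector `a⁻¹ = ⟪a, ·⟫`; for a unit vector `a` this is the dual basis vector. -/
def covec (a : A) : A.dual := InnerProductSpace.toDual ℂ A a

/-- The unit `1` of the trivial line. -/
def one : trivial := (1 : ℂ)

theorem inner_tmul (a a' : A) (b b' : B) :
    inner ℂ (tmul a b) (tmul a' b') = inner ℂ a a' * inner ℂ b b' := rfl

theorem inner_covec (a a' : A) : inner ℂ (covec a) (covec a') = inner ℂ a' a := by
  change inner ℂ ((InnerProductSpace.toDual ℂ A).symm (InnerProductSpace.toDual ℂ A a'))
    ((InnerProductSpace.toDual ℂ A).symm (InnerProductSpace.toDual ℂ A a)) = _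
  simp

theorem norm_tmul (a : A) (b : B) : ‖tmul a b‖ = ‖a‖ * ‖b‖ := TensorProduct.norm_tmul a b

theorem norm_covec (a : A) : ‖covec a‖ = ‖a‖ := (InnerProductSpace.toDual ℂ A).norm_map a

theorem norm_one : ‖one‖ = 1 := by
  change ‖(1 : ℂ)‖ = 1
  simp

theorem inner_one_one : inner ℂ one one = (1 : ℂ) := by
  rw [inner_self_eq_norm_sq_to_K, norm_one]; simp

theorem exists_unit (A : HermitianLine) : ∃ a : A, ‖a‖ = 1 := by
  have : Nontrivial A := Module.nontrivial_of_finrank_eq_succ (R := ℂ) A.finrank_eq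
  obtain ⟨x, hx⟩ := exists_ne (0 : A)
  refine ⟨((‖x‖ : ℂ)⁻¹) • x, ?_⟩
  rw [norm_smul, norm_inv, Complex.norm_real, norm_norm, inv_mul_cancel₀ (norm_ne_zero_iff.2 hx)]

/-- The unit vectors of a Hermitian line. -/
def UnitVec (A : HermitianLine) : Type := {a : A // ‖a‖ = 1}

/-- An auxiliary unit vector. -/
def unit (A : HermitianLine) : A := A.exists_unit.choose

theorem norm_unit (A : HermitianLine) : ‖A.unit‖ = 1 := A.exists_unit.choose_spec

theorem inner_smul_unit {w : A} (hw : ‖w‖ = 1) (x : A) : (inner ℂ w x : ℂ) • w = x := by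
  have hw0 : w ≠ 0 := by rintro rfl; simp at hw
  obtain ⟨c, rfl⟩ := (finrank_eq_one_iff_of_nonzero' w hw0).1 A.finrank_eq x
  rw [inner_smul_right, inner_self_eq_norm_sq_to_K, hw]; simp

theorem inner_mul_inner {w : A} (hw : ‖w‖ = 1) (x y : A) :
    (inner ℂ x w * inner ℂ w y : ℂ) = inner ℂ x y := by
  conv_rhs => rw [← inner_smul_unit hw y, inner_smul_right]
  ring

theorem norm_inner_of_unit {w : A} (hw : ‖w‖ = 1) (x : A) : ‖(inner ℂ w x : ℂ)‖ = ‖x‖ := by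
  conv_rhs => rw [← inner_smul_unit hw x, norm_smul, hw, mul_one]

theorem exists_tmul (t : A.tensor B) : ∃ a b, t = tmul a b := by
  refine ⟨(inner ℂ (tmul A.unit B.unit) t : ℂ) • A.unit, B.unit, ?_⟩
  have h : ‖tmul A.unit B.unit‖ = 1 := by simp [norm_tmul, norm_unit]
  conv_lhs => rw [← inner_smul_unit h t]
  exact (TensorProduct.smul_tmul' _ _ _).symm

theorem exists_unit_tmul (t : A.tensor B) (ht : ‖t‖ = 1) :
    ∃ a b, ‖a‖ = 1 ∧ ‖b‖ = 1 ∧ t = tmul a b := by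
  have h : ‖tmul A.unit B.unit‖ = 1 := by simp [norm_tmul, norm_unit]
  refine ⟨(inner ℂ (tmul A.unit B.unit) t : ℂ) • A.unit, B.unit, ?_, norm_unit B, ?_⟩
  · rw [norm_smul, norm_inner_of_unit h, ht, norm_unit, mul_one]
  · conv_lhs => rw [← inner_smul_unit h t]
    exact (TensorProduct.smul_tmul' _ _ _).symm

theorem exists_covec (t : A.dual) : ∃ a, t = covec a :=
  ⟨(InnerProductSpace.toDual ℂ A).symm t, ((InnerProductSpace.toDual ℂ A).apply_symm_apply t).symm⟩

theorem exists_unit_covec (t : A.dual) (ht : ‖t‖ = 1) : ∃ a, ‖a‖ = 1 ∧ t = covec a := by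
  obtain ⟨a, rfl⟩ := exists_covec t
  exact ⟨a, by rwa [norm_covec] at ht, rfl⟩

/-- The vector `a ⊗ b⁻¹ ⊗ c` of `A ⊗ B⁻¹ ⊗ C`. -/
def vec₃ (a : A) (b : B) (c : C) : (A.tensor B.dual).tensor C := tmul (tmul a (covec b)) c

/-- The vector `(a ⊗ b⁻¹)⁻¹ ⊗ c` of `(A ⊗ B⁻¹)⁻¹ ⊗ C`. -/
def vec₂ (a : A) (b : B) (c : C) : (A.tensor B.dual).dual.tensor C :=
  tmul (covec (tmul a (covec b))) c

theorem inner_vec₃ (a a' : A) (b b' : B) (c c' : C) :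
    inner ℂ (vec₃ a b c) (vec₃ a' b' c') = inner ℂ a a' * inner ℂ b' b * inner ℂ c c' := by
  simp only [vec₃, inner_tmul, inner_covec]

theorem inner_vec₂ (a a' : A) (b b' : B) (c c' : C) :
    inner ℂ (vec₂ a b c) (vec₂ a' b' c') = inner ℂ a' a * inner ℂ b b' * inner ℂ c c' := by
  simp only [vec₂, inner_tmul, inner_covec]

theorem norm_vec₃ (a : A) (b : B) (c : C) : ‖vec₃ a b c‖ = ‖a‖ * ‖b‖ * ‖c‖ := by
  simp only [vec₃, norm_tmul, norm_covec]

theorem norm_vec₂ (a : A) (b : B) (c : C) : ‖vec₂ a b c‖ = ‖a‖ * ‖b‖ * ‖c‖ := by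
  simp only [vec₂, norm_tmul, norm_covec]

theorem norm_vec₃_unit : ‖vec₃ A.unit B.unit C.unit‖ = 1 := by simp [norm_vec₃, norm_unit]

theorem norm_vec₂_unit : ‖vec₂ A.unit B.unit C.unit‖ = 1 := by simp [norm_vec₂, norm_unit]

/-- The product of `τ ∈ A ⊗ B⁻¹ ⊗ C` and `τ' ∈ A' ⊗ B'⁻¹ ⊗ C'`, i.e. the image of `τ ⊗ τ'` under
the canonical reordering isomorphism; it is characterised by `inner_mul₃` and does not depend on
the auxiliary unit vectors. -/
def mul₃ (τ : (A.tensor B.dual).tensor C) (τ' : (A'.tensor B'.dual).tensor C') :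
    ((A.tensor A').tensor (B.tensor B').dual).tensor (C.tensor C') :=
  ((inner ℂ (vec₃ A.unit B.unit C.unit) τ * inner ℂ (vec₃ A'.unit B'.unit C'.unit) τ' : ℂ)) •
    vec₃ (tmul A.unit A'.unit) (tmul B.unit B'.unit) (tmul C.unit C'.unit)

theorem inner_mul₃ (τ : (A.tensor B.dual).tensor C) (τ' : (A'.tensor B'.dual).tensor C')
    (a : A) (a' : A') (b : B) (b' : B') (c : C) (c' : C') :
    inner ℂ (vec₃ (tmul a a') (tmul b b') (tmul c c')) (mul₃ τ τ') =
      (inner ℂ (vec₃ a b c) τ * inner ℂ (vec₃ a' b' c') τ' : ℂ) := by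
  rw [mul₃, inner_smul_right, inner_vec₃, ← inner_mul_inner norm_vec₃_unit (vec₃ a b c) τ,
    ← inner_mul_inner norm_vec₃_unit (vec₃ a' b' c') τ']
  simp only [inner_vec₃, inner_tmul]
  ring

theorem norm_mul₃ (τ : (A.tensor B.dual).tensor C) (τ' : (A'.tensor B'.dual).tensor C')
    (h : ‖τ‖ = 1) (h' : ‖τ'‖ = 1) : ‖mul₃ τ τ'‖ = 1 := by
  rw [mul₃, norm_smul, norm_mul, norm_inner_of_unit norm_vec₃_unit,
    norm_inner_of_unit norm_vec₃_unit, norm_vec₃]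
  simp [norm_tmul, norm_unit, h, h']

/-- The inverse of a unit vector `τ ∈ A ⊗ B⁻¹ ⊗ C`, as a vector of `A⁻¹ ⊗ B⁻¹⁻¹ ⊗ C⁻¹`;
characterised by `inner_inv₃`. -/
def inv₃ (τ : (A.tensor B.dual).tensor C) : (A.dual.tensor B.dual.dual).tensor C.dual :=
  (conj (inner ℂ (vec₃ A.unit B.unit C.unit) τ : ℂ)) •
    vec₃ (covec A.unit) (covec B.unit) (covec C.unit)

theorem inner_inv₃ (τ : (A.tensor B.dual).tensor C) (a : A) (b : B) (c : C) :
    inner ℂ (vec₃ (covec a) (covec b) (covec c)) (inv₃ τ) =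
      conj (inner ℂ (vec₃ a b c) τ : ℂ) := by
  rw [inv₃, inner_smul_right, inner_vec₃, ← inner_mul_inner norm_vec₃_unit (vec₃ a b c) τ]
  simp only [inner_vec₃, inner_covec, map_mul, inner_conj_symm]
  ring

theorem norm_inv₃ (τ : (A.tensor B.dual).tensor C) (h : ‖τ‖ = 1) : ‖inv₃ τ‖ = 1 := by
  rw [inv₃, norm_smul, RCLike.norm_conj, norm_inner_of_unit norm_vec₃_unit, norm_vec₃]
  simp [norm_covec, norm_unit, h]

/-- The product of `τ ∈ (A ⊗ B⁻¹)⁻¹ ⊗ C` and `τ' ∈ (A' ⊗ B'⁻¹)⁻¹ ⊗ C'`, after canonical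
reordering; characterised by `inner_mul₂`. -/
def mul₂ (τ : (A.tensor B.dual).dual.tensor C) (τ' : (A'.tensor B'.dual).dual.tensor C') :
    ((A.tensor A').tensor (B.tensor B').dual).dual.tensor (C.tensor C') :=
  ((inner ℂ (vec₂ A.unit B.unit C.unit) τ * inner ℂ (vec₂ A'.unit B'.unit C'.unit) τ' : ℂ)) •
    vec₂ (tmul A.unit A'.unit) (tmul B.unit B'.unit) (tmul C.unit C'.unit)

theorem inner_mul₂ (τ : (A.tensor B.dual).dual.tensor C)
    (τ' : (A'.tensor B'.dual).dual.tensor C')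
    (a : A) (a' : A') (b : B) (b' : B') (c : C) (c' : C') :
    inner ℂ (vec₂ (tmul a a') (tmul b b') (tmul c c')) (mul₂ τ τ') =
      (inner ℂ (vec₂ a b c) τ * inner ℂ (vec₂ a' b' c') τ' : ℂ) := by
  rw [mul₂, inner_smul_right, inner_vec₂, ← inner_mul_inner norm_vec₂_unit (vec₂ a b c) τ,
    ← inner_mul_inner norm_vec₂_unit (vec₂ a' b' c') τ']
  simp only [inner_vec₂, inner_tmul]
  ring

theorem norm_mul₂ (τ : (A.tensor B.dual).dual.tensor C) (τ' : (A'.tensor B'.dual).dual.tensor C')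
    (h : ‖τ‖ = 1) (h' : ‖τ'‖ = 1) : ‖mul₂ τ τ'‖ = 1 := by
  rw [mul₂, norm_smul, norm_mul, norm_inner_of_unit norm_vec₂_unit,
    norm_inner_of_unit norm_vec₂_unit, norm_vec₂]
  simp [norm_tmul, norm_unit, h, h']

/-- The inverse of a unit vector `τ ∈ (A ⊗ B⁻¹)⁻¹ ⊗ C`; characterised by `inner_inv₂`. -/
def inv₂ (τ : (A.tensor B.dual).dual.tensor C) : (A.dual.tensor B.dual.dual).dual.tensor C.dual :=
  (conj (inner ℂ (vec₂ A.unit B.unit C.unit) τ : ℂ)) •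
    vec₂ (covec A.unit) (covec B.unit) (covec C.unit)

theorem inner_inv₂ (τ : (A.tensor B.dual).dual.tensor C) (a : A) (b : B) (c : C) :
    inner ℂ (vec₂ (covec a) (covec b) (covec c)) (inv₂ τ) =
      conj (inner ℂ (vec₂ a b c) τ : ℂ) := by
  rw [inv₂, inner_smul_right, inner_vec₂, ← inner_mul_inner norm_vec₂_unit (vec₂ a b c) τ]
  simp only [inner_vec₂, inner_covec, map_mul, inner_conj_symm]
  ring

theorem norm_inv₂ (τ : (A.tensor B.dual).dual.tensor C) (h : ‖τ‖ = 1) : ‖inv₂ τ‖ = 1 := by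
  rw [inv₂, norm_smul, RCLike.norm_conj, norm_inner_of_unit norm_vec₂_unit, norm_vec₂]
  simp [norm_covec, norm_unit, h]

/-- The isometry of Hermitian lines which takes the unit vector `w` to the unit vector `w'`. -/
def isoOfUnit (w : A) (w' : B) (hw : ‖w‖ = 1) (hw' : ‖w'‖ = 1) : A ≃ₗᵢ[ℂ] B where
  toFun x := (inner ℂ w x : ℂ) • w'
  invFun y := (inner ℂ w' y : ℂ) • w
  map_add' x y := by rw [inner_add_right, add_smul]
  map_smul' r x := by simp [mul_smul]
  left_inv x := by
    simp only [inner_smul_right, inner_self_eq_norm_sq_to_K, hw']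
    simp [inner_smul_unit hw]
  right_inv x := by
    simp only [inner_smul_right, inner_self_eq_norm_sq_to_K, hw]
    simp [inner_smul_unit hw']
  norm_map' x := by
    change ‖(inner ℂ w x : ℂ) • w'‖ = _
    rw [norm_smul, hw', mul_one, norm_inner_of_unit hw]

theorem inner_isoOfUnit (w : A) (w' : B) (hw : ‖w‖ = 1) (hw' : ‖w'‖ = 1) (x : A) (y : B) :
    inner ℂ y (isoOfUnit w w' hw hw' x) = (inner ℂ y w' * inner ℂ w x : ℂ) := by
  change inner ℂ y ((inner ℂ w x : ℂ) • w') = _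
  rw [inner_smul_right]; ring

end HermitianLine

open HermitianLine

/-! ### Hermitian line bundles -/

section Bundles

variable (E : Type*) [NormedAddCommGroup E] [NormedSpace ℝ E]
  (X : Type u) [TopologicalSpace X] [ChartedSpace E X]

/-- A smooth Hermitian line bundle on the manifold `X` (modelled on `E`): a family of Hermitian
lines with a smooth structure, given by local unitary frames whose transition functions are
smooth. (A frame is written as a section on all of `X`; only its values on its domain matter. For
unit vectors `e, e'` of a Hermitian line, `e' = ⟪e, e'⟫ e`.) -/
structure HermitianLineBundle where
  fiber : X → HermitianLine
  frames : Set (Opens X × (∀ x, fiber x))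
  norm_frame : ∀ e ∈ frames, ∀ x ∈ e.1, ‖e.2 x‖ = 1
  exists_frame : ∀ x, ∃ e ∈ frames, x ∈ e.1
  smooth_transition : ∀ e ∈ frames, ∀ e' ∈ frames,
    ContMDiffOn 𝓘(ℝ, E) 𝓘(ℝ, ℂ) ∞ (fun x => inner ℂ (e.2 x) (e'.2 x)) (e.1 ∩ e'.1)

variable {E X}

/-- A smooth unitary section of a Hermitian line bundle. -/
structure UnitarySection (L : HermitianLineBundle E X) where
  val : ∀ x, L.fiber x
  norm_eq : ∀ x, ‖val x‖ = 1
  smooth : ∀ e ∈ L.frames,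
    ContMDiffOn 𝓘(ℝ, E) 𝓘(ℝ, ℂ) ∞ (fun x => inner ℂ (e.2 x) (val x)) e.1

/-- The value of a unitary section, as a unit vector. -/
def UnitarySection.unitVal {L : HermitianLineBundle E X} (σ : UnitarySection L) (x : X) :
    (L.fiber x).UnitVec :=
  ⟨σ.val x, σ.norm_eq x⟩

/-- An isomorphism (fibrewise unitary, smooth) of Hermitian line bundles. -/
structure BundleIso (L L' : HermitianLineBundle E X) where
  map : ∀ x, L.fiber x ≃ₗᵢ[ℂ] L'.fiber x
  smooth : ∀ e ∈ L.frames, ∀ e' ∈ L'.frames,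
    ContMDiffOn 𝓘(ℝ, E) 𝓘(ℝ, ℂ) ∞ (fun x => inner ℂ (e'.2 x) (map x (e.2 x))) (e.1 ∩ e'.1)

theorem smooth_conj {f : X → ℂ} {S : Set X} (hf : ContMDiffOn 𝓘(ℝ, E) 𝓘(ℝ, ℂ) ∞ f S) :
    ContMDiffOn 𝓘(ℝ, E) 𝓘(ℝ, ℂ) ∞ (fun x => conj (f x)) S :=
  (Complex.conjCLE.contDiff.contMDiff (n := ∞)).comp_contMDiffOn hf

theorem smooth_mul {f g : X → ℂ} {S : Set X} (hf : ContMDiffOn 𝓘(ℝ, E) 𝓘(ℝ, ℂ) ∞ f S)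
    (hg : ContMDiffOn 𝓘(ℝ, E) 𝓘(ℝ, ℂ) ∞ g S) :
    ContMDiffOn 𝓘(ℝ, E) 𝓘(ℝ, ℂ) ∞ (fun x => f x * g x) S :=
  ((contDiff_mul (𝕜 := ℝ) (𝔸 := ℂ)).contMDiff (n := ∞)).comp_contMDiffOn (hf.prodMk_space hg)

theorem smooth_inner_comm {A : X → HermitianLine} {a b : ∀ x, A x} {S : Set X}
    (h : ContMDiffOn 𝓘(ℝ, E) 𝓘(ℝ, ℂ) ∞ (fun x => inner ℂ (a x) (b x)) S) :
    ContMDiffOn 𝓘(ℝ, E) 𝓘(ℝ, ℂ) ∞ (fun x => inner ℂ (b x) (a x)) S :=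
  (smooth_conj h).congr fun _ _ => (inner_conj_symm _ _).symm

namespace HermitianLineBundle

/-- The trivial line bundle `X × ℂ`. -/
def trivial : HermitianLineBundle E X where
  fiber _ := HermitianLine.trivial
  frames := {(⊤, fun _ => one)}
  norm_frame := by rintro e rfl x -; exact HermitianLine.norm_one
  exists_frame x := ⟨_, rfl, Set.mem_univ x⟩
  smooth_transition := by
    rintro e rfl e' rfl
    simp only [inner_one_one]
    exact contMDiffOn_const

/-- The tensor product of line bundles. -/
def tensor (L L' : HermitianLineBundle E X) : HermitianLineBundle E X where
  fiber x := (L.fiber x).tensor (L'.fiber x)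
  frames := {e | ∃ a ∈ L.frames, ∃ b ∈ L'.frames, e = (a.1 ⊓ b.1, fun x => tmul (a.2 x) (b.2 x))}
  norm_frame := by
    rintro _ ⟨a, ha, b, hb, rfl⟩ x hx
    rw [norm_tmul, L.norm_frame a ha x hx.1, L'.norm_frame b hb x hx.2, mul_one]
  exists_frame x := by
    obtain ⟨a, ha, hxa⟩ := L.exists_frame x
    obtain ⟨b, hb, hxb⟩ := L'.exists_frame x
    exact ⟨_, ⟨a, ha, b, hb, rfl⟩, hxa, hxb⟩
  smooth_transition := by
    rintro _ ⟨a, ha, b, hb, rfl⟩ _ ⟨a', ha', b', hb', rfl⟩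
    simp only [inner_tmul]
    exact smooth_mul ((L.smooth_transition a ha a' ha').mono fun x hx => ⟨hx.1.1, hx.2.1⟩)
      ((L'.smooth_transition b hb b' hb').mono fun x hx => ⟨hx.1.2, hx.2.2⟩)

/-- The dual line bundle `L⁻¹`. -/
def dual (L : HermitianLineBundle E X) : HermitianLineBundle E X where
  fiber x := (L.fiber x).dual
  frames := {e | ∃ a ∈ L.frames, e = (a.1, fun x => covec (a.2 x))}
  norm_frame := by
    rintro _ ⟨a, ha, rfl⟩ x hx
    rw [norm_covec, L.norm_frame a ha x hx]
  exists_frame x := by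
    obtain ⟨a, ha, hxa⟩ := L.exists_frame x
    exact ⟨_, ⟨a, ha, rfl⟩, hxa⟩
  smooth_transition := by
    rintro _ ⟨a, ha, rfl⟩ _ ⟨a', ha', rfl⟩
    simp only [inner_covec]
    exact (L.smooth_transition a' ha' a ha).mono fun x hx => ⟨hx.2, hx.1⟩

variable {F : Type*} [NormedAddCommGroup F] [NormedSpace ℝ F]
  {Y : Type u} [TopologicalSpace Y] [ChartedSpace F Y]

/-- The pull-back of a line bundle along a smooth map. -/
def pullback (L : HermitianLineBundle F Y) (f : C^∞⟮𝓘(ℝ, E), X; 𝓘(ℝ, F), Y⟯) :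
    HermitianLineBundle E X where
  fiber x := L.fiber (f x)
  frames := {e | ∃ a ∈ L.frames,
    e = (Opens.comap ⟨f, f.contMDiff.continuous⟩ a.1, fun x => a.2 (f x))}
  norm_frame := by
    rintro _ ⟨a, ha, rfl⟩ x hx
    exact L.norm_frame a ha (f x) hx
  exists_frame x := by
    obtain ⟨a, ha, hxa⟩ := L.exists_frame (f x)
    exact ⟨_, ⟨a, ha, rfl⟩, hxa⟩
  smooth_transition := by
    rintro _ ⟨a, ha, rfl⟩ _ ⟨a', ha', rfl⟩
    exact (L.smooth_transition a ha a' ha').comp f.contMDiff.contMDiffOn fun x hx => hx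

end HermitianLineBundle

end Bundles

/-! ### Covers, restriction maps -/

section Covers

variable {E : Type*} [NormedAddCommGroup E] [NormedSpace ℝ E]
  {X : Type u} [TopologicalSpace X] [ChartedSpace E X]
  {F : Type*} [NormedAddCommGroup F] [NormedSpace ℝ F]
  {Y : Type u} [TopologicalSpace Y] [ChartedSpace F Y]
  {ι κ : Type u}

/-- The intersection `U_{s 0} ∩ ⋯ ∩ U_{s (n-1)}`. -/
def inter (U : ι → Opens X) {n : ℕ} (s : Fin n → ι) : Opens X where
  carrier := {x | ∀ k, x ∈ U (s k)}
  is_open' := by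
    simp only [Set.ofPred_forall]
    exact isOpen_iInter_of_finite fun k => (U (s k)).isOpen

/-- The inclusion of intersections, given by forgetting or repeating indices. With
`v = Fin.succAbove k` this is the inclusion `δ_k` which omits the `k`-th index. -/
def restr (U : ι → Opens X) {m n : ℕ} (s : Fin n → ι) (v : Fin m → Fin n) :
    C^∞⟮𝓘(ℝ, E), inter U s; 𝓘(ℝ, E), inter U (s ∘ v)⟯ where
  val x := ⟨x.1, fun k => x.2 (v k)⟩
  property := contMDiff_inclusion (U := inter U s) (V := inter U (s ∘ v)) fun _ hx k => hx (v k)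

/-- The inclusion of an intersection into one of its members. -/
def restrVertex (U : ι → Opens X) {n : ℕ} (s : Fin n → ι) (k : Fin n) :
    C^∞⟮𝓘(ℝ, E), inter U s; 𝓘(ℝ, E), U (s k)⟯ where
  val x := ⟨x.1, x.2 k⟩
  property := contMDiff_inclusion (U := inter U s) (V := U (s k)) fun _ hx => hx k

/-- A smooth map restricted to open subsets. -/
def restrictOpens (f : C^∞⟮𝓘(ℝ, E), X; 𝓘(ℝ, F), Y⟯) (U : Opens X) (V : Opens Y)
    (h : ∀ x ∈ U, f x ∈ V) : C^∞⟮𝓘(ℝ, E), U; 𝓘(ℝ, F), V⟯ where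
  val x := ⟨f x.1, h x.1 x.2⟩
  property := by
    have h1 : ContMDiff 𝓘(ℝ, E) 𝓘(ℝ, F) ∞ (fun x : U => f x.1) :=
      f.contMDiff.comp contMDiff_subtype_val
    exact (ContMDiff.subtypeVal_comp_iff V _).1 h1

end Covers

/-! ### Gerbes and quasi-line bundles -/

section Gerbes

variable {E : Type*} [NormedAddCommGroup E] [NormedSpace ℝ E]
  {X : Type u} [TopologicalSpace X] [ChartedSpace E X]
  {F : Type*} [NormedAddCommGroup F] [NormedSpace ℝ F]
  {Y : Type u} [TopologicalSpace Y] [ChartedSpace F Y]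
  {ι κ : Type u}

/-- The multiplicative Čech coboundary, evaluated on a simplex with vertices `0, 1, 2`. -/
def delta₁ (p : (Fin 2 → Fin 3) → ℂ) : ℂ :=
  p (Fin.succAbove 0) * (p (Fin.succAbove 1))⁻¹ * p (Fin.succAbove 2)

/-- The multiplicative Čech coboundary, evaluated on a simplex with vertices `0, 1, 2, 3`. -/
def delta₂ (c : (Fin 3 → Fin 4) → ℂ) : ℂ :=
  c (Fin.succAbove 0) * (c (Fin.succAbove 1))⁻¹ * c (Fin.succAbove 2) * (c (Fin.succAbove 3))⁻¹

/-- The line bundle `(δL)_{ijk} = L_{jk} ⊗ L_{ik}⁻¹ ⊗ L_{ij}` on `U_{ijk}`, `s = (i, j, k)`. -/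
def deltaL (U : ι → Opens X) (L : ∀ s : Fin 2 → ι, HermitianLineBundle E (inter U s))
    (s : Fin 3 → ι) : HermitianLineBundle E (inter U s) :=
  (((L (s ∘ Fin.succAbove 0)).pullback (restr U s (Fin.succAbove 0))).tensor
    ((L (s ∘ Fin.succAbove 1)).pullback (restr U s (Fin.succAbove 1))).dual).tensor
      ((L (s ∘ Fin.succAbove 2)).pullback (restr U s (Fin.succAbove 2)))

/-- The line bundle `(δE)_{ij} = E_j ⊗ E_i⁻¹` on `U_{ij}`, `s = (i, j)`. -/
def deltaE (U : ι → Opens X) (B : ∀ i, HermitianLineBundle E (U i))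
    (s : Fin 2 → ι) : HermitianLineBundle E (inter U s) :=
  ((B (s 1)).pullback (restrVertex U s 1)).tensor ((B (s 0)).pullback (restrVertex U s 0)).dual

/-- The coefficient of `θ_x` with respect to `a ⊗ b⁻¹ ⊗ c`, where `a ∈ L_{jk}`, `b ∈ L_{ik}`,
`c ∈ L_{ij}` at the point `x`. -/
def coefL {U : ι → Opens X} {L : ∀ s : Fin 2 → ι, HermitianLineBundle E (inter U s)}
    {s : Fin 3 → ι} (θ : UnitarySection (deltaL U L s)) (x : inter U s)
    (a : (L (s ∘ Fin.succAbove 0)).fiber (restr (E := E) U s (Fin.succAbove 0) x))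
    (b : (L (s ∘ Fin.succAbove 1)).fiber (restr (E := E) U s (Fin.succAbove 1) x))
    (c : (L (s ∘ Fin.succAbove 2)).fiber (restr (E := E) U s (Fin.succAbove 2) x)) : ℂ :=
  inner ℂ (vec₃ a b c) (θ.val x)

theorem mem_frames_deltaL {U : ι → Opens X} {L : ∀ s : Fin 2 → ι, HermitianLineBundle E (inter U s)}
    {s : Fin 3 → ι} {a b c}
    (ha : a ∈ (L (s ∘ Fin.succAbove 0)).frames) (hb : b ∈ (L (s ∘ Fin.succAbove 1)).frames)
    (hc : c ∈ (L (s ∘ Fin.succAbove 2)).frames) :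
    ((Opens.comap ⟨_, (restr (E := E) U s (Fin.succAbove 0)).contMDiff.continuous⟩ a.1 ⊓
      Opens.comap ⟨_, (restr (E := E) U s (Fin.succAbove 1)).contMDiff.continuous⟩ b.1) ⊓
      Opens.comap ⟨_, (restr (E := E) U s (Fin.succAbove 2)).contMDiff.continuous⟩ c.1,
      fun x => vec₃ (a.2 (restr (E := E) U s _ x))
      (b.2 (restr (E := E) U s _ x)) (c.2 (restr (E := E) U s _ x))) ∈ (deltaL U L s).frames :=
  ⟨_, ⟨_, ⟨a, ha, rfl⟩, _, ⟨_, ⟨b, hb, rfl⟩, rfl⟩, rfl⟩, _, ⟨c, hc, rfl⟩, rfl⟩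

theorem smooth_deltaL {U : ι → Opens X} {L : ∀ s : Fin 2 → ι, HermitianLineBundle E (inter U s)}
    {s : Fin 3 → ι} (θ : UnitarySection (deltaL U L s))
    {a b c} (ha : a ∈ (L (s ∘ Fin.succAbove 0)).frames) (hb : b ∈ (L (s ∘ Fin.succAbove 1)).frames)
    (hc : c ∈ (L (s ∘ Fin.succAbove 2)).frames) :
    ContMDiffOn 𝓘(ℝ, E) 𝓘(ℝ, ℂ) ∞ (fun x => coefL θ x (a.2 (restr (E := E) U s _ x))
      (b.2 (restr (E := E) U s _ x)) (c.2 (restr (E := E) U s _ x)))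
      {x | (restr (E := E) U s (Fin.succAbove 0) x ∈ a.1 ∧
        restr (E := E) U s (Fin.succAbove 1) x ∈ b.1) ∧
        restr (E := E) U s (Fin.succAbove 2) x ∈ c.1} := by
  have h := (θ.smooth _ (mem_frames_deltaL ha hb hc)).mono
    (s := {x | (restr (E := E) U s (Fin.succAbove 0) x ∈ a.1 ∧
      restr (E := E) U s (Fin.succAbove 1) x ∈ b.1) ∧
      restr (E := E) U s (Fin.succAbove 2) x ∈ c.1}) fun x hx => hx
  exact h

/-- A unitary section of `δL` from its values. -/
def mkSectionL {U : ι → Opens X} {L : ∀ s : Fin 2 → ι, HermitianLineBundle E (inter U s)}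
    {s : Fin 3 → ι} (val : ∀ x, (deltaL U L s).fiber x) (norm_eq : ∀ x, ‖val x‖ = 1)
    (smooth : ∀ a ∈ (L (s ∘ Fin.succAbove 0)).frames, ∀ b ∈ (L (s ∘ Fin.succAbove 1)).frames,
      ∀ c ∈ (L (s ∘ Fin.succAbove 2)).frames,
      ContMDiffOn 𝓘(ℝ, E) 𝓘(ℝ, ℂ) ∞ (fun x => inner ℂ (vec₃ (a.2 (restr (E := E) U s _ x))
        (b.2 (restr (E := E) U s _ x)) (c.2 (restr (E := E) U s _ x))) (val x))
      {x | (restr (E := E) U s (Fin.succAbove 0) x ∈ a.1 ∧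
        restr (E := E) U s (Fin.succAbove 1) x ∈ b.1) ∧
        restr (E := E) U s (Fin.succAbove 2) x ∈ c.1}) :
    UnitarySection (deltaL U L s) where
  val := val
  norm_eq := norm_eq
  smooth := by
    rintro _ ⟨_, ⟨_, ⟨a, ha, rfl⟩, _, ⟨_, ⟨b, hb, rfl⟩, rfl⟩, rfl⟩, _, ⟨c, hc, rfl⟩, rfl⟩
    have h := smooth a ha b hb c hc
    exact h.mono fun x hx => hx

/-- A gerbe on the open cover `U`: Hermitian line bundles `L_{ij}` on `U_{ij}` and unitary sections
`θ_{ijk}` of `(δL)_{ijk}` such that `δθ = 1` on quadruple intersections. As `δδL` is canonically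
trivial, `δθ` is a function: it is the Čech coboundary of the coefficients of `θ` with respect to
any choice `ℓ` of unit vectors in the lines `L_{ij}` at the point under consideration.
(The isomorphisms `L_{ij} ≅ L_{ji}⁻¹` are induced by `θ_{iji}` and `θ_{iii}`.) -/
structure Gerbe (E : Type*) [NormedAddCommGroup E] [NormedSpace ℝ E]
    {X : Type u} [TopologicalSpace X] [ChartedSpace E X] (U : ι → Opens X) where
  L : ∀ s : Fin 2 → ι, HermitianLineBundle E (inter U s)
  θ : ∀ s : Fin 3 → ι, UnitarySection (deltaL U L s)
  cocycle : ∀ (s : Fin 4 → ι) (x : inter U s)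
    (ℓ : ∀ e : Fin 2 → Fin 4, (L (s ∘ e)).fiber (restr (E := E) U s e x)), (∀ e, ‖ℓ e‖ = 1) →
    delta₂ (fun v => coefL (θ (s ∘ v)) (restr (E := E) U s v x) (ℓ (v ∘ Fin.succAbove 0))
      (ℓ (v ∘ Fin.succAbove 1)) (ℓ (v ∘ Fin.succAbove 2))) = 1

/-- The coefficient of `ψ_x` with respect to `(a ⊗ b⁻¹)⁻¹ ⊗ c`, where `a ∈ E_j`, `b ∈ E_i`,
`c ∈ L_{ij}` at the point `x`. -/
def coefE {U : ι → Opens X} {B : ∀ i, HermitianLineBundle E (U i)}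
    {s : Fin 2 → ι} {L : HermitianLineBundle E (inter U s)}
    (ψ : UnitarySection ((deltaE U B s).dual.tensor L)) (x : inter U s)
    (a : (B (s 1)).fiber (restrVertex (E := E) U s 1 x))
    (b : (B (s 0)).fiber (restrVertex (E := E) U s 0 x)) (c : L.fiber x) : ℂ :=
  inner ℂ (vec₂ a b c) (ψ.val x)

/-- A quasi-line bundle for the gerbe `G`: Hermitian line bundles `E_i` on `U_i` and unitary
sections `ψ_{ij}` of `(δE)_{ij}⁻¹ ⊗ L_{ij}` such that `δψ = θ`, under the canonical isomorphism
`δ(δE⁻¹ ⊗ L) = δL`; that is, with respect to any unit vectors in the lines involved, the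
coefficients of `θ` are the Čech coboundary of those of `ψ`. -/
structure QuasiLineBundle {U : ι → Opens X} (G : Gerbe E U) where
  B : ∀ i, HermitianLineBundle E (U i)
  ψ : ∀ s : Fin 2 → ι, UnitarySection ((deltaE U B s).dual.tensor (G.L s))
  delta_eq : ∀ (s : Fin 3 → ι) (x : inter U s)
    (e : ∀ a, (B (s a)).fiber (restrVertex (E := E) U s a x))
    (ℓ : ∀ v : Fin 2 → Fin 3, (G.L (s ∘ v)).fiber (restr (E := E) U s v x)),
    (∀ a, ‖e a‖ = 1) → (∀ v, ‖ℓ v‖ = 1) →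
    delta₁ (fun v => coefE (ψ (s ∘ v)) (restr (E := E) U s v x) (e (v 1)) (e (v 0)) (ℓ v)) =
      coefL (G.θ s) x (ℓ (Fin.succAbove 0)) (ℓ (Fin.succAbove 1)) (ℓ (Fin.succAbove 2))

variable {U : ι → Opens X} {V : κ → Opens Y}

/-- The smooth map `U_s → V_{k ∘ s}` induced by `f`, if `f(U_i) ⊆ V_{k i}` for all `i`. -/
def mapInter (f : C^∞⟮𝓘(ℝ, E), X; 𝓘(ℝ, F), Y⟯) (k : ι → κ) (h : ∀ i, ∀ x ∈ U i, f x ∈ V (k i))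
    {n : ℕ} (s : Fin n → ι) : C^∞⟮𝓘(ℝ, E), inter U s; 𝓘(ℝ, F), inter V (k ∘ s)⟯ :=
  restrictOpens f _ _ fun x hx a => h (s a) x (hx a)

theorem smooth_comp (f : C^∞⟮𝓘(ℝ, E), X; 𝓘(ℝ, F), Y⟯) {g : Y → ℂ} {S : Set Y}
    (hg : ContMDiffOn 𝓘(ℝ, F) 𝓘(ℝ, ℂ) ∞ g S) :
    ContMDiffOn 𝓘(ℝ, E) 𝓘(ℝ, ℂ) ∞ (fun x => g (f x)) (f ⁻¹' S) :=
  hg.comp f.contMDiff.contMDiffOn fun _ hx => hx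

theorem cocycle_mul {c c' d : (Fin 3 → Fin 4) → ℂ} (hc : delta₂ c = 1) (hc' : delta₂ c' = 1)
    (h : ∀ v, d v = c v * c' v) : delta₂ d = 1 := by
  rw [← mul_one (1 : ℂ)]
  nth_rw 1 [← hc]
  rw [← hc']
  simp only [delta₂, h, mul_inv]
  ring

theorem cocycle_conj {c d : (Fin 3 → Fin 4) → ℂ} (hc : delta₂ c = 1)
    (h : ∀ v, d v = conj (c v)) : delta₂ d = 1 := by
  have := congrArg conj hc
  simpa only [delta₂, h, map_mul, map_inv₀, map_one] using this

theorem cocycle_of_unit {c : (Fin 3 → Fin 4) → ℂ} (z : (Fin 2 → Fin 4) → ℂ) (hz : ∀ e, ‖z e‖ = 1)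
    (h : ∀ v, c v = conj (z (v ∘ Fin.succAbove 0)) * z (v ∘ Fin.succAbove 1) *
      conj (z (v ∘ Fin.succAbove 2))) :
    delta₂ c = 1 := by
  have h0 : ∀ e, z e ≠ 0 := fun e he => by simpa [he] using hz e
  have hz' : ∀ e, conj (z e) = (z e)⁻¹ := fun e => by
    rw [Complex.inv_def, Complex.normSq_eq_norm_sq, hz]; simp
  have e1 : (Fin.succAbove (1 : Fin 4)) ∘ Fin.succAbove (0 : Fin 3) =
    Fin.succAbove 0 ∘ Fin.succAbove 0 := by decide
  have e2 : (Fin.succAbove (2 : Fin 4)) ∘ Fin.succAbove (0 : Fin 3) =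
    Fin.succAbove 0 ∘ Fin.succAbove 1 := by decide
  have e3 : (Fin.succAbove (3 : Fin 4)) ∘ Fin.succAbove (0 : Fin 3) =
    Fin.succAbove 0 ∘ Fin.succAbove 2 := by decide
  have e4 : (Fin.succAbove (2 : Fin 4)) ∘ Fin.succAbove (1 : Fin 3) =
    Fin.succAbove 1 ∘ Fin.succAbove 1 := by decide
  have e5 : (Fin.succAbove (3 : Fin 4)) ∘ Fin.succAbove (1 : Fin 3) =
    Fin.succAbove 1 ∘ Fin.succAbove 2 := by decide
  have e6 : (Fin.succAbove (3 : Fin 4)) ∘ Fin.succAbove (2 : Fin 3) =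
    Fin.succAbove 2 ∘ Fin.succAbove 2 := by decide
  simp only [delta₂, h, e1, e2, e3, e4, e5, e6, hz']
  generalize Fin.succAbove (0 : Fin 4) ∘ Fin.succAbove (0 : Fin 3) = v1
  generalize Fin.succAbove (0 : Fin 4) ∘ Fin.succAbove (1 : Fin 3) = v2
  generalize Fin.succAbove (0 : Fin 4) ∘ Fin.succAbove (2 : Fin 3) = v3
  generalize Fin.succAbove (1 : Fin 4) ∘ Fin.succAbove (1 : Fin 3) = v4
  generalize Fin.succAbove (1 : Fin 4) ∘ Fin.succAbove (2 : Fin 3) = v5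
  generalize Fin.succAbove (2 : Fin 4) ∘ Fin.succAbove (2 : Fin 3) = v6
  have := h0 v1; have := h0 v2; have := h0 v3; have := h0 v4; have := h0 v5; have := h0 v6
  field_simp

theorem inner_vec₃_one : inner ℂ (vec₃ one one one) (vec₃ one one one) = (1 : ℂ) := by
  rw [inner_vec₃, inner_one_one, mul_one, mul_one]

theorem inner_vec₂_one : inner ℂ (vec₂ one one one) (vec₂ one one one) = (1 : ℂ) := by
  rw [inner_vec₂, inner_one_one, mul_one, mul_one]

theorem norm_inner_one {z : HermitianLine.trivial} (hz : ‖z‖ = 1) : ‖(inner ℂ one z : ℂ)‖ = 1 := by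
  rw [norm_inner_of_unit HermitianLine.norm_one, hz]

/-- The line bundles `f^* L_{k i, k j}`. -/
def Gerbe.pullbackL (G : Gerbe F V) (f : C^∞⟮𝓘(ℝ, E), X; 𝓘(ℝ, F), Y⟯) (k : ι → κ)
    (h : ∀ i, ∀ x ∈ U i, f x ∈ V (k i)) (s : Fin 2 → ι) : HermitianLineBundle E (inter U s) :=
  (G.L (k ∘ s)).pullback (mapInter f k h s)

/-- The values of the sections `f^* θ`, as unit vectors. -/
def Gerbe.pullbackVal (G : Gerbe F V) (f : C^∞⟮𝓘(ℝ, E), X; 𝓘(ℝ, F), Y⟯) (k : ι → κ)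
    (h : ∀ i, ∀ x ∈ U i, f x ∈ V (k i)) (s : Fin 3 → ι) (x : inter U s) :
    ((deltaL U (G.pullbackL f k h) s).fiber x).UnitVec :=
  (G.θ (k ∘ s)).unitVal (mapInter f k h s x)

/-- The sections `f^* θ`. -/
def Gerbe.pullbackθ (G : Gerbe F V) (f : C^∞⟮𝓘(ℝ, E), X; 𝓘(ℝ, F), Y⟯) (k : ι → κ)
    (h : ∀ i, ∀ x ∈ U i, f x ∈ V (k i)) (s : Fin 3 → ι) :
    UnitarySection (deltaL U (G.pullbackL f k h) s) :=
  mkSectionL (fun x => (G.pullbackVal f k h s x).1)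
    (fun x => (G.pullbackVal f k h s x).2) <| by
      rintro _ ⟨a, ha, rfl⟩ _ ⟨b, hb, rfl⟩ _ ⟨c, hc, rfl⟩
      have := smooth_comp (mapInter f k h s) (smooth_deltaL (G.θ (k ∘ s)) ha hb hc)
      have := this.mono (s := {x | (restr (E := E) U s (Fin.succAbove 0) x ∈ Opens.comap
            ⟨_, (mapInter (V := V) f k h (s ∘ Fin.succAbove 0)).contMDiff.continuous⟩ a.1 ∧
          restr (E := E) U s (Fin.succAbove 1) x ∈ Opens.comap
            ⟨_, (mapInter (V := V) f k h (s ∘ Fin.succAbove 1)).contMDiff.continuous⟩ b.1) ∧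
          restr (E := E) U s (Fin.succAbove 2) x ∈ Opens.comap
            ⟨_, (mapInter (V := V) f k h (s ∘ Fin.succAbove 2)).contMDiff.continuous⟩ c.1})
        fun x hx => hx
      exact this

theorem Gerbe.coefL_pullbackθ (G : Gerbe F V) (f : C^∞⟮𝓘(ℝ, E), X; 𝓘(ℝ, F), Y⟯) (k : ι → κ)
    (h : ∀ i, ∀ x ∈ U i, f x ∈ V (k i)) (s : Fin 3 → ι) (x : inter U s) (a b c) :
    coefL (G.pullbackθ f k h s) x a b c = coefL (G.θ (k ∘ s)) (mapInter f k h s x) a b c := rfl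

/-- The pull-back of a gerbe on the cover `V` of `Y` along a smooth map `f : X → Y`, with respect
to a cover `U` of `X` such that `f(U_i) ⊆ V_{k i}`: the bundles are `f^* L_{k i, k j}`, the sections
`f^* θ`. For `f = id` this is the restriction of a gerbe to a refined cover. -/
def Gerbe.pullback (G : Gerbe F V) (f : C^∞⟮𝓘(ℝ, E), X; 𝓘(ℝ, F), Y⟯) (k : ι → κ)
    (h : ∀ i, ∀ x ∈ U i, f x ∈ V (k i)) : Gerbe E U where
  L := G.pullbackL f k h
  θ s := G.pullbackθ f k h s
  cocycle s x ℓ hℓ := by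
    let ℓ' : ∀ e : Fin 2 → Fin 4,
      (G.L ((k ∘ s) ∘ e)).fiber (restr (E := F) V (k ∘ s) e (mapInter f k h s x)) := fun e => ℓ e
    have hℓ' : ∀ e, ‖ℓ' e‖ = 1 := fun e => hℓ e
    have := G.cocycle (k ∘ s) (mapInter f k h s x) ℓ' hℓ'
    refine (congrArg delta₂ (funext fun v => ?_)).trans this
    exact G.coefL_pullbackθ f k h (s ∘ v) (restr (E := E) U s v x) _ _ _

/-- The tensor product of two gerbes on the same cover. -/
def Gerbe.tensor (G G' : Gerbe E U) : Gerbe E U where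
  L s := (G.L s).tensor (G'.L s)
  θ s := mkSectionL (fun x => mul₃ ((G.θ s).val x) ((G'.θ s).val x))
    (fun x => norm_mul₃ _ _ ((G.θ s).norm_eq x) ((G'.θ s).norm_eq x)) <| by
      rintro _ ⟨a, ha, a', ha', rfl⟩ _ ⟨b, hb, b', hb', rfl⟩ _ ⟨c, hc, c', hc', rfl⟩
      refine ContMDiffOn.congr (smooth_mul ((smooth_deltaL (G.θ s) ha hb hc).mono ?_)
          ((smooth_deltaL (G'.θ s) ha' hb' hc').mono ?_)) fun x _ => inner_mul₃ _ _ _ _ _ _ _ _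
      · exact fun x hx => ⟨⟨hx.1.1.1, hx.1.2.1⟩, hx.2.1⟩
      · exact fun x hx => ⟨⟨hx.1.1.2, hx.1.2.2⟩, hx.2.2⟩
  cocycle s x ℓ hℓ := by
    choose a b ha hb hab using fun e => exists_unit_tmul (ℓ e) (hℓ e)
    obtain rfl : ℓ = fun e => tmul (a e) (b e) := funext hab
    exact cocycle_mul (G.cocycle s x a ha) (G'.cocycle s x b hb)
      fun v => inner_mul₃ _ _ _ _ _ _ _ _

theorem Gerbe.coefL_tensor (G G' : Gerbe E U) (s : Fin 3 → ι) (x : inter U s)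
    (a a' b b' c c') : coefL ((G.tensor G').θ s) x (tmul a a') (tmul b b') (tmul c c') =
      coefL (G.θ s) x a b c * coefL (G'.θ s) x a' b' c' := inner_mul₃ _ _ _ _ _ _ _ _

/-- The dual of a gerbe. -/
def Gerbe.dual (G : Gerbe E U) : Gerbe E U where
  L s := (G.L s).dual
  θ s := mkSectionL (fun x => inv₃ ((G.θ s).val x)) (fun x => norm_inv₃ _ ((G.θ s).norm_eq x)) <| by
      rintro _ ⟨a, ha, rfl⟩ _ ⟨b, hb, rfl⟩ _ ⟨c, hc, rfl⟩
      exact (smooth_conj (smooth_deltaL (G.θ s) ha hb hc)).congr fun x _ => inner_inv₃ _ _ _ _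
  cocycle s x ℓ hℓ := by
    choose a ha hab using fun e => exists_unit_covec (ℓ e) (hℓ e)
    obtain rfl : ℓ = fun e => covec (a e) := funext hab
    exact cocycle_conj (G.cocycle s x a ha) fun v => inner_inv₃ _ _ _ _

theorem Gerbe.coefL_dual (G : Gerbe E U) (s : Fin 3 → ι) (x : inter U s) (a b c) :
    coefL (G.dual.θ s) x (covec a) (covec b) (covec c) = conj (coefL (G.θ s) x a b c) :=
  inner_inv₃ _ _ _ _

/-- The trivial gerbe. -/
def Gerbe.trivial : Gerbe E U where
  L _ := HermitianLineBundle.trivial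
  θ s := mkSectionL (fun x => vec₃ one one one)
    (fun x => (norm_vec₃ one one one).trans (by simp only [HermitianLine.norm_one, mul_one])) <| by
      rintro _ rfl _ rfl _ rfl
      exact (contMDiffOn_const (c := (1 : ℂ))).congr fun x _ => inner_vec₃_one
  cocycle s x ℓ hℓ :=
    cocycle_of_unit (fun e => inner ℂ one (ℓ e)) (fun e => norm_inner_one (hℓ e)) fun v =>
      (inner_vec₃ _ _ _ _ _ _).trans
        (congrArg₂ _ (congrArg₂ _ (inner_conj_symm _ _).symm rfl) (inner_conj_symm _ _).symm)

/-! Operations on quasi-line bundles. -/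

theorem mem_frames_deltaE {B : ∀ i, HermitianLineBundle E (U i)} {s : Fin 2 → ι}
    {L : HermitianLineBundle E (inter U s)} {a b c} (ha : a ∈ (B (s 1)).frames)
    (hb : b ∈ (B (s 0)).frames) (hc : c ∈ L.frames) :
    ((Opens.comap ⟨_, (restrVertex (E := E) U s 1).contMDiff.continuous⟩ a.1 ⊓
      Opens.comap ⟨_, (restrVertex (E := E) U s 0).contMDiff.continuous⟩ b.1) ⊓ c.1,
      fun x => vec₂ (a.2 (restrVertex (E := E) U s _ x)) (b.2 (restrVertex (E := E) U s _ x))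
        (c.2 x)) ∈ ((deltaE U B s).dual.tensor L).frames :=
  ⟨_, ⟨_, ⟨_, ⟨a, ha, rfl⟩, _, ⟨_, ⟨b, hb, rfl⟩, rfl⟩, rfl⟩, rfl⟩, c, hc, rfl⟩

theorem smooth_deltaE {B : ∀ i, HermitianLineBundle E (U i)} {s : Fin 2 → ι}
    {L : HermitianLineBundle E (inter U s)} (ψ : UnitarySection ((deltaE U B s).dual.tensor L))
    {a b c} (ha : a ∈ (B (s 1)).frames) (hb : b ∈ (B (s 0)).frames) (hc : c ∈ L.frames) :
    ContMDiffOn 𝓘(ℝ, E) 𝓘(ℝ, ℂ) ∞ (fun x => coefE ψ x (a.2 (restrVertex (E := E) U s _ x))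
      (b.2 (restrVertex (E := E) U s _ x)) (c.2 x))
      {x | (restrVertex (E := E) U s 1 x ∈ a.1 ∧ restrVertex (E := E) U s 0 x ∈ b.1) ∧
        x ∈ c.1} := by
  have h := (ψ.smooth _ (mem_frames_deltaE ha hb hc)).mono
    (s := {x | (restrVertex (E := E) U s 1 x ∈ a.1 ∧ restrVertex (E := E) U s 0 x ∈ b.1) ∧
        x ∈ c.1}) fun x hx => hx
  exact h

/-- A unitary section of `(δE)⁻¹ ⊗ L` from its values. -/
def mkSectionE {B : ∀ i, HermitianLineBundle E (U i)} {s : Fin 2 → ι}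
    {L : HermitianLineBundle E (inter U s)} (val : ∀ x, ((deltaE U B s).dual.tensor L).fiber x)
    (norm_eq : ∀ x, ‖val x‖ = 1)
    (smooth : ∀ a ∈ (B (s 1)).frames, ∀ b ∈ (B (s 0)).frames, ∀ c ∈ L.frames,
      ContMDiffOn 𝓘(ℝ, E) 𝓘(ℝ, ℂ) ∞ (fun x => inner ℂ (vec₂ (a.2 (restrVertex (E := E) U s _ x))
        (b.2 (restrVertex (E := E) U s _ x)) (c.2 x)) (val x))
      {x | (restrVertex (E := E) U s 1 x ∈ a.1 ∧ restrVertex (E := E) U s 0 x ∈ b.1) ∧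
        x ∈ c.1}) : UnitarySection ((deltaE U B s).dual.tensor L) where
  val := val
  norm_eq := norm_eq
  smooth := by
    rintro _ ⟨_, ⟨_, ⟨_, ⟨a, ha, rfl⟩, _, ⟨_, ⟨b, hb, rfl⟩, rfl⟩, rfl⟩, rfl⟩, c, hc, rfl⟩
    have h := smooth a ha b hb c hc
    exact h.mono fun x hx => hx

theorem delta₁_mul {p p' q : (Fin 2 → Fin 3) → ℂ} {z z' w : ℂ} (hp : delta₁ p = z)
    (hp' : delta₁ p' = z') (hw : w = z * z') (h : ∀ v, q v = p v * p' v) : delta₁ q = w := by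
  rw [hw, ← hp, ← hp']
  simp only [delta₁, h, mul_inv]
  ring

theorem delta₁_conj {p q : (Fin 2 → Fin 3) → ℂ} {z w : ℂ} (hp : delta₁ p = z) (hw : w = conj z)
    (h : ∀ v, q v = conj (p v)) : delta₁ q = w := by
  rw [hw, ← hp]
  simp only [delta₁, h, map_mul, map_inv₀]

theorem delta₁_of_unit {q : (Fin 2 → Fin 3) → ℂ} {w : ℂ} (y : Fin 3 → ℂ) (hy : ∀ a, ‖y a‖ = 1)
    (z : (Fin 2 → Fin 3) → ℂ) (hz : ∀ v, ‖z v‖ = 1)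
    (hw : w = conj (z (Fin.succAbove 0)) * z (Fin.succAbove 1) * conj (z (Fin.succAbove 2)))
    (h : ∀ v, q v = y (v 1) * conj (y (v 0)) * conj (z v)) : delta₁ q = w := by
  have h0 : ∀ e, z e ≠ 0 := fun e he => by simpa [he] using hz e
  have h0' : ∀ e, y e ≠ 0 := fun e he => by simpa [he] using hy e
  have hz' : ∀ e, conj (z e) = (z e)⁻¹ := fun e => by
    rw [Complex.inv_def, Complex.normSq_eq_norm_sq, hz]; simp
  have hy' : ∀ e, conj (y e) = (y e)⁻¹ := fun e => by
    rw [Complex.inv_def, Complex.normSq_eq_norm_sq, hy]; simp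
  have e1 : (Fin.succAbove (0 : Fin 3)) (0 : Fin 2) = 1 := by decide
  have e2 : (Fin.succAbove (0 : Fin 3)) (1 : Fin 2) = 2 := by decide
  have e3 : (Fin.succAbove (1 : Fin 3)) (0 : Fin 2) = 0 := by decide
  have e4 : (Fin.succAbove (1 : Fin 3)) (1 : Fin 2) = 2 := by decide
  have e5 : (Fin.succAbove (2 : Fin 3)) (0 : Fin 2) = 0 := by decide
  have e6 : (Fin.succAbove (2 : Fin 3)) (1 : Fin 2) = 1 := by decide
  rw [hw]
  simp only [delta₁, h, e1, e2, e3, e4, e5, e6, hz', hy']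
  have := h0 (Fin.succAbove 0); have := h0 (Fin.succAbove 1); have := h0 (Fin.succAbove 2)
  have := h0' 0; have := h0' 1; have := h0' 2
  field_simp

/-- The tensor product of quasi-line bundles for `f^* G` and `f^* G'`, as a quasi-line bundle for
`f^* (G ⊗ G')`. -/
def QuasiLineBundle.tensor {f : C^∞⟮𝓘(ℝ, E), X; 𝓘(ℝ, F), Y⟯} {k : ι → κ}
    {h : ∀ i, ∀ x ∈ U i, f x ∈ V (k i)} {G G' : Gerbe F V}
    (Q : QuasiLineBundle (G.pullback f k h)) (Q' : QuasiLineBundle (G'.pullback f k h)) :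
    QuasiLineBundle ((G.tensor G').pullback f k h) where
  B i := (Q.B i).tensor (Q'.B i)
  ψ s := mkSectionE (fun x => mul₂ ((Q.ψ s).val x) ((Q'.ψ s).val x))
    (fun x => norm_mul₂ _ _ ((Q.ψ s).norm_eq x) ((Q'.ψ s).norm_eq x)) <| by
      rintro _ ⟨a, ha, a', ha', rfl⟩ _ ⟨b, hb, b', hb', rfl⟩ _ ⟨_, ⟨c, hc, c', hc', rfl⟩, rfl⟩
      refine ContMDiffOn.congr (smooth_mul ((smooth_deltaE (Q.ψ s) ha hb ⟨c, hc, rfl⟩).mono ?_)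
        ((smooth_deltaE (Q'.ψ s) ha' hb' ⟨c', hc', rfl⟩).mono ?_))
        fun x _ => inner_mul₂ _ _ _ _ _ _ _ _
      · exact fun x hx => ⟨⟨hx.1.1.1, hx.1.2.1⟩, hx.2.1⟩
      · exact fun x hx => ⟨⟨hx.1.1.2, hx.1.2.2⟩, hx.2.2⟩
  delta_eq s x e ℓ he hℓ := by
    choose a b ha hb hab using fun i => exists_unit_tmul (e i) (he i)
    obtain rfl : e = fun i => tmul (a i) (b i) := funext hab
    choose c d hc hd hcd using fun v => exists_unit_tmul (ℓ v) (hℓ v)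
    obtain rfl : ℓ = fun v => tmul (c v) (d v) := funext hcd
    have h1 := Q.delta_eq s x a c ha hc
    have h2 := Q'.delta_eq s x b d hb hd
    have h3 := G.coefL_tensor G' (k ∘ s) (mapInter f k h s x) (c (Fin.succAbove 0))
      (d (Fin.succAbove 0)) (c (Fin.succAbove 1)) (d (Fin.succAbove 1)) (c (Fin.succAbove 2))
      (d (Fin.succAbove 2))
    refine delta₁_mul h1 h2 h3 fun v => ?_
    exact inner_mul₂ _ _ _ _ _ _ _ _

/-- The dual of a quasi-line bundle for `f^* G`, as a quasi-line bundle for `f^* G⁻¹`. -/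
def QuasiLineBundle.dual {f : C^∞⟮𝓘(ℝ, E), X; 𝓘(ℝ, F), Y⟯} {k : ι → κ}
    {h : ∀ i, ∀ x ∈ U i, f x ∈ V (k i)} {G : Gerbe F V}
    (Q : QuasiLineBundle (G.pullback f k h)) : QuasiLineBundle (G.dual.pullback f k h) where
  B i := (Q.B i).dual
  ψ s := mkSectionE (fun x => inv₂ ((Q.ψ s).val x)) (fun x => norm_inv₂ _ ((Q.ψ s).norm_eq x)) <| by
      rintro _ ⟨a, ha, rfl⟩ _ ⟨b, hb, rfl⟩ _ ⟨_, ⟨c, hc, rfl⟩, rfl⟩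
      exact (smooth_conj (smooth_deltaE (Q.ψ s) ha hb ⟨c, hc, rfl⟩)).congr
        fun x _ => inner_inv₂ _ _ _ _
  delta_eq s x e ℓ he hℓ := by
    choose a ha hab using fun i => exists_unit_covec (e i) (he i)
    obtain rfl : e = fun i => covec (a i) := funext hab
    choose c hc hcd using fun v => exists_unit_covec (ℓ v) (hℓ v)
    obtain rfl : ℓ = fun v => covec (c v) := funext hcd
    have h1 := Q.delta_eq s x a c ha hc
    have h3 := G.coefL_dual (k ∘ s) (mapInter f k h s x) (c (Fin.succAbove 0))
      (c (Fin.succAbove 1)) (c (Fin.succAbove 2))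
    refine delta₁_conj h1 h3 fun v => ?_
    exact inner_inv₂ _ _ _ _

/-- The trivial quasi-line bundle for the pull-back of the trivial gerbe. -/
def QuasiLineBundle.trivial {f : C^∞⟮𝓘(ℝ, E), X; 𝓘(ℝ, F), Y⟯} {k : ι → κ}
    {h : ∀ i, ∀ x ∈ U i, f x ∈ V (k i)} :
    QuasiLineBundle ((Gerbe.trivial (U := V) (E := F)).pullback f k h) where
  B _ := HermitianLineBundle.trivial
  ψ s := mkSectionE (fun x => vec₂ one one one)
    (fun x => (norm_vec₂ one one one).trans (by simp only [HermitianLine.norm_one, mul_one])) <| by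
      rintro _ rfl _ rfl _ ⟨_, rfl, rfl⟩
      exact (contMDiffOn_const (c := (1 : ℂ))).congr fun x _ => inner_vec₂_one
  delta_eq s x e ℓ he hℓ :=
    delta₁_of_unit (fun a => inner ℂ one (e a)) (fun a => norm_inner_one (he a))
      (fun v => inner ℂ one (ℓ v)) (fun v => norm_inner_one (hℓ v))
      ((inner_vec₃ _ _ _ _ _ _).trans
        (congrArg₂ _ (congrArg₂ _ (inner_conj_symm _ _).symm rfl) (inner_conj_symm _ _).symm))
      fun v => (inner_vec₂ _ _ _ _ _ _).trans
        (congrArg₂ _ (congrArg₂ _ rfl (inner_conj_symm _ _).symm) (inner_conj_symm _ _).symm)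

end Gerbes

/-! ### Relative gerbes -/

section Relative

variable {EM : Type*} [NormedAddCommGroup EM] [NormedSpace ℝ EM]
  {M : Type u} [TopologicalSpace M] [ChartedSpace EM M]
  {EN : Type*} [NormedAddCommGroup EN] [NormedSpace ℝ EN]
  {N : Type u} [TopologicalSpace N] [ChartedSpace EN N]

/-- An open cover `V = (V_j)_{j ∈ J}` of `N`, an open cover `U = (U_i)_{i ∈ I}` of `M` and a map
`r : I → J` such that `Φ(U_i) ⊆ V_{r i}`. The index set `I` is presented as the disjoint union
of the fibres `K_j` of `r`, i.e. as `Σ j, K j` with `r (j, k) = j`. -/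
structure RelCover (Φ : C^∞⟮𝓘(ℝ, EM), M; 𝓘(ℝ, EN), N⟯) where
  J : Type u
  V : J → Opens N
  cover_V : ∀ y, ∃ j, y ∈ V j
  K : J → Type u
  U : (Σ j, K j) → Opens M
  cover_U : ∀ x, ∃ i, x ∈ U i
  map_mem : ∀ i, ∀ x ∈ U i, Φ x ∈ V i.1

variable {Φ : C^∞⟮𝓘(ℝ, EM), M; 𝓘(ℝ, EN), N⟯}

/-- A refinement of pairs of covers: maps `J' → J` and `I' → I` of index sets, compatible with `r'`
and `r`, such that each member of the finer covers is contained in the corresponding member of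
the coarser ones. -/
structure Refinement (c' c : RelCover Φ) where
  f : c'.J → c.J
  g : ∀ j, c'.K j → c.K (f j)
  V_le : ∀ j, ∀ y ∈ c'.V j, y ∈ c.V (f j)
  U_le : ∀ i, ∀ x ∈ c'.U i, x ∈ c.U (Sigma.map f g i)

/-- The index map `I' → I` of a refinement. -/
def Refinement.idx {c' c : RelCover Φ} (m : Refinement c' c) : (Σ j, c'.K j) → Σ j, c.K j :=
  Sigma.map m.f m.g

/-- A relative gerbe for `Φ` on the covers `c`: a gerbe on `N` and a quasi-line bundle for its
pull-back to `M`. -/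
structure RelGerbe (c : RelCover Φ) where
  gerbe : Gerbe EN c.V
  quasi : QuasiLineBundle (gerbe.pullback Φ Sigma.fst c.map_mem)

namespace RelGerbe

/-- The tensor product of relative gerbes. -/
def tensor {c : RelCover Φ} (G G' : RelGerbe c) : RelGerbe c where
  gerbe := G.gerbe.tensor G'.gerbe
  quasi := G.quasi.tensor G'.quasi

/-- The dual of a relative gerbe. -/
def dual {c : RelCover Φ} (G : RelGerbe c) : RelGerbe c where
  gerbe := G.gerbe.dual
  quasi := G.quasi.dual

/-- The trivial relative gerbe. -/
def trivial {c : RelCover Φ} : RelGerbe c where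
  gerbe := Gerbe.trivial
  quasi := QuasiLineBundle.trivial

/-- The restriction of a gerbe on `N` to a refinement of the cover. -/
def restrictGerbe {c' c : RelCover Φ} (m : Refinement c' c) (G : Gerbe EN c.V) : Gerbe EN c'.V :=
  G.pullback ContMDiffMap.id m.f m.V_le

/-- The line bundles `E_i` restricted to a refinement. -/
def restrictB {c' c : RelCover Φ} (m : Refinement c' c)
    (B : ∀ i, HermitianLineBundle EM (c.U i)) (i : Σ j, c'.K j) :
    HermitianLineBundle EM (c'.U i) :=
  (B (m.idx i)).pullback (restrictOpens ContMDiffMap.id _ _ (m.U_le i))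

/-- The values of the sections `ψ` restricted to a refinement. -/
def restrictVal {c' c : RelCover Φ} (m : Refinement c' c) (G : RelGerbe c)
    (s : Fin 2 → Σ j, c'.K j) (x : inter c'.U s) :
    (((deltaE c'.U (restrictB m G.quasi.B) s).dual.tensor
      (((restrictGerbe m G.gerbe).pullback Φ Sigma.fst c'.map_mem).L s)).fiber x).UnitVec :=
  (G.quasi.ψ (m.idx ∘ s)).unitVal
    (mapInter (E := EM) (F := EM) (V := c.U) ContMDiffMap.id m.idx m.U_le s x)

/-- The sections `ψ` restricted to a refinement. -/
def restrictψ {c' c : RelCover Φ} (m : Refinement c' c) (G : RelGerbe c)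
    (s : Fin 2 → Σ j, c'.K j) :
    UnitarySection ((deltaE c'.U (restrictB m G.quasi.B) s).dual.tensor
      (((restrictGerbe m G.gerbe).pullback Φ Sigma.fst c'.map_mem).L s)) :=
  mkSectionE (fun x => (restrictVal m G s x).1) (fun x => (restrictVal m G s x).2) <| by
    rintro _ ⟨a, ha, rfl⟩ _ ⟨b, hb, rfl⟩ _ ⟨_, ⟨d, hd, rfl⟩, rfl⟩
    have h := smooth_comp (mapInter (E := EM) (F := EM) (V := c.U) ContMDiffMap.id m.idx m.U_le s)
      (smooth_deltaE (G.quasi.ψ (m.idx ∘ s)) ha hb ⟨d, hd, rfl⟩)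
    have h' := h.mono (s := {x | (restrVertex (E := EM) c'.U s 1 x ∈ Opens.comap
          ⟨_, (restrictOpens (E := EM) (F := EM) ContMDiffMap.id _ _
            (m.U_le (s 1))).contMDiff.continuous⟩ a.1 ∧
        restrVertex (E := EM) c'.U s 0 x ∈ Opens.comap
          ⟨_, (restrictOpens (E := EM) (F := EM) ContMDiffMap.id _ _
            (m.U_le (s 0))).contMDiff.continuous⟩ b.1) ∧
        mapInter (E := EM) (F := EM) (V := c.U) ContMDiffMap.id m.idx m.U_le s x ∈ Opens.comap
          ⟨_, (mapInter (V := c.V) Φ Sigma.fst c.map_mem (m.idx ∘ s)).contMDiff.continuous⟩ d.1})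
      fun x hx => hx
    refine (h'.mono fun x hx => ?_).congr fun x hx => ?_
    · exact hx
    · rfl

/-- The restriction of a relative gerbe to a refinement. -/
def restrict {c' c : RelCover Φ} (m : Refinement c' c) (G : RelGerbe c) : RelGerbe c' where
  gerbe := restrictGerbe m G.gerbe
  quasi :=
    { B := restrictB m G.quasi.B
      ψ := restrictψ m G
      delta_eq := fun s x e ℓ he hℓ => by
        let e' : ∀ a, (G.quasi.B ((m.idx ∘ s) a)).fiber (restrVertex (E := EM) c.U (m.idx ∘ s) a
          (mapInter (E := EM) (F := EM) (V := c.U) ContMDiffMap.id m.idx m.U_le s x)) := e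
        let ℓ' : ∀ v : Fin 2 → Fin 3, ((G.gerbe.pullback Φ Sigma.fst c.map_mem).L
            ((m.idx ∘ s) ∘ v)).fiber (restr (E := EM) c.U (m.idx ∘ s) v
              (mapInter (E := EM) (F := EM) (V := c.U) ContMDiffMap.id m.idx m.U_le s x)) := ℓ
        have h := G.quasi.delta_eq (m.idx ∘ s) (mapInter (E := EM) (F := EM) (V := c.U)
          ContMDiffMap.id m.idx m.U_le s x) e' ℓ' he hℓ
        exact h }

end RelGerbe

end Relative

/-! ### Isomorphisms -/

namespace HermitianLine

variable {A B C A' B' : HermitianLine}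

/-- `A ⊗ B ≅ A' ⊗ B'`. -/
def tensorCongr (f : A ≃ₗᵢ[ℂ] A') (g : B ≃ₗᵢ[ℂ] B') : A.tensor B ≃ₗᵢ[ℂ] A'.tensor B' :=
  TensorProduct.congrIsometry f g

theorem tensorCongr_tmul (f : A ≃ₗᵢ[ℂ] A') (g : B ≃ₗᵢ[ℂ] B') (a : A) (b : B) :
    tensorCongr f g (tmul a b) = tmul (f a) (g b) := rfl

/-- `A⁻¹ ≅ B⁻¹`. -/
def dualCongr (f : A ≃ₗᵢ[ℂ] B) : A.dual ≃ₗᵢ[ℂ] B.dual :=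
  ((InnerProductSpace.toDual ℂ A).symm.trans f).trans (InnerProductSpace.toDual ℂ B)

theorem dualCongr_covec (f : A ≃ₗᵢ[ℂ] B) (a : A) : dualCongr f (covec a) = covec (f a) := by
  change InnerProductSpace.toDual ℂ B (f ((InnerProductSpace.toDual ℂ A).symm
    (InnerProductSpace.toDual ℂ A a))) = InnerProductSpace.toDual ℂ B (f a)
  rw [LinearIsometryEquiv.symm_apply_apply]

/-- `(A ⊗ B) ⊗ C ≅ A ⊗ (B ⊗ C)`. -/
def assoc (A B C : HermitianLine) : (A.tensor B).tensor C ≃ₗᵢ[ℂ] A.tensor (B.tensor C) :=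
  TensorProduct.assocIsometry ℂ A B C

theorem assoc_tmul (a : A) (b : B) (c : C) :
    assoc A B C (tmul (tmul a b) c) = tmul a (tmul b c) := rfl

/-- `A ⊗ B ≅ B ⊗ A`. -/
def comm (A B : HermitianLine) : A.tensor B ≃ₗᵢ[ℂ] B.tensor A := TensorProduct.commIsometry ℂ A B

theorem comm_tmul (a : A) (b : B) : comm A B (tmul a b) = tmul b a := rfl

/-- `ℂ ⊗ A ≅ A`. -/
def lid (A : HermitianLine) : trivial.tensor A ≃ₗᵢ[ℂ] A := TensorProduct.lidIsometry ℂ A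

theorem inner_lid (z : trivial) (a b : A) :
    inner ℂ b (lid A (tmul z a)) = (inner ℂ one z * inner ℂ b a : ℂ) := by
  have h1 : lid A (tmul z a) = (id z : ℂ) • a := rfl
  have h2 : inner ℂ one z = (id z : ℂ) := (RCLike.inner_apply (1 : ℂ) (id z : ℂ)).trans (by simp)
  rw [h1, h2, inner_smul_right]

theorem norm_tmul_covec_unit (A : HermitianLine) : ‖tmul (covec A.unit) A.unit‖ = 1 := by
  simp [norm_tmul, norm_covec, norm_unit]

/-- The evaluation `A⁻¹ ⊗ A ≅ ℂ`. -/
def evalIso (A : HermitianLine) : A.dual.tensor A ≃ₗᵢ[ℂ] trivial :=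
  isoOfUnit _ _ (norm_tmul_covec_unit A) norm_one

theorem inner_evalIso (z : trivial) (a b : A) :
    inner ℂ z (evalIso A (tmul (covec a) b)) = (inner ℂ z one * inner ℂ a b : ℂ) := by
  rw [evalIso, inner_isoOfUnit, inner_tmul, inner_covec, inner_mul_inner (norm_unit A)]

end HermitianLine

namespace BundleIso

variable {E : Type*} [NormedAddCommGroup E] [NormedSpace ℝ E]
  {X : Type u} [TopologicalSpace X] [ChartedSpace E X]
  {F : Type*} [NormedAddCommGroup F] [NormedSpace ℝ F]
  {Y : Type u} [TopologicalSpace Y] [ChartedSpace F Y]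

/-- The identity. -/
def refl (L : HermitianLineBundle E X) : BundleIso L L where
  map x := LinearIsometryEquiv.refl ℂ _
  smooth a ha a' ha' := (L.smooth_transition a' ha' a ha).mono fun x hx => ⟨hx.2, hx.1⟩

/-- `L ⊗ R ≅ L' ⊗ R'`. -/
def tensorCongr {L L' R R' : HermitianLineBundle E X} (φ : BundleIso L L') (ρ : BundleIso R R') :
    BundleIso (L.tensor R) (L'.tensor R') where
  map x := HermitianLine.tensorCongr (φ.map x) (ρ.map x)
  smooth := by
    rintro _ ⟨a, ha, b, hb, rfl⟩ _ ⟨a', ha', b', hb', rfl⟩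
    exact smooth_mul ((φ.smooth a ha a' ha').mono fun x hx => ⟨hx.1.1, hx.2.1⟩)
      ((ρ.smooth b hb b' hb').mono fun x hx => ⟨hx.1.2, hx.2.2⟩)

/-- `L⁻¹ ≅ L'⁻¹`. -/
def dualCongr {L L' : HermitianLineBundle E X} (φ : BundleIso L L') :
    BundleIso L.dual L'.dual where
  map x := HermitianLine.dualCongr (φ.map x)
  smooth := by
    rintro _ ⟨a, ha, rfl⟩ _ ⟨a', ha', rfl⟩
    refine ((smooth_inner_comm (φ.smooth a ha a' ha')).mono fun x hx => hx).congr fun x hx => ?_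
    exact (congrArg _ (dualCongr_covec _ _)).trans (inner_covec _ _)

/-- `(L ⊗ R) ⊗ S ≅ L ⊗ (R ⊗ S)`. -/
def assoc (L R S : HermitianLineBundle E X) :
    BundleIso ((L.tensor R).tensor S) (L.tensor (R.tensor S)) where
  map x := HermitianLine.assoc _ _ _
  smooth := by
    rintro _ ⟨_, ⟨a, ha, b, hb, rfl⟩, c, hc, rfl⟩ _ ⟨a', ha', _, ⟨b', hb', c', hc', rfl⟩, rfl⟩
    exact smooth_mul
      ((L.smooth_transition a' ha' a ha).mono fun x hx => ⟨hx.2.1, hx.1.1.1⟩)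
      (smooth_mul ((R.smooth_transition b' hb' b hb).mono fun x hx => ⟨hx.2.2.1, hx.1.1.2⟩)
      ((S.smooth_transition c' hc' c hc).mono fun x hx => ⟨hx.2.2.2, hx.1.2⟩))

/-- `L ⊗ R ≅ R ⊗ L`. -/
def comm (L R : HermitianLineBundle E X) : BundleIso (L.tensor R) (R.tensor L) where
  map x := HermitianLine.comm _ _
  smooth := by
    rintro _ ⟨a, ha, b, hb, rfl⟩ _ ⟨b', hb', a', ha', rfl⟩
    exact smooth_mul ((R.smooth_transition b' hb' b hb).mono fun x hx => ⟨hx.2.1, hx.1.2⟩)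
      ((L.smooth_transition a' ha' a ha).mono fun x hx => ⟨hx.2.2, hx.1.1⟩)

/-- `1 ⊗ L ≅ L`. -/
def lid (L : HermitianLineBundle E X) : BundleIso (HermitianLineBundle.trivial.tensor L) L where
  map x := HermitianLine.lid _
  smooth := by
    rintro _ ⟨_, rfl, a, ha, rfl⟩ a' ha'
    refine ((L.smooth_transition a' ha' a ha).mono fun x hx => ⟨hx.2, hx.1.2⟩).congr
      fun x hx => ?_
    exact (inner_lid _ _ _).trans (by rw [inner_one_one, one_mul])

/-- `L⁻¹ ⊗ L ≅ 1`. -/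
def evalIso (L : HermitianLineBundle E X) :
    BundleIso (L.dual.tensor L) HermitianLineBundle.trivial where
  map x := HermitianLine.evalIso _
  smooth := by
    rintro _ ⟨_, ⟨a, ha, rfl⟩, b, hb, rfl⟩ _ rfl
    refine ((L.smooth_transition a ha b hb).mono fun x hx => hx.1).congr fun x hx => ?_
    exact (inner_evalIso _ _ _).trans (by rw [inner_one_one, one_mul])

/-- The pull-back of an isomorphism. -/
def pullback {L L' : HermitianLineBundle F Y} (φ : BundleIso L L')
    (f : C^∞⟮𝓘(ℝ, E), X; 𝓘(ℝ, F), Y⟯) : BundleIso (L.pullback f) (L'.pullback f) where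
  map x := φ.map (f x)
  smooth := by
    rintro _ ⟨a, ha, rfl⟩ _ ⟨a', ha', rfl⟩
    exact (φ.smooth a ha a' ha').comp f.contMDiff.contMDiffOn fun x hx => hx

/-- `f^* (L ⊗ R) ≅ f^* L ⊗ f^* R`. -/
def pullbackTensor (L R : HermitianLineBundle F Y) (f : C^∞⟮𝓘(ℝ, E), X; 𝓘(ℝ, F), Y⟯) :
    BundleIso ((L.tensor R).pullback f) ((L.pullback f).tensor (R.pullback f)) where
  map x := LinearIsometryEquiv.refl ℂ _
  smooth := by
    rintro _ ⟨_, ⟨a, ha, b, hb, rfl⟩, rfl⟩ _ ⟨_, ⟨a', ha', rfl⟩, _, ⟨b', hb', rfl⟩, rfl⟩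
    exact (((L.tensor R).smooth_transition _ ⟨a', ha', b', hb', rfl⟩ _ ⟨a, ha, b, hb, rfl⟩).comp
      f.contMDiff.contMDiffOn fun x hx => hx).mono fun x hx => ⟨hx.2, hx.1⟩

end BundleIso

namespace HermitianLine

variable {A B C : HermitianLine}

theorem lid_tmul (z : trivial) (a : A) : lid A (tmul z a) = (inner ℂ one z : ℂ) • a := by
  refine ext_inner_left ℂ fun b => ?_
  rw [inner_lid, inner_smul_right]

theorem inner_vec₃_lid (a b d : trivial) (a' : A) (b' : B) (d' : C)
    (τ : (A.tensor B.dual).tensor C) :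
    inner ℂ (vec₃ (lid A (tmul a a')) (lid B (tmul b b')) (lid C (tmul d d'))) τ =
      (inner ℂ a one * inner ℂ one b * inner ℂ d one : ℂ) * inner ℂ (vec₃ a' b' d') τ := by
  rw [← inner_mul_inner norm_vec₃_unit _ τ, ← inner_mul_inner norm_vec₃_unit (vec₃ a' b' d') τ,
    inner_vec₃, inner_vec₃, lid_tmul, lid_tmul, lid_tmul, inner_smul_left, inner_smul_right,
    inner_smul_left, inner_conj_symm, inner_conj_symm]
  ring

theorem inner_vec₂_lid (a b d : trivial) (a' : A) (b' : B) (d' : C)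
    (τ : (A.tensor B.dual).dual.tensor C) :
    inner ℂ (vec₂ (lid A (tmul a a')) (lid B (tmul b b')) (lid C (tmul d d'))) τ =
      (inner ℂ one a * inner ℂ b one * inner ℂ d one : ℂ) * inner ℂ (vec₂ a' b' d') τ := by
  rw [← inner_mul_inner norm_vec₂_unit _ τ, ← inner_mul_inner norm_vec₂_unit (vec₂ a' b' d') τ,
    inner_vec₂, inner_vec₂, lid_tmul, lid_tmul, lid_tmul, inner_smul_left, inner_smul_right,
    inner_smul_left, inner_conj_symm, inner_conj_symm]
  ring

theorem inner_evalIso_left (z : trivial) (a b : A) :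
    inner ℂ (evalIso A (tmul (covec a) b)) z = (inner ℂ b a * inner ℂ one z : ℂ) := by
  rw [← inner_conj_symm, inner_evalIso, map_mul, inner_conj_symm, inner_conj_symm, mul_comm]

theorem evalIso_coef₃ (a a' : A) (b b' : B) (d d' : C) (τ : (A.tensor B.dual).tensor C)
    (hτ : ‖τ‖ = 1) :
    inner ℂ (evalIso A (tmul (covec a) a')) one * inner ℂ one (evalIso B (tmul (covec b) b')) *
      inner ℂ (evalIso C (tmul (covec d) d')) one =
      (conj (inner ℂ (vec₃ a b d) τ : ℂ) * inner ℂ (vec₃ a' b' d') τ : ℂ) := by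
  rw [inner_conj_symm, mul_comm (inner ℂ τ _), inner_mul_inner hτ, inner_vec₃, inner_evalIso_left,
    inner_evalIso_left, inner_evalIso, inner_one_one]
  ring

theorem evalIso_coef₂ (a a' : A) (b b' : B) (d d' : C) (τ : (A.tensor B.dual).dual.tensor C)
    (hτ : ‖τ‖ = 1) :
    inner ℂ one (evalIso A (tmul (covec a) a')) * inner ℂ (evalIso B (tmul (covec b) b')) one *
      inner ℂ (evalIso C (tmul (covec d) d')) one =
      (conj (inner ℂ (vec₂ a b d) τ : ℂ) * inner ℂ (vec₂ a' b' d') τ : ℂ) := by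
  rw [inner_conj_symm, mul_comm (inner ℂ τ _), inner_mul_inner hτ, inner_vec₂, inner_evalIso_left,
    inner_evalIso_left, inner_evalIso, inner_one_one]
  ring

end HermitianLine

section RelativeIso

variable {EM : Type*} [NormedAddCommGroup EM] [NormedSpace ℝ EM]
  {M : Type u} [TopologicalSpace M] [ChartedSpace EM M]
  {EN : Type*} [NormedAddCommGroup EN] [NormedSpace ℝ EN]
  {N : Type u} [TopologicalSpace N] [ChartedSpace EN N]
  {Φ : C^∞⟮𝓘(ℝ, EM), M; 𝓘(ℝ, EN), N⟯} {c c' : RelCover Φ}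

namespace RelGerbe

/-- An isomorphism of relative gerbes on the same covers: isomorphisms of the line bundles
`L_{jj'}` and `E_i` which are compatible with the sections `θ` and `ψ`. -/
structure Iso (G G' : RelGerbe c) where
  φ : ∀ s, BundleIso (G.gerbe.L s) (G'.gerbe.L s)
  ε : ∀ i, BundleIso (G.quasi.B i) (G'.quasi.B i)
  coefL_eq : ∀ (s : Fin 3 → c.J) (x : inter c.V s)
    (a : (G.gerbe.L (s ∘ Fin.succAbove 0)).fiber (restr (E := EN) c.V s (Fin.succAbove 0) x))
    (b : (G.gerbe.L (s ∘ Fin.succAbove 1)).fiber (restr (E := EN) c.V s (Fin.succAbove 1) x))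
    (d : (G.gerbe.L (s ∘ Fin.succAbove 2)).fiber (restr (E := EN) c.V s (Fin.succAbove 2) x)),
    coefL (G'.gerbe.θ s) x ((φ _).map _ a) ((φ _).map _ b) ((φ _).map _ d) =
      coefL (G.gerbe.θ s) x a b d
  coefE_eq : ∀ (s : Fin 2 → Σ j, c.K j) (x : inter c.U s)
    (a : (G.quasi.B (s 1)).fiber (restrVertex (E := EM) c.U s 1 x))
    (b : (G.quasi.B (s 0)).fiber (restrVertex (E := EM) c.U s 0 x))
    (d : (G.gerbe.L (Sigma.fst ∘ s)).fiber (mapInter Φ Sigma.fst c.map_mem s x)),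
    coefE (G'.quasi.ψ s) x ((ε _).map _ a) ((ε _).map _ b) ((φ (Sigma.fst ∘ s)).map _ d) =
      coefE (G.quasi.ψ s) x a b d

theorem coefL_tensor (G G' : RelGerbe c) (s : Fin 3 → c.J) (x : inter c.V s) (a a' b b' d d') :
    coefL ((G.tensor G').gerbe.θ s) x (tmul a a') (tmul b b') (tmul d d') =
      coefL (G.gerbe.θ s) x a b d * coefL (G'.gerbe.θ s) x a' b' d' :=
  inner_mul₃ _ _ _ _ _ _ _ _

theorem coefL_dual (G : RelGerbe c) (s : Fin 3 → c.J) (x : inter c.V s) (a b d) :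
    coefL (G.dual.gerbe.θ s) x (covec a) (covec b) (covec d) = conj (coefL (G.gerbe.θ s) x a b d) :=
  inner_inv₃ _ _ _ _

theorem coefE_tensor (G G' : RelGerbe c) (s : Fin 2 → Σ j, c.K j) (x : inter c.U s)
    (a a' b b') (d : (G.gerbe.L (Sigma.fst ∘ s)).fiber (mapInter Φ Sigma.fst c.map_mem s x))
    (d' : (G'.gerbe.L (Sigma.fst ∘ s)).fiber (mapInter Φ Sigma.fst c.map_mem s x)) :
    coefE ((G.tensor G').quasi.ψ s) x (tmul a a') (tmul b b') (tmul d d') =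
      coefE (G.quasi.ψ s) x a b d * coefE (G'.quasi.ψ s) x a' b' d' :=
  inner_mul₂ _ _ _ _ _ _ _ _

theorem coefE_dual (G : RelGerbe c) (s : Fin 2 → Σ j, c.K j) (x : inter c.U s)
    (a b) (d : (G.gerbe.L (Sigma.fst ∘ s)).fiber (mapInter Φ Sigma.fst c.map_mem s x)) :
    coefE (G.dual.quasi.ψ s) x (covec a) (covec b) (covec d) = conj (coefE (G.quasi.ψ s) x a b d) :=
  inner_inv₂ _ _ _ _

namespace Iso

/-- The identity. -/
def refl (G : RelGerbe c) : Iso G G where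
  φ s := BundleIso.refl _
  ε j := BundleIso.refl _
  coefL_eq s x a b d := rfl
  coefE_eq s x a b d := rfl

/-- The tensor product of isomorphisms. -/
def tensorCongr {G G' H H' : RelGerbe c} (i : Iso G G') (k : Iso H H') :
    Iso (G.tensor H) (G'.tensor H') where
  φ s := (i.φ s).tensorCongr (k.φ s)
  ε j := (i.ε j).tensorCongr (k.ε j)
  coefL_eq s x a b d := by
    obtain ⟨a, a', rfl⟩ := exists_tmul a
    obtain ⟨b, b', rfl⟩ := exists_tmul b
    obtain ⟨d, d', rfl⟩ := exists_tmul d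
    exact (coefL_tensor G' H' s x _ _ _ _ _ _).trans ((congrArg₂ _ (i.coefL_eq s x a b d)
      (k.coefL_eq s x a' b' d')).trans (coefL_tensor G H s x a a' b b' d d').symm)
  coefE_eq s x a b d := by
    obtain ⟨a, a', rfl⟩ := exists_tmul a
    obtain ⟨b, b', rfl⟩ := exists_tmul b
    obtain ⟨d, d', rfl⟩ := exists_tmul d
    exact (coefE_tensor G' H' s x _ _ _ _ _ _).trans ((congrArg₂ _ (i.coefE_eq s x a b d)
      (k.coefE_eq s x a' b' d')).trans (coefE_tensor G H s x a a' b b' d d').symm)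

/-- The dual of an isomorphism. -/
def dualCongr {G G' : RelGerbe c} (i : Iso G G') : Iso G.dual G'.dual where
  φ s := (i.φ s).dualCongr
  ε j := (i.ε j).dualCongr
  coefL_eq s x a b d := by
    obtain ⟨a, rfl⟩ := exists_covec a
    obtain ⟨b, rfl⟩ := exists_covec b
    obtain ⟨d, rfl⟩ := exists_covec d
    have h : ∀ {A B : HermitianLine} (f : A ≃ₗᵢ[ℂ] B) (a : A),
      covec (f a) = HermitianLine.dualCongr f (covec a) := fun f a => (dualCongr_covec f a).symm
    refine Eq.trans ?_ ((coefL_dual G' s x _ _ _).trans ((congrArg _ (i.coefL_eq s x a b d)).trans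
      (coefL_dual G s x a b d).symm))
    rw [h, h, h]
    rfl
  coefE_eq s x a b d := by
    obtain ⟨a, rfl⟩ := exists_covec a
    obtain ⟨b, rfl⟩ := exists_covec b
    obtain ⟨d, rfl⟩ := exists_covec d
    have h : ∀ {A B : HermitianLine} (f : A ≃ₗᵢ[ℂ] B) (a : A),
      covec (f a) = HermitianLine.dualCongr f (covec a) := fun f a => (dualCongr_covec f a).symm
    refine Eq.trans ?_ ((coefE_dual G' s x _ _ _).trans ((congrArg _ (i.coefE_eq s x a b d)).trans
      (coefE_dual G s x a b d).symm))
    rw [h, h, h]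
    rfl

/-- `(G ⊗ G') ⊗ G'' ≅ G ⊗ (G' ⊗ G'')`. -/
def assoc (G G' G'' : RelGerbe c) : Iso ((G.tensor G').tensor G'') (G.tensor (G'.tensor G'')) where
  φ s := BundleIso.assoc _ _ _
  ε j := BundleIso.assoc _ _ _
  coefL_eq s x a b d := by
    obtain ⟨a, a₃, rfl⟩ := exists_tmul a
    obtain ⟨a₁, a₂, rfl⟩ := exists_tmul a
    obtain ⟨b, b₃, rfl⟩ := exists_tmul b
    obtain ⟨b₁, b₂, rfl⟩ := exists_tmul b
    obtain ⟨d, d₃, rfl⟩ := exists_tmul d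
    obtain ⟨d₁, d₂, rfl⟩ := exists_tmul d
    refine (coefL_tensor G (G'.tensor G'') s x a₁ (tmul a₂ a₃) b₁ (tmul b₂ b₃) d₁
      (tmul d₂ d₃)).trans ?_
    rw [coefL_tensor G' G'' s x a₂ a₃ b₂ b₃ d₂ d₃, ← mul_assoc]
    exact ((coefL_tensor (G.tensor G') G'' s x (tmul a₁ a₂) a₃ (tmul b₁ b₂) b₃ (tmul d₁ d₂) d₃).trans
      (congrArg (· * _) (coefL_tensor G G' s x a₁ a₂ b₁ b₂ d₁ d₂))).symm
  coefE_eq s x a b d := by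
    obtain ⟨a, a₃, rfl⟩ := exists_tmul a
    obtain ⟨a₁, a₂, rfl⟩ := exists_tmul a
    obtain ⟨b, b₃, rfl⟩ := exists_tmul b
    obtain ⟨b₁, b₂, rfl⟩ := exists_tmul b
    obtain ⟨d, d₃, rfl⟩ := exists_tmul d
    obtain ⟨d₁, d₂, rfl⟩ := exists_tmul d
    refine (coefE_tensor G (G'.tensor G'') s x a₁ (tmul a₂ a₃) b₁ (tmul b₂ b₃) d₁
      (tmul d₂ d₃)).trans ?_
    rw [coefE_tensor G' G'' s x a₂ a₃ b₂ b₃ d₂ d₃, ← mul_assoc]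
    exact ((coefE_tensor (G.tensor G') G'' s x (tmul a₁ a₂) a₃ (tmul b₁ b₂) b₃ (tmul d₁ d₂) d₃).trans
      (congrArg (· * _) (coefE_tensor G G' s x a₁ a₂ b₁ b₂ d₁ d₂))).symm

/-- `G ⊗ G' ≅ G' ⊗ G`. -/
def comm (G G' : RelGerbe c) : Iso (G.tensor G') (G'.tensor G) where
  φ s := BundleIso.comm _ _
  ε j := BundleIso.comm _ _
  coefL_eq s x a b d := by
    obtain ⟨a₁, a₂, rfl⟩ := exists_tmul a
    obtain ⟨b₁, b₂, rfl⟩ := exists_tmul b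
    obtain ⟨d₁, d₂, rfl⟩ := exists_tmul d
    exact (coefL_tensor G' G s x a₂ a₁ b₂ b₁ d₂ d₁).trans ((mul_comm _ _).trans
      (coefL_tensor G G' s x a₁ a₂ b₁ b₂ d₁ d₂).symm)
  coefE_eq s x a b d := by
    obtain ⟨a₁, a₂, rfl⟩ := exists_tmul a
    obtain ⟨b₁, b₂, rfl⟩ := exists_tmul b
    obtain ⟨d₁, d₂, rfl⟩ := exists_tmul d
    exact (coefE_tensor G' G s x a₂ a₁ b₂ b₁ d₂ d₁).trans ((mul_comm _ _).trans
      (coefE_tensor G G' s x a₁ a₂ b₁ b₂ d₁ d₂).symm)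

theorem coefL_trivial (s : Fin 3 → c.J) (x : inter c.V s) (a b d : HermitianLine.trivial) :
    coefL ((RelGerbe.trivial (c := c)).gerbe.θ s) x a b d =
      (inner ℂ a one * inner ℂ one b * inner ℂ d one : ℂ) := inner_vec₃ _ _ _ _ _ _

theorem coefE_trivial (s : Fin 2 → Σ j, c.K j) (x : inter c.U s) (a b d : HermitianLine.trivial) :
    coefE ((RelGerbe.trivial (c := c)).quasi.ψ s) x a b d =
      (inner ℂ one a * inner ℂ b one * inner ℂ d one : ℂ) := inner_vec₂ _ _ _ _ _ _

/-- `1 ⊗ G ≅ G`. -/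
def lid (G : RelGerbe c) : Iso (RelGerbe.trivial.tensor G) G where
  φ s := BundleIso.lid _
  ε j := BundleIso.lid _
  coefL_eq s x a b d := by
    obtain ⟨a₁, a₂, rfl⟩ := exists_tmul a
    obtain ⟨b₁, b₂, rfl⟩ := exists_tmul b
    obtain ⟨d₁, d₂, rfl⟩ := exists_tmul d
    refine Eq.trans ?_ ((congrArg (· * _) (coefL_trivial s x a₁ b₁ d₁)).symm.trans
      (coefL_tensor RelGerbe.trivial G s x a₁ a₂ b₁ b₂ d₁ d₂).symm)
    exact inner_vec₃_lid _ _ _ _ _ _ _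
  coefE_eq s x a b d := by
    obtain ⟨a₁, a₂, rfl⟩ := exists_tmul a
    obtain ⟨b₁, b₂, rfl⟩ := exists_tmul b
    obtain ⟨d₁, d₂, rfl⟩ := exists_tmul d
    refine Eq.trans ?_ ((congrArg (· * _) (coefE_trivial s x a₁ b₁ d₁)).symm.trans
      (coefE_tensor RelGerbe.trivial G s x a₁ a₂ b₁ b₂ d₁ d₂).symm)
    exact inner_vec₂_lid _ _ _ _ _ _ _

/-- `G⁻¹ ⊗ G ≅ 1`. -/
def evalIso (G : RelGerbe c) : Iso (G.dual.tensor G) RelGerbe.trivial where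
  φ s := BundleIso.evalIso _
  ε j := BundleIso.evalIso _
  coefL_eq s x a b d := by
    obtain ⟨a, a₂, rfl⟩ := exists_tmul a
    obtain ⟨b, b₂, rfl⟩ := exists_tmul b
    obtain ⟨d, d₂, rfl⟩ := exists_tmul d
    obtain ⟨a₁, rfl⟩ := exists_covec a
    obtain ⟨b₁, rfl⟩ := exists_covec b
    obtain ⟨d₁, rfl⟩ := exists_covec d
    refine Eq.trans ?_ ((congrArg (· * _) (coefL_dual G s x a₁ b₁ d₁)).symm.trans
      (coefL_tensor G.dual G s x (covec a₁) a₂ (covec b₁) b₂ (covec d₁) d₂).symm)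
    refine (coefL_trivial s x _ _ _).trans ?_
    exact evalIso_coef₃ _ _ _ _ _ _ _ ((G.gerbe.θ s).norm_eq x)
  coefE_eq s x a b d := by
    obtain ⟨a, a₂, rfl⟩ := exists_tmul a
    obtain ⟨b, b₂, rfl⟩ := exists_tmul b
    obtain ⟨d, d₂, rfl⟩ := exists_tmul d
    obtain ⟨a₁, rfl⟩ := exists_covec a
    obtain ⟨b₁, rfl⟩ := exists_covec b
    obtain ⟨d₁, rfl⟩ := exists_covec d
    refine Eq.trans ?_ ((congrArg (· * _) (coefE_dual G s x a₁ b₁ d₁)).symm.trans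
      (coefE_tensor G.dual G s x (covec a₁) a₂ (covec b₁) b₂ (covec d₁) d₂).symm)
    refine (coefE_trivial s x _ _ _).trans ?_
    exact evalIso_coef₂ _ _ _ _ _ _ _ ((G.quasi.ψ s).norm_eq x)

/-- The restriction of an isomorphism to a refinement. -/
def restrict {G G' : RelGerbe c} (i : Iso G G') (m : Refinement c' c) :
    Iso (G.restrict m) (G'.restrict m) where
  φ s := (i.φ (m.f ∘ s)).pullback _
  ε j := (i.ε (m.idx j)).pullback _
  coefL_eq s x a b d := by
    have h := i.coefL_eq (m.f ∘ s) (mapInter (E := EN) (F := EN) (V := c.V) ContMDiffMap.id m.f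
      m.V_le s x) a b d
    exact h
  coefE_eq s x a b d := by
    have h := i.coefE_eq (m.idx ∘ s) (mapInter (E := EM) (F := EM) (V := c.U) ContMDiffMap.id m.idx
      m.U_le s x) a b d
    exact h

/-- Restriction is compatible with tensor products. -/
def restrictTensor (m : Refinement c' c) (G G' : RelGerbe c) :
    Iso ((G.tensor G').restrict m) ((G.restrict m).tensor (G'.restrict m)) where
  φ s := BundleIso.pullbackTensor _ _ _
  ε j := BundleIso.pullbackTensor _ _ _
  coefL_eq s x a b d := by
    obtain ⟨a₁, a₂, rfl⟩ := exists_tmul a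
    obtain ⟨b₁, b₂, rfl⟩ := exists_tmul b
    obtain ⟨d₁, d₂, rfl⟩ := exists_tmul d
    exact (coefL_tensor (G.restrict m) (G'.restrict m) s x a₁ a₂ b₁ b₂ d₁ d₂).trans
      (coefL_tensor G G' (m.f ∘ s) (mapInter (E := EN) (F := EN) (V := c.V) ContMDiffMap.id m.f
        m.V_le s x) a₁ a₂ b₁ b₂ d₁ d₂).symm
  coefE_eq s x a b d := by
    obtain ⟨a₁, a₂, rfl⟩ := exists_tmul a
    obtain ⟨b₁, b₂, rfl⟩ := exists_tmul b
    obtain ⟨d₁, d₂, rfl⟩ := exists_tmul d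
    exact (coefE_tensor (G.restrict m) (G'.restrict m) s x a₁ a₂ b₁ b₂ d₁ d₂).trans
      (coefE_tensor G G' (m.idx ∘ s) (mapInter (E := EM) (F := EM) (V := c.U) ContMDiffMap.id m.idx
        m.U_le s x) a₁ a₂ b₁ b₂ d₁ d₂).symm

end Iso

/-- Two relative gerbes on the same covers are isomorphic. -/
def Isomorphic (G G' : RelGerbe c) : Prop := Nonempty (Iso G G')

end RelGerbe

/-- The group `Ger(c)` of isomorphism classes of relative gerbes on the covers `c`, with the tensor
product. -/
def GerOn (c : RelCover Φ) := Quot (RelGerbe.Isomorphic (c := c))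

namespace GerOn

/-- The class of a relative gerbe. -/
def mk (G : RelGerbe c) : GerOn c := Quot.mk _ G

theorem sound {G G' : RelGerbe c} (i : RelGerbe.Iso G G') : mk G = mk G' := Quot.sound ⟨i⟩

instance : Add (GerOn c) where
  add := Quot.map₂ RelGerbe.tensor
    (fun G _ _ ⟨k⟩ => ⟨(RelGerbe.Iso.refl G).tensorCongr k⟩)
    (fun _ _ H ⟨i⟩ => ⟨i.tensorCongr (RelGerbe.Iso.refl H)⟩)

instance : Zero (GerOn c) := ⟨mk RelGerbe.trivial⟩

instance : Neg (GerOn c) where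
  neg := Quot.map RelGerbe.dual fun _ _ ⟨i⟩ => ⟨i.dualCongr⟩

theorem add_comm' (x y : GerOn c) : x + y = y + x := by
  induction x using Quot.ind with | mk G
  induction y using Quot.ind with | mk G'
  exact sound (RelGerbe.Iso.comm G G')

theorem zero_add' (x : GerOn c) : 0 + x = x := by
  induction x using Quot.ind with | mk G
  exact sound (RelGerbe.Iso.lid G)

instance : AddCommGroup (GerOn c) where
  add_assoc x y z := by
    induction x using Quot.ind with | mk G
    induction y using Quot.ind with | mk G'
    induction z using Quot.ind with | mk G''
    exact sound (RelGerbe.Iso.assoc G G' G'')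
  zero_add := zero_add'
  add_zero x := (add_comm' x 0).trans (zero_add' x)
  add_comm := add_comm'
  neg_add_cancel x := by
    induction x using Quot.ind with | mk G
    exact sound (RelGerbe.Iso.evalIso G)
  nsmul := nsmulRec
  zsmul := zsmulRec

/-- The restriction homomorphism `Ger(c) → Ger(c')` of a refinement. -/
def restrict (m : Refinement c' c) : GerOn c →+ GerOn c' :=
  AddMonoidHom.mk' (Quot.map (RelGerbe.restrict m) fun _ _ ⟨i⟩ => ⟨i.restrict m⟩) fun x y => by
    induction x using Quot.ind with | mk G
    induction y using Quot.ind with | mk G'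
    exact sound (RelGerbe.Iso.restrictTensor m G G')

end GerOn

end RelativeIso

/-! ### Čech cochains -/

section Cech

variable {X Y : Type u} [TopologicalSpace X] [TopologicalSpace Y] {ι κ : Type u}

/-- The Čech `p`-cochains of the cover `U` with values in functions to `A`. -/
abbrev Cochain (U : ι → Opens X) (A : Type*) (p : ℕ) :=
  ∀ s : Fin (p + 1) → ι, inter U s → A

/-- The inclusion of `U_s` into its `k`-th face. -/
def face (U : ι → Opens X) {p : ℕ} (s : Fin (p + 2) → ι) (k : Fin (p + 2)) (x : inter U s) :
    inter U (s ∘ k.succAbove) :=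
  ⟨x.1, fun a => x.2 (k.succAbove a)⟩

/-- The Čech coboundary `(δf)_{i_0 … i_{p+1}} = ∑ (-1)^k f_{i_0 … î_k … i_{p+1}}`. -/
def cechD (U : ι → Opens X) (A : Type*) [AddCommGroup A] (p : ℕ) :
    Cochain U A p →+ Cochain U A (p + 1) :=
  AddMonoidHom.mk'
    (fun f s x => ∑ k : Fin (p + 2), (-1 : ℤ) ^ (k : ℕ) • f (s ∘ k.succAbove) (face U s k x))
    fun f g => by
      funext s x
      simp only [Pi.add_apply, smul_add, Finset.sum_add_distrib]

variable {U : ι → Opens X} {V : κ → Opens Y}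

/-- The map `U_s → V_{k ∘ s}` induced by a map `f` with `f(U_i) ⊆ V_{k i}`. -/
def interMap (f : X → Y) (k : ι → κ) (h : ∀ i, ∀ x ∈ U i, f x ∈ V (k i)) {n : ℕ}
    (s : Fin n → ι) (x : inter U s) : inter V (k ∘ s) :=
  ⟨f x.1, fun a => h (s a) x.1 (x.2 a)⟩

theorem continuous_interMap {f : X → Y} (hf : Continuous f) (k : ι → κ)
    (h : ∀ i, ∀ x ∈ U i, f x ∈ V (k i)) {n : ℕ} (s : Fin n → ι) :
    Continuous (interMap (V := V) f k h s) :=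
  (hf.comp continuous_subtype_val).subtype_mk _

/-- The pull-back of Čech cochains. -/
def cochainMap (A : Type*) [AddCommGroup A] (f : X → Y) (k : ι → κ)
    (h : ∀ i, ∀ x ∈ U i, f x ∈ V (k i)) (p : ℕ) : Cochain V A p →+ Cochain U A p where
  toFun g s x := g (k ∘ s) (interMap f k h s x)
  map_zero' := rfl
  map_add' _ _ := rfl

/-- The locally constant cochains, i.e. the cochains with values in the constant sheaf `A`. -/
def locConst (U : ι → Opens X) (A : Type*) [AddCommGroup A] (p : ℕ) :
    AddSubgroup (Cochain U A p) where
  carrier := {f | ∀ s, IsLocallyConstant (f s)}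
  zero_mem' _ := IsLocallyConstant.const 0
  add_mem' hf hg s := (hf s).add (hg s)
  neg_mem' hf s := (hf s).neg

theorem cochainMap_locConst {A : Type*} [AddCommGroup A] {f : X → Y} (hf : Continuous f)
    (k : ι → κ) (h : ∀ i, ∀ x ∈ U i, f x ∈ V (k i)) {p : ℕ} {g : Cochain V A p}
    (hg : g ∈ locConst V A p) : cochainMap A f k h p g ∈ locConst U A p :=
  fun s => (hg (k ∘ s)).comp_continuous (continuous_interMap hf k h s)

end Cech

/-! ### Direct limits of abelian groups over a system of covers -/

section Limits

open Classical in
/-- The subgroup of `⨁ A_c` generated by all `x - x|_{c'}`, for `x ∈ A_c` and `c'` a refinement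
of `c`. -/
def limRelations {C : Type*} (A : C → Type*) [∀ c, AddCommGroup (A c)] {R : C → C → Type*}
    (res : ∀ {c' c : C}, R c' c → A c →+ A c') : AddSubgroup (DirectSum C A) :=
  AddSubgroup.closure {z | ∃ (c' c : C) (m : R c' c) (x : A c),
    z = DirectSum.of A c x - DirectSum.of A c' (res m x)}

/-- The direct limit (colimit) of the groups `A_c` along the restriction maps. -/
abbrev Lim {C : Type*} (A : C → Type*) [∀ c, AddCommGroup (A c)] {R : C → C → Type*}
    (res : ∀ {c' c : C}, R c' c → A c →+ A c') :=
  DirectSum C A ⧸ limRelations A res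

open Classical in
/-- The canonical homomorphism `A_c → lim A`. -/
def Lim.of {C : Type*} (A : C → Type*) [∀ c, AddCommGroup (A c)] {R : C → C → Type*}
    (res : ∀ {c' c : C}, R c' c → A c →+ A c') (c : C) : A c →+ Lim A res :=
  (QuotientAddGroup.mk' (limRelations A res)).comp (DirectSum.of A c)

end Limits

/-! ### Relative cohomology -/

section RelativeCohomology

variable {EM : Type*} [NormedAddCommGroup EM] [NormedSpace ℝ EM]
  {M : Type u} [TopologicalSpace M] [ChartedSpace EM M]
  {EN : Type*} [NormedAddCommGroup EN] [NormedSpace ℝ EN]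
  {N : Type u} [TopologicalSpace N] [ChartedSpace EN N]
  {Φ : C^∞⟮𝓘(ℝ, EM), M; 𝓘(ℝ, EN), N⟯}

/-- The cochains of degree `p + 1` of the algebraic mapping cone of
`Φ^* : C^*(V, A) → C^*(U, A)`, i.e. `C^p(U, A) ⊕ C^{p+1}(V, A)`. -/
abbrev RelCochain (c : RelCover Φ) (A : Type*) (p : ℕ) := Cochain c.U A p × Cochain c.V A (p + 1)

/-- The pull-back `Φ^* : C^p(V, A) → C^p(U, A)`. -/
def RelCover.pull (c : RelCover Φ) (A : Type*) [AddCommGroup A] (p : ℕ) :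
    Cochain c.V A p →+ Cochain c.U A p :=
  cochainMap A Φ Sigma.fst c.map_mem p

/-- The differential `d(α, β) = (Φ^* β - δα, δβ)` of the mapping cone. -/
def relD (c : RelCover Φ) (A : Type*) [AddCommGroup A] (p : ℕ) :
    RelCochain c A p →+ RelCochain c A (p + 1) :=
  ((c.pull A (p + 1)).comp (AddMonoidHom.snd _ _) -
      (cechD c.U A p).comp (AddMonoidHom.fst _ _)).prod
    ((cechD c.V A (p + 1)).comp (AddMonoidHom.snd _ _))

/-- The relative cochains with values in the constant sheaf `ℤ`. -/
def intCochains (c : RelCover Φ) (p : ℕ) : AddSubgroup (RelCochain c ℤ p) :=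
  (locConst c.U ℤ p).prod (locConst c.V ℤ (p + 1))

/-- The integral relative cocycles of degree `p + 1`. -/
def intCocycles (c : RelCover Φ) (p : ℕ) : AddSubgroup (RelCochain c ℤ p) :=
  intCochains c p ⊓ (relD c ℤ p).ker

/-- The integral relative coboundaries of degree `p + 2`. -/
def intCoboundaries (c : RelCover Φ) (p : ℕ) : AddSubgroup (RelCochain c ℤ (p + 1)) :=
  (intCochains c p).map (relD c ℤ p)

/-- The integral relative Čech cohomology group `H^{p+2}(c, ℤ)` of the covers `c`. -/
abbrev intCohomology (c : RelCover Φ) (p : ℕ) :=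
  intCocycles c (p + 1) ⧸ (intCoboundaries c p).addSubgroupOf (intCocycles c (p + 1))

/-- The restriction of relative cochains to a refinement. -/
def cochainRes {c' c : RelCover Φ} (m : Refinement c' c) (A : Type*) [AddCommGroup A] (p : ℕ) :
    RelCochain c A p →+ RelCochain c' A p :=
  (cochainMap A id m.idx m.U_le p).prodMap (cochainMap A id m.f m.V_le (p + 1))

theorem cochainRes_relD {c' c : RelCover Φ} (m : Refinement c' c) (A : Type*) [AddCommGroup A]
    (p : ℕ) (z : RelCochain c A p) :
    cochainRes m A (p + 1) (relD c A p z) = relD c' A p (cochainRes m A p z) := rfl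

theorem cochainRes_mem_cochains {c' c : RelCover Φ} (m : Refinement c' c) {p : ℕ}
    {z : RelCochain c ℤ p} (hz : z ∈ intCochains c p) : cochainRes m ℤ p z ∈ intCochains c' p :=
  ⟨cochainMap_locConst continuous_id _ _ hz.1, cochainMap_locConst continuous_id _ _ hz.2⟩

theorem cochainRes_mem_cocycles {c' c : RelCover Φ} (m : Refinement c' c) {p : ℕ}
    {z : RelCochain c ℤ p} (hz : z ∈ intCocycles c p) : cochainRes m ℤ p z ∈ intCocycles c' p := by
  refine ⟨cochainRes_mem_cochains m hz.1, ?_⟩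
  have h : relD c ℤ p z = 0 := hz.2
  change relD c' ℤ p (cochainRes m ℤ p z) = 0
  rw [← cochainRes_relD, h, map_zero]

theorem cochainRes_mem_coboundaries {c' c : RelCover Φ} (m : Refinement c' c) {p : ℕ}
    {z : RelCochain c ℤ (p + 1)} (hz : z ∈ intCoboundaries c p) :
    cochainRes m ℤ (p + 1) z ∈ intCoboundaries c' p := by
  obtain ⟨y, hy, rfl⟩ := hz
  exact ⟨_, cochainRes_mem_cochains m hy, (cochainRes_relD m ℤ p y).symm⟩

/-- The restriction of relative cocycles to a refinement. -/
def cocycleRes {c' c : RelCover Φ} (m : Refinement c' c) (p : ℕ) :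
    intCocycles c p →+ intCocycles c' p :=
  ((cochainRes m ℤ p).comp (intCocycles c p).subtype).codRestrict _
    fun z => cochainRes_mem_cocycles m z.2

/-- The restriction of relative cohomology to a refinement. -/
def cohomologyRes {c' c : RelCover Φ} (m : Refinement c' c) (p : ℕ) :
    intCohomology c p →+ intCohomology c' p :=
  QuotientAddGroup.map _ _ (cocycleRes m (p + 1)) fun _ hz => cochainRes_mem_coboundaries m hz

/-- The integral relative cohomology group `H³(Φ, ℤ)`: the direct limit, over all pairs of open
covers, of the cohomology of the mapping cone of the Čech complexes of `N` and `M`. -/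
abbrev H3 (Φ : C^∞⟮𝓘(ℝ, EM), M; 𝓘(ℝ, EN), N⟯) :=
  Lim (fun c : RelCover Φ => intCohomology c 1) (fun m => cohomologyRes m 1)

/-- The class in `H³(Φ, ℤ)` of an integral relative cocycle of degree 3. -/
def H3.mk {c : RelCover Φ} (z : intCocycles c 2) : H3 Φ :=
  Lim.of (fun c : RelCover Φ => intCohomology c 1) (fun m => cohomologyRes m 1) c
    (QuotientAddGroup.mk z)

/-! ### The group of relative gerbes and the Dixmier–Douady class -/

/-- The group `Ger(Φ)` of relative gerbes: the direct limit over all pairs of open covers of the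
groups of isomorphism classes of relative gerbes. -/
abbrev Ger (Φ : C^∞⟮𝓘(ℝ, EM), M; 𝓘(ℝ, EN), N⟯) :=
  Lim (GerOn (Φ := Φ)) (fun m => GerOn.restrict m)

/-- The class in `Ger(Φ)` of a relative gerbe. -/
def Ger.mk {c : RelCover Φ} (G : RelGerbe c) : Ger Φ :=
  Lim.of (GerOn (Φ := Φ)) (fun m => GerOn.restrict m) c (GerOn.mk G)

namespace RelGerbe

/-- The line bundle `E_i ⊗ Φ^* E'_{r i}⁻¹` on `U_i`. -/
def differenceBundle {c : RelCover Φ} (G : RelGerbe c) (Q : QuasiLineBundle G.gerbe)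
    (i : Σ j, c.K j) : HermitianLineBundle EM (c.U i) :=
  (G.quasi.B i).tensor ((Q.B i.1).pullback (restrictOpens Φ _ _ (c.map_mem i))).dual

/-- The coefficient of a section `ξ` of `E_i ⊗ Φ^* E'_{r i}⁻¹` with respect to `e ⊗ e'⁻¹`. -/
def coefDiff {c : RelCover Φ} {G : RelGerbe c} {Q : QuasiLineBundle G.gerbe} {i : Σ j, c.K j}
    (ξ : UnitarySection (G.differenceBundle Q i)) (x : c.U i) (e : (G.quasi.B i).fiber x)
    (e' : (Q.B i.1).fiber (restrictOpens (E := EM) (F := EN) Φ _ _ (c.map_mem i) x)) : ℂ :=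
  inner ℂ (tmul e (covec e')) (ξ.val x)

/-- The condition which defines `Ger₀`: the gerbe `𝒢` on `N` admits a quasi-line bundle
`𝓛' = (E', ψ')` such that the line bundle `𝓛 ⊗ Φ^* 𝓛'⁻¹` on `M` admits a unitary section. This
line bundle is glued from the bundles `E_i ⊗ Φ^* E'_{r i}⁻¹` by means of the unitary sections
`ψ ⊗ Φ^* ψ'⁻¹` of `δ(E ⊗ Φ^* E'⁻¹)⁻¹`. Thus a section is given by sections `ξ_i` with
`(δξ)⁻¹ = ψ ⊗ Φ^* ψ'⁻¹`; this is expressed by coefficients with respect to arbitrary unit vectors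
`e_i, e_{i'}` of `E`, `e'_i, e'_{i'}` of `E'` and `ℓ` of `L_{r i, r i'}`. -/
def IsTrivial {c : RelCover Φ} (G : RelGerbe c) : Prop :=
  ∃ (Q : QuasiLineBundle G.gerbe) (ξ : ∀ i, UnitarySection (G.differenceBundle Q i)),
    ∀ (s : Fin 2 → Σ j, c.K j) (x : inter c.U s)
      (e : ∀ a, (G.quasi.B (s a)).fiber (restrVertex (E := EM) c.U s a x))
      (e' : ∀ a, (Q.B (s a).1).fiber (restrictOpens (E := EM) (F := EN) Φ _ _ (c.map_mem (s a))
        (restrVertex (E := EM) c.U s a x)))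
      (ℓ : (G.gerbe.L (Sigma.fst ∘ s)).fiber (mapInter Φ Sigma.fst c.map_mem s x)),
      (∀ a, ‖e a‖ = 1) → (∀ a, ‖e' a‖ = 1) → ‖ℓ‖ = 1 →
      coefE (Q.ψ (Sigma.fst ∘ s)) (mapInter Φ Sigma.fst c.map_mem s x) (e' 1) (e' 0) ℓ =
        coefE (G.quasi.ψ s) x (e 1) (e 0) ℓ *
          (coefDiff (ξ (s 1)) (restrVertex (E := EM) c.U s 1 x) (e 1) (e' 1) *
            (coefDiff (ξ (s 0)) (restrVertex (E := EM) c.U s 0 x) (e 0) (e' 0))⁻¹)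

/-- Relative gerbes (on possibly different covers) are equivalent if, on a common refinement of
the covers, the quotient `G ⊗ G'⁻¹` satisfies the condition defining `Ger₀`. -/
def Equivalent {c c' : RelCover Φ} (G : RelGerbe c) (G' : RelGerbe c') : Prop :=
  ∃ (d : RelCover Φ) (m : Refinement d c) (m' : Refinement d c'),
    ((G.restrict m).tensor (G'.restrict m').dual).IsTrivial

/-- The real Čech cochain `f` consists of smooth functions `f_s : U_s → ℝ`. -/
def SmoothCochain {E : Type*} [NormedAddCommGroup E] [NormedSpace ℝ E] {X : Type u}
    [TopologicalSpace X] [ChartedSpace E X] {ι : Type u} {U : ι → Opens X} {p : ℕ}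
    (f : Cochain U ℝ p) : Prop :=
  ∀ s, ContMDiff 𝓘(ℝ, E) 𝓘(ℝ, ℝ) ∞ (f s)

/-- The integral cocycle `z` is a relative Dixmier–Douady cocycle of `(𝓛, 𝒢)`. For this one chooses
unitary sections `σ` of the bundles `L_{jj'}` and `λ` of the bundles `E_i`. The `U(1)`-valued
cochains `t = (δσ) θ⁻¹` and `s = ψ⁻¹ ((δλ)⁻¹ ⊗ Φ^* σ)` form a relative cocycle `(s, t)`. Writing
`s = exp(2πi a)` and `t = exp(2πi b)` with smooth real cochains `a` and `b`, the cocycle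
`z = d(a, b)` represents the image of `[(s, t)] ∈ H²(Φ, U(1))` in `H³(Φ, ℤ)`. -/
def IsDDCocycle {c : RelCover Φ} (G : RelGerbe c) (z : intCocycles c 2) : Prop :=
  ∃ (σ : ∀ s, UnitarySection (G.gerbe.L s)) (lam : ∀ i, UnitarySection (G.quasi.B i))
    (a : Cochain c.U ℝ 1) (b : Cochain c.V ℝ 2),
    SmoothCochain (E := EM) a ∧ SmoothCochain (E := EN) b ∧
    (∀ v x, Complex.exp (2 * Real.pi * Complex.I * b v x) =
      (coefL (G.gerbe.θ v) x ((σ _).val _) ((σ _).val _) ((σ _).val _))⁻¹) ∧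
    (∀ s x, Complex.exp (2 * Real.pi * Complex.I * a s x) =
      (coefE (G.quasi.ψ s) x ((lam (s 1)).val _) ((lam (s 0)).val _)
        ((σ (Sigma.fst ∘ s)).val (mapInter Φ Sigma.fst c.map_mem s x)))⁻¹) ∧
    relD c ℝ 1 (a, b) = (fun s x => (z.1.1 s x : ℝ), fun s x => (z.1.2 s x : ℝ))

end RelGerbe

/-- The subset `Ger₀(Φ)` of `Ger(Φ)`: the classes of the relative gerbes `(𝓛, 𝒢)` such that `𝒢`
admits a quasi-line bundle `𝓛'` for which `𝓛 ⊗ Φ^* 𝓛'⁻¹` admits a unitary section. -/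
def Ger0 (Φ : C^∞⟮𝓘(ℝ, EM), M; 𝓘(ℝ, EN), N⟯) : Set (Ger Φ) :=
  {x | ∃ (c : RelCover Φ) (G : RelGerbe c), Ger.mk G = x ∧ G.IsTrivial}

end RelativeCohomology

end RelativeGerbe

end

/-! The proof is the exponential sequence, applied to the mapping cone. Choosing unitary sections
`σ` of the `L_{jj'}` and `λ` of the `E_i` turns a relative gerbe into a `U(1)`-valued pair `(s, t)`.
The conditions `δψ = θ` and `δθ = 1` say exactly that this pair is a cocycle of the cone
(`IsLog.expOne`). Hence, for a smooth real logarithm `(a, b)`, the cochain `d(a, b)` is an integral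
cocycle (`IsLog.exists_cocycle`). Multiplying the sections by `exp(2πi g)` multiplies `(s, t)` by
`exp(2πi dg)`, and two logarithms of the same pair differ by an integral cochain, so the class of
`d(a, b)` does not depend on the choices (`IsDDCocycle.mk_eq`).

Kernel and image of `κ` come from the acyclicity of smooth cochains, valid on every cover by a
partition of unity (`exists_cechD_eq`, `exists_relD_eq`). An integral cocycle is therefore `d(a, b)`
with smooth `a`, `b`, and trivial bundles with `ψ = exp(-2πi a)`, `θ = exp(-2πi b)` realise it
(`exists_isDDCocycle`). If `d(a, b) = dn` with `n` integral, then `n - (a, b) = dv`, and rescaling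
the sections by `exp(2πi v)` makes `(s, t) = (1, 1)`. At that point `σ` is a quasi-line bundle with
trivial underlying bundles and `λ` is the required section (`Frame.isTrivial`). Conversely, a
trivialisation `(ψ', ξ)` can be used to normalise `σ` and `λ` until `(s, t) = (1, 1)`
(`exists_isDDCocycle_zero`). So `Ger₀` is the kernel of a homomorphism; this proves at once that it
is a subgroup and gives the classification.

Two difficulties remain. Sections and logarithms exist only locally, and one pair of covers must
provide them on all intersections simultaneously. No good cover is used: `exists_refinement` takes
countably many compact sets, ranks them, and prepares each neighbourhood for the finitely many
indices of no larger rank; on a nonempty intersection the member of largest rank takes care of the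
others.

Secondly, parallel refinements need not agree on isomorphism classes of gerbes. For cohomology they
do agree, by the prism homotopy (`cochainRes_sub_mem`), and so a class that vanishes in the limit
vanishes on a finer cover. For gerbes, two parallel refinements are combined into one refinement of
the doubled cover. A Dixmier–Douady cocycle there restricts to cocycles for both, and these have the
same class in the limit (`mk_eq_of_isDD_restrict`). -/

noncomputable section

namespace RelativeGerbe

/-! ### Fine pairs of covers: making local properties hold on all triple intersections. -/

section Refine

/-- A property of open sets which holds locally on the intersections of a family `V` holds, for the
finitely many triples of bounded rank, on a single neighbourhood of a given point, as long as this
neighbourhood meets the closed sets `D a ⊆ V a` involved. -/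
theorem exists_nhd_of_bounded_rank {X : Type u} [TopologicalSpace X] {ι : Type u} (rank : ι → ℕ)
    (hrank : Function.Injective rank) (D : ι → Set X) (hD : ∀ a, IsClosed (D a))
    (V : ι → Opens X) (hDV : ∀ a, ∀ x ∈ D a, x ∈ V a) (P : (Fin 3 → ι) → Opens X → Prop)
    (mono : ∀ s O O', O ≤ O' → P s O' → P s O)
    (loc : ∀ s, ∀ y ∈ inter V s, ∃ O : Opens X, y ∈ O ∧ P s O) (n : ℕ) (y : X) :
    ∃ O : Opens X, y ∈ O ∧ ∀ s, (∀ k, rank (s k) ≤ n) → (∀ k, ∃ z ∈ O, z ∈ D (s k)) → P s O := by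
  classical
  have hfin : Finite {a // rank a ≤ n} :=
    Finite.of_injective (β := Fin (n + 1)) (fun a => ⟨rank a.1, Nat.lt_succ_of_le a.2⟩)
      fun a b h => Subtype.ext (hrank (Fin.mk.inj_iff.1 h))
  -- When `y` lies outside `D a`, the complement of `D a` is used. A neighbourhood inside `A a` that
  -- meets `D a` therefore has its centre in `D a`, hence in `V a`.
  let A (a : {a // rank a ≤ n}) : Opens X := if y ∈ D a.1 then ⊤ else ⟨(D a.1)ᶜ, (hD a.1).isOpen_compl⟩
  have hA : ∀ a, y ∈ A a := fun a => by
    by_cases h : y ∈ D a.1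
    · simp [A, h]
    · simp only [A, h, if_false]; exact h
  have hB : ∀ t : Fin 3 → {a // rank a ≤ n}, ∃ O : Opens X, y ∈ O ∧
      (y ∈ inter V (fun k => (t k).1) → P (fun k => (t k).1) O) := fun t => by
    by_cases h : y ∈ inter V (fun k => (t k).1)
    · obtain ⟨O, h1, h2⟩ := loc _ y h
      exact ⟨O, h1, fun _ => h2⟩
    · exact ⟨⊤, trivial, fun h' => absurd h' h⟩
  choose B hyB hPB using hB
  refine ⟨⟨(⋂ a, (A a : Set X)) ∩ ⋂ t, (B t : Set X),
    (isOpen_iInter_of_finite fun a => (A a).isOpen).inter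
      (isOpen_iInter_of_finite fun t => (B t).isOpen)⟩,
    ⟨Set.mem_iInter.2 hA, Set.mem_iInter.2 hyB⟩, fun s hs hmeet => ?_⟩
  refine mono s _ (B fun k => ⟨s k, hs k⟩) (fun z hz => Set.mem_iInter.1 hz.2 _)
    (hPB (fun k => ⟨s k, hs k⟩) fun k => hDV _ _ ?_)
  obtain ⟨z, hz, hzD⟩ := hmeet k
  by_contra hy
  have := Set.mem_iInter.1 hz.1 ⟨s k, hs k⟩
  simp only [A, hy, if_false] at this
  exact this hzD

/-- A countable refinement, by interiors of closed sets, of a family of open sets. -/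
theorem exists_countable_compact_cover {X : Type u} [TopologicalSpace X] [T2Space X]
    [LocallyCompactSpace X] [SecondCountableTopology X] {ι : Type u} (V : ι → Opens X)
    (hV : ∀ x, ∃ i, x ∈ V i) :
    ∃ (T : Type u) (_ : Countable T) (f : T → ι) (D : T → Set X), (∀ t, IsCompact (D t)) ∧
      (∀ t, ∀ x ∈ D t, x ∈ V (f t)) ∧ ∀ x, ∃ t, x ∈ interior (D t) := by
  choose i hi using hV
  have h : ∀ x, ∃ K : Set X, IsCompact K ∧ x ∈ interior K ∧ K ⊆ V (i x) := fun x =>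
    exists_compact_subset (V (i x)).isOpen (hi x)
  choose K hK hxK hKV using h
  obtain ⟨T, hT, hTu⟩ := TopologicalSpace.countable_cover_nhds (f := fun x => interior (K x))
    fun x => isOpen_interior.mem_nhds (hxK x)
  refine ⟨T, hT.to_subtype, fun t => i t, fun t => K t, fun t => hK t, fun t => hKV t, fun x => ?_⟩
  have hx : x ∈ ⋃ x ∈ T, interior (K x) := hTu ▸ Set.mem_univ x
  simp only [Set.mem_iUnion] at hx
  obtain ⟨t, ht, hx⟩ := hx
  exact ⟨⟨t, ht⟩, hx⟩

variable {EM : Type*} [NormedAddCommGroup EM] [NormedSpace ℝ EM]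
  {M : Type u} [TopologicalSpace M] [ChartedSpace EM M]
  {EN : Type*} [NormedAddCommGroup EN] [NormedSpace ℝ EN]
  {N : Type u} [TopologicalSpace N] [ChartedSpace EN N]
  {Φ : C^∞⟮𝓘(ℝ, EM), M; 𝓘(ℝ, EN), N⟯}

/-- A triple of rank-bounded indices: its member of maximal rank. -/
theorem exists_max_rank {ι : Type*} (rank : ι → ℕ) (s : Fin 3 → ι) :
    ∃ k, ∀ l, rank (s l) ≤ rank (s k) := by
  obtain ⟨k, -, hk⟩ := Finset.exists_max_image Finset.univ (fun k => rank (s k))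
    ⟨0, Finset.mem_univ 0⟩
  exact ⟨k, fun l => hk l (Finset.mem_univ l)⟩

/-- Every pair of covers has a refinement on whose triple intersections given local properties
hold. -/
theorem exists_refinement [T2Space M] [LocallyCompactSpace M] [SecondCountableTopology M]
    [T2Space N] [LocallyCompactSpace N] [SecondCountableTopology N] (c : RelCover Φ)
    (P : (Fin 3 → c.J) → Opens N → Prop) (Pbot : ∀ s, P s ⊥)
    (Pmono : ∀ s O O', O ≤ O' → P s O' → P s O)
    (Ploc : ∀ s, ∀ y ∈ inter c.V s, ∃ O : Opens N, y ∈ O ∧ P s O)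
    (Q : (Fin 3 → Σ j, c.K j) → Opens M → Prop) (Qbot : ∀ s, Q s ⊥)
    (Qmono : ∀ s O O', O ≤ O' → Q s O' → Q s O)
    (Qloc : ∀ s, ∀ y ∈ inter c.U s, ∃ O : Opens M, y ∈ O ∧ Q s O) :
    ∃ (c' : RelCover Φ) (m : Refinement c' c), (∀ s, P (m.f ∘ s) (inter c'.V s)) ∧
      ∀ s, Q (m.idx ∘ s) (inter c'.U s) := by
  classical
  have hΦ : Continuous Φ := Φ.contMDiff.continuous
  obtain ⟨TN, hTN, fN, DN, hDN, hDNV, hcovN⟩ := exists_countable_compact_cover c.V c.cover_V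
  obtain ⟨TM, hTM, fM, DM, hDM, hDMU, hcovM⟩ := exists_countable_compact_cover c.U c.cover_U
  -- The interior of `E t` becomes a member of the cover of `N`: it receives the image of `DM t` and
  -- still lies in the prescribed `V`.
  have hE : ∀ t, ∃ L : Set N, IsCompact L ∧ Φ '' DM t ⊆ interior L ∧ L ⊆ c.V (fM t).1 := fun t =>
    exists_compact_between ((hDM t).image hΦ) (c.V (fM t).1).isOpen (by
      rintro _ ⟨x, hx, rfl⟩
      exact c.map_mem _ _ (hDMU t x hx))
  choose E hEc hEi hEV using hE
  -- The indices from `TN` already cover `N`; those from `TM` are added to give the members of the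
  -- cover of `M` a target.
  let A := TN ⊕ TM
  let D : A → Set N := Sum.elim DN E
  let fA : A → c.J := Sum.elim fN fun t => (fM t).1
  have hD : ∀ a, IsClosed (D a) := by rintro (t | t); exacts [(hDN t).isClosed, (hEc t).isClosed]
  have hDV : ∀ a, ∀ x ∈ D a, x ∈ c.V (fA a) := by rintro (t | t); exacts [hDNV t, hEV t]
  have : Countable A := inferInstanceAs (Countable (TN ⊕ TM))
  obtain ⟨rN, hrN⟩ := Countable.exists_injective_nat A
  obtain ⟨rM, hrM⟩ := Countable.exists_injective_nat TM
  have hnN := fun (a : A) y => exists_nhd_of_bounded_rank rN hrN D hD (fun a => c.V (fA a)) hDV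
    (fun s O => P (fA ∘ s) O) (fun s => Pmono _) (fun s => Ploc _) (rN a) y
  choose ON hyN hPN using hnN
  have hnM := fun (t : TM) y => exists_nhd_of_bounded_rank rM hrM DM
    (fun t => (hDM t).isClosed) (fun t => c.U (fM t)) hDMU
    (fun s O => Q (fM ∘ s) O) (fun s => Qmono _) (fun s => Qloc _) (rM t) y
  choose OM hyM hQM using hnM
  let intN (a : A) : Opens N := ⟨interior (D a), isOpen_interior⟩
  let intM (t : TM) : Opens M := ⟨interior (DM t), isOpen_interior⟩
  -- All points of `N` serve as second index. The neighbourhood `ON a y` is good for every triple of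
  -- indices of rank at most that of `a` whose closed sets it meets.
  let V' : (A × N) → Opens N := fun p => intN p.1 ⊓ ON p.1 p.2
  -- There is nothing over an index from `TN`. Over one from `TM` there is one open set of `M` for
  -- each point of `M`, cut down below by the preimage of its target so that compatibility with `Φ`
  -- holds by construction.
  let K' : (A × N) → Type u := fun p => Sum.elim (fun _ => PEmpty) (fun _ => M) p.1
  let U₀ : ∀ (a : A) (y : N), K' (a, y) → Opens M := fun a y => Sum.rec (motive := fun a =>
    K' (a, y) → Opens M) (fun _ k => PEmpty.elim k)
    (fun t x => (intM t ⊓ OM t x) ⊓ Opens.comap ⟨Φ, hΦ⟩ (V' (Sum.inr t, y))) a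
  let U' : (Σ j, K' j) → Opens M := fun i => U₀ i.1.1 i.1.2 i.2
  let c' : RelCover Φ :=
    { J := A × N
      V := V'
      cover_V := fun y => by
        obtain ⟨t, ht⟩ := hcovN y
        exact ⟨(Sum.inl t, y), ht, hyN _ _⟩
      K := K'
      U := U'
      cover_U := fun x => by
        obtain ⟨t, ht⟩ := hcovM x
        exact ⟨⟨(Sum.inr t, Φ x), x⟩, ⟨ht, hyM _ _⟩,
          hEi t ⟨x, interior_subset ht, rfl⟩, hyN _ _⟩
      map_mem := by
        rintro ⟨⟨t | t, y⟩, k⟩ x hx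
        · exact PEmpty.elim k
        · exact hx.2 }
  let m : Refinement c' c :=
    { f := fun p => fA p.1
      g := fun p => Sum.rec (motive := fun a => K' (a, p.2) → c.K (fA a))
        (fun _ k => PEmpty.elim k) (fun t _ => (fM t).2) p.1
      V_le := fun p y hy => hDV p.1 y (interior_subset hy.1)
      U_le := by
        rintro ⟨⟨t | t, y⟩, k⟩ x hx
        · exact PEmpty.elim k
        · exact hDMU t x (interior_subset hx.1.1) }
  refine ⟨c', m, fun s => ?_, fun s => ?_⟩
  · by_cases hne : ∃ y, y ∈ inter c'.V s
    · obtain ⟨y, hy⟩ := hne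
      -- The neighbourhood attached to the member of largest rank is prepared for all three indices,
      -- and the common point `y` shows that it meets their closed sets.
      obtain ⟨k, hk⟩ := exists_max_rank (fun p : A × N => rN p.1) s
      refine Pmono _ _ (ON (s k).1 (s k).2) (fun z hz => (hz k).2) ?_
      exact hPN (s k).1 (s k).2 (fun l => (s l).1) hk
        fun l => ⟨y, (hy k).2, interior_subset (hy l).1⟩
    · exact Pmono _ _ ⊥ (fun z hz => absurd ⟨z, hz⟩ hne) (Pbot _)
  · by_cases hne : ∃ y, y ∈ inter c'.U s
    · obtain ⟨y, hy⟩ := hne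
      have ht : ∀ l, ∃ (t : TM) (z : N) (x : M), s l = ⟨(Sum.inr t, z), x⟩ := fun l => by
        rcases s l with ⟨⟨t | t, z⟩, x⟩
        · exact PEmpty.elim x
        · exact ⟨t, z, x, rfl⟩
      choose t z x hs using ht
      obtain rfl : s = fun l => ⟨(Sum.inr (t l), z l), x l⟩ := funext hs
      obtain ⟨k, hk⟩ := exists_max_rank rM t
      refine Qmono _ _ (OM (t k) (x k)) (fun w hw => (hw k).1.2) ?_
      exact hQM (t k) (x k) t hk fun l => ⟨y, (hy k).1.2, interior_subset (hy l).1.1⟩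
    · exact Qmono _ _ ⊥ (fun z hz => absurd ⟨z, hz⟩ hne) (Qbot _)

end Refine

/-! ### Common refinements, and the doubling of a pair of covers. -/

section Covers

variable {EM : Type*} [NormedAddCommGroup EM] [NormedSpace ℝ EM]
  {M : Type u} [TopologicalSpace M] [ChartedSpace EM M]
  {EN : Type*} [NormedAddCommGroup EN] [NormedSpace ℝ EN]
  {N : Type u} [TopologicalSpace N] [ChartedSpace EN N]
  {Φ : C^∞⟮𝓘(ℝ, EM), M; 𝓘(ℝ, EN), N⟯}

namespace Refinement

/-- The identity refinement. -/
def id (c : RelCover Φ) : Refinement c c where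
  f j := j
  g _ k := k
  V_le _ _ h := h
  U_le _ _ h := h

/-- The composite of refinements. -/
def comp {c c' c'' : RelCover Φ} (m : Refinement c' c) (n : Refinement c'' c') :
    Refinement c'' c where
  f j := m.f (n.f j)
  g j k := m.g (n.f j) (n.g j k)
  V_le j y h := m.V_le _ y (n.V_le j y h)
  U_le i x h := m.U_le _ x (n.U_le i x h)

end Refinement

namespace RelCover

/-- The pair of covers by the whole manifolds. -/
def whole (Φ : C^∞⟮𝓘(ℝ, EM), M; 𝓘(ℝ, EN), N⟯) : RelCover Φ where
  J := PUnit
  V _ := ⊤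
  cover_V _ := ⟨⟨⟩, trivial⟩
  K _ := PUnit
  U _ := ⊤
  cover_U _ := ⟨⟨⟨⟩, ⟨⟩⟩, trivial⟩
  map_mem _ _ _ := trivial

/-- The common refinement of two pairs of covers. -/
def inf (c c' : RelCover Φ) : RelCover Φ where
  J := c.J × c'.J
  V j := c.V j.1 ⊓ c'.V j.2
  cover_V y := by
    obtain ⟨j, hj⟩ := c.cover_V y
    obtain ⟨j', hj'⟩ := c'.cover_V y
    exact ⟨(j, j'), hj, hj'⟩
  K j := c.K j.1 × c'.K j.2
  U i := c.U ⟨i.1.1, i.2.1⟩ ⊓ c'.U ⟨i.1.2, i.2.2⟩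
  cover_U x := by
    obtain ⟨⟨j, k⟩, hj⟩ := c.cover_U x
    obtain ⟨⟨j', k'⟩, hj'⟩ := c'.cover_U x
    exact ⟨⟨(j, j'), (k, k')⟩, hj, hj'⟩
  map_mem i x hx := ⟨c.map_mem _ x hx.1, c'.map_mem _ x hx.2⟩

/-- The pair of covers in which each member of the covers `c` is repeated twice. -/
def double (c : RelCover Φ) : RelCover Φ where
  J := Bool × c.J
  V j := c.V j.2
  cover_V y := by
    obtain ⟨j, hj⟩ := c.cover_V y
    exact ⟨(true, j), hj⟩
  K j := c.K j.2
  U i := c.U ⟨i.1.2, i.2⟩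
  cover_U x := by
    obtain ⟨⟨j, k⟩, hj⟩ := c.cover_U x
    exact ⟨⟨(true, j), k⟩, hj⟩
  map_mem i x hx := c.map_mem ⟨i.1.2, i.2⟩ x hx

end RelCover

namespace Refinement

/-- The first projection from the common refinement. -/
def infLeft (c c' : RelCover Φ) : Refinement (c.inf c') c where
  f := Prod.fst
  g _ := Prod.fst
  V_le _ _ h := h.1
  U_le _ _ h := h.1

/-- The second projection from the common refinement. -/
def infRight (c c' : RelCover Φ) : Refinement (c.inf c') c' where
  f := Prod.snd
  g _ := Prod.snd
  V_le _ _ h := h.2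
  U_le _ _ h := h.2

/-- The inclusions of `c` into its double. -/
def inDouble (ε : Bool) (c : RelCover Φ) : Refinement c c.double where
  f j := (ε, j)
  g _ k := k
  V_le _ _ h := h
  U_le _ _ h := h

/-- The refinement of doubles induced by a refinement. -/
def mapDouble {c c' : RelCover Φ} (m : Refinement c' c) : Refinement c'.double c.double where
  f j := (j.1, m.f j.2)
  g j k := m.g j.2 k
  V_le j := m.V_le j.2
  U_le i := m.U_le ⟨i.1.2, i.2⟩

/-- The refinement of the double induced by two refinements. -/
def copair {c c' : RelCover Φ} (m n : Refinement c' c) : Refinement c'.double c where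
  f j := match j.1 with
    | true => m.f j.2
    | false => n.f j.2
  g j k := match j with
    | (true, j) => m.g j k
    | (false, j) => n.g j k
  V_le := by
    rintro ⟨_ | _, j⟩ y hy
    exacts [n.V_le j y hy, m.V_le j y hy]
  U_le := by
    rintro ⟨⟨_ | _, j⟩, k⟩ y hy
    exacts [n.U_le ⟨j, k⟩ y hy, m.U_le ⟨j, k⟩ y hy]

end Refinement

/-- A version of `exists_refinement` for local properties of triple intersections of the double. -/
theorem exists_refinement_double [T2Space M] [LocallyCompactSpace M] [SecondCountableTopology M]
    [T2Space N] [LocallyCompactSpace N] [SecondCountableTopology N] (c : RelCover Φ)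
    (P : (Fin 3 → c.double.J) → Opens N → Prop) (Pbot : ∀ s, P s ⊥)
    (Pmono : ∀ s O O', O ≤ O' → P s O' → P s O)
    (Ploc : ∀ s, ∀ y ∈ inter c.double.V s, ∃ O : Opens N, y ∈ O ∧ P s O)
    (Q : (Fin 3 → Σ j, c.double.K j) → Opens M → Prop) (Qbot : ∀ s, Q s ⊥)
    (Qmono : ∀ s O O', O ≤ O' → Q s O' → Q s O)
    (Qloc : ∀ s, ∀ y ∈ inter c.double.U s, ∃ O : Opens M, y ∈ O ∧ Q s O) :
    ∃ (c' : RelCover Φ) (m : Refinement c' c),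
      (∀ s, P (m.mapDouble.f ∘ s) (inter c'.double.V s)) ∧
      ∀ s, Q (m.mapDouble.idx ∘ s) (inter c'.double.U s) := by
  -- A triple of indices of the double is a triple for `c` with one of eight labellings. Requiring
  -- the property for all eight is again a local condition, now on `c`, and the refinement obtained
  -- can be doubled.
  have key : ∀ {X : Type u} [TopologicalSpace X] (R : (Fin 3 → Bool) → Opens X → Prop)
      (_ : ∀ s O O', O ≤ O' → R s O' → R s O) (y : X) (_ : ∀ s, ∃ O : Opens X, y ∈ O ∧ R s O),
      ∃ O : Opens X, y ∈ O ∧ ∀ s, R s O := fun {X} _ R mono y h => by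
    choose O hy hO using h
    exact ⟨⟨⋂ s, (O s : Set X), isOpen_iInter_of_finite fun s => (O s).isOpen⟩,
      Set.mem_iInter.2 hy, fun s => mono s _ (O s) (fun z hz => Set.mem_iInter.1 hz s) (hO s)⟩
  obtain ⟨c', m, h1, h2⟩ := exists_refinement c
    (fun s O => ∀ ε : Fin 3 → Bool, P (fun k => (ε k, s k)) O) (fun s ε => Pbot _)
    (fun s O O' h hO ε => Pmono _ _ _ h (hO ε))
    (fun s y hy => key _ (fun ε => Pmono _) y fun ε => Ploc (fun k => (ε k, s k)) y hy)
    (fun s O => ∀ ε : Fin 3 → Bool, Q (fun k => ⟨(ε k, (s k).1), (s k).2⟩) O) (fun s ε => Qbot _)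
    (fun s O O' h hO ε => Qmono _ _ _ h (hO ε))
    (fun s y hy => key _ (fun ε => Qmono _) y
      fun ε => Qloc (fun k => ⟨(ε k, (s k).1), (s k).2⟩) y hy)
  exact ⟨c', m, fun s => h1 (fun k => (s k).2) fun k => (s k).1,
    fun s => h2 (fun k => ⟨(s k).1.2, (s k).2⟩) fun k => (s k).1.1⟩

end Covers

end RelativeGerbe

end

noncomputable section

namespace RelativeGerbe

/-! ### Čech cochains and their coboundaries in low degrees. -/

section Cochains

variable {X Y : Type u} [TopologicalSpace X] [TopologicalSpace Y] {ι κ : Type u}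
  {U : ι → Opens X} {V : κ → Opens Y} {A : Type*} [AddCommGroup A]

open Classical in
/-- The extension by zero of the members of a cochain. -/
def extend {p : ℕ} (f : Cochain U A p) (s : Fin (p + 1) → ι) (x : X) : A :=
  if h : x ∈ inter U s then f s ⟨x, h⟩ else 0

/-- Extension by zero removes the dependence of the point on the index tuple. Tuples such as `s ∘
k.succAbove` can then be rewritten at a fixed point of `X` without transporting that point between
intersections. -/
theorem extend_of_mem {p : ℕ} (f : Cochain U A p) (s : Fin (p + 1) → ι) (x : inter U s) :
    extend f s x.1 = f s x := dif_pos x.2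

theorem cechD_apply {p : ℕ} (f : Cochain U A p) (s : Fin (p + 2) → ι) (x : inter U s) :
    cechD U A p f s x = ∑ k : Fin (p + 2), (-1 : ℤ) ^ (k : ℕ) • extend f (s ∘ k.succAbove) x.1 := by
  change ∑ k : Fin (p + 2), (-1 : ℤ) ^ (k : ℕ) • f (s ∘ k.succAbove) (face U s k x) = _
  refine Finset.sum_congr rfl fun k _ => ?_
  rw [show x.1 = (face U s k x).1 from rfl, extend_of_mem]

theorem extend_cechD {p : ℕ} (f : Cochain U A p) (s : Fin (p + 2) → ι) {x : X}
    (hx : x ∈ inter U s) :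
    extend (cechD U A p f) s x =
      ∑ k : Fin (p + 2), (-1 : ℤ) ^ (k : ℕ) • extend f (s ∘ k.succAbove) x := by
  rw [show x = (⟨x, hx⟩ : inter U s).1 from rfl, extend_of_mem, cechD_apply]

section Vec

variable {α : Type*} (a b c d e : α)

theorem vec₂_comp_zero : ![a, b] ∘ Fin.succAbove (0 : Fin 2) = ![b] := by
  funext i; fin_cases i; rfl
theorem vec₂_comp_one : ![a, b] ∘ Fin.succAbove (1 : Fin 2) = ![a] := by
  funext i; fin_cases i; rfl
theorem vec₃_comp_zero : ![a, b, c] ∘ Fin.succAbove (0 : Fin 3) = ![b, c] := by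
  funext i; fin_cases i <;> rfl
theorem vec₃_comp_one : ![a, b, c] ∘ Fin.succAbove (1 : Fin 3) = ![a, c] := by
  funext i; fin_cases i <;> rfl
theorem vec₃_comp_two : ![a, b, c] ∘ Fin.succAbove (2 : Fin 3) = ![a, b] := by
  funext i; fin_cases i <;> rfl
theorem vec₄_comp_zero : ![a, b, c, d] ∘ Fin.succAbove (0 : Fin 4) = ![b, c, d] := by
  funext i; fin_cases i <;> rfl
theorem vec₄_comp_one : ![a, b, c, d] ∘ Fin.succAbove (1 : Fin 4) = ![a, c, d] := by
  funext i; fin_cases i <;> rfl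
theorem vec₄_comp_two : ![a, b, c, d] ∘ Fin.succAbove (2 : Fin 4) = ![a, b, d] := by
  funext i; fin_cases i <;> rfl
theorem vec₄_comp_three : ![a, b, c, d] ∘ Fin.succAbove (3 : Fin 4) = ![a, b, c] := by
  funext i; fin_cases i <;> rfl
theorem vec₅_comp_zero : ![a, b, c, d, e] ∘ Fin.succAbove (0 : Fin 5) = ![b, c, d, e] := by
  funext i; fin_cases i <;> rfl
theorem vec₅_comp_one : ![a, b, c, d, e] ∘ Fin.succAbove (1 : Fin 5) = ![a, c, d, e] := by
  funext i; fin_cases i <;> rfl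
theorem vec₅_comp_two : ![a, b, c, d, e] ∘ Fin.succAbove (2 : Fin 5) = ![a, b, d, e] := by
  funext i; fin_cases i <;> rfl
theorem vec₅_comp_three : ![a, b, c, d, e] ∘ Fin.succAbove (3 : Fin 5) = ![a, b, c, e] := by
  funext i; fin_cases i <;> rfl
theorem vec₅_comp_four : ![a, b, c, d, e] ∘ Fin.succAbove (4 : Fin 5) = ![a, b, c, d] := by
  funext i; fin_cases i <;> rfl

theorem eta_vec₃ (s : Fin 3 → α) : s = ![s 0, s 1, s 2] := by funext i; fin_cases i <;> rfl
theorem eta_vec₄ (s : Fin 4 → α) : s = ![s 0, s 1, s 2, s 3] := by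
  funext i; fin_cases i <;> rfl
theorem eta_vec₅ (s : Fin 5 → α) : s = ![s 0, s 1, s 2, s 3, s 4] := by
  funext i; fin_cases i <;> rfl

end Vec

theorem mem_inter_vec₂ {a b : ι} {x : X} : x ∈ inter U ![a, b] ↔ x ∈ U a ∧ x ∈ U b :=
  (Fin.forall_fin_two (p := fun k => x ∈ U (![a, b] k)))

theorem mem_inter_vec₃ {a b c : ι} {x : X} :
    x ∈ inter U ![a, b, c] ↔ x ∈ U a ∧ x ∈ U b ∧ x ∈ U c :=
  ⟨fun h => ⟨h 0, h 1, h 2⟩, fun h k => by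
    fin_cases k; exacts [h.1, h.2.1, h.2.2]⟩

theorem mem_inter_vec₄ {a b c d : ι} {x : X} :
    x ∈ inter U ![a, b, c, d] ↔ x ∈ U a ∧ x ∈ U b ∧ x ∈ U c ∧ x ∈ U d :=
  ⟨fun h => ⟨h 0, h 1, h 2, h 3⟩, fun h k => by
    fin_cases k; exacts [h.1, h.2.1, h.2.2.1, h.2.2.2]⟩

theorem mem_inter_vec₅ {a b c d e : ι} {x : X} :
    x ∈ inter U ![a, b, c, d, e] ↔ x ∈ U a ∧ x ∈ U b ∧ x ∈ U c ∧ x ∈ U d ∧ x ∈ U e :=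
  ⟨fun h => ⟨h 0, h 1, h 2, h 3, h 4⟩, fun h k => by
    fin_cases k; exacts [h.1, h.2.1, h.2.2.1, h.2.2.2.1, h.2.2.2.2]⟩

theorem extend_cechD_zero (f : Cochain U A 0) {a b : ι} {x : X} (ha : x ∈ U a) (hb : x ∈ U b) :
    extend (cechD U A 0 f) ![a, b] x = extend f ![b] x - extend f ![a] x := by
  rw [extend_cechD f _ (mem_inter_vec₂.2 ⟨ha, hb⟩), Fin.sum_univ_two, vec₂_comp_zero,
    vec₂_comp_one]
  simp
  abel

theorem extend_cechD_one (f : Cochain U A 1) {a b c : ι} {x : X} (ha : x ∈ U a) (hb : x ∈ U b)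
    (hc : x ∈ U c) : extend (cechD U A 1 f) ![a, b, c] x =
      extend f ![b, c] x - extend f ![a, c] x + extend f ![a, b] x := by
  rw [extend_cechD f _ (mem_inter_vec₃.2 ⟨ha, hb, hc⟩), Fin.sum_univ_three, vec₃_comp_zero,
    vec₃_comp_one, vec₃_comp_two]
  simp
  abel

theorem extend_cechD_two (f : Cochain U A 2) {a b c d : ι} {x : X} (ha : x ∈ U a) (hb : x ∈ U b)
    (hc : x ∈ U c) (hd : x ∈ U d) : extend (cechD U A 2 f) ![a, b, c, d] x =
      extend f ![b, c, d] x - extend f ![a, c, d] x + extend f ![a, b, d] x -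
        extend f ![a, b, c] x := by
  rw [extend_cechD f _ (mem_inter_vec₄.2 ⟨ha, hb, hc, hd⟩), Fin.sum_univ_four, vec₄_comp_zero,
    vec₄_comp_one, vec₄_comp_two, vec₄_comp_three]
  norm_num [pow_succ]
  abel

theorem extend_cechD_three (f : Cochain U A 3) {a b c d e : ι} {x : X} (ha : x ∈ U a)
    (hb : x ∈ U b) (hc : x ∈ U c) (hd : x ∈ U d) (he : x ∈ U e) :
    extend (cechD U A 3 f) ![a, b, c, d, e] x =
      extend f ![b, c, d, e] x - extend f ![a, c, d, e] x + extend f ![a, b, d, e] x -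
        extend f ![a, b, c, e] x + extend f ![a, b, c, d] x := by
  rw [extend_cechD f _ (mem_inter_vec₅.2 ⟨ha, hb, hc, hd, he⟩), Fin.sum_univ_five, vec₅_comp_zero,
    vec₅_comp_one, vec₅_comp_two, vec₅_comp_three, vec₅_comp_four]
  norm_num [pow_succ]
  abel

theorem cochain_ext {p : ℕ} {f g : Cochain U A p}
    (h : ∀ s, ∀ x ∈ inter U s, extend f s x = extend g s x) : f = g := by
  funext s x
  simpa only [extend_of_mem] using h s x.1 x.2

theorem extend_add {p : ℕ} (f g : Cochain U A p) (s x) :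
    extend (f + g) s x = extend f s x + extend g s x := by
  by_cases h : x ∈ inter U s <;> simp [extend, h]

theorem extend_sub {p : ℕ} (f g : Cochain U A p) (s x) :
    extend (f - g) s x = extend f s x - extend g s x := by
  by_cases h : x ∈ inter U s <;> simp [extend, h]

theorem extend_zero {p : ℕ} (s x) : extend (0 : Cochain U A p) s x = 0 := by
  by_cases h : x ∈ inter U s <;> simp [extend, h]

theorem extend_cochainMap {p : ℕ} (f : X → Y) (k : ι → κ) (h : ∀ i, ∀ x ∈ U i, f x ∈ V (k i))
    (g : Cochain V A p) {s x} (hx : x ∈ inter U s) :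
    extend (cochainMap A f k h p g) s x = extend g (k ∘ s) (f x) := by
  rw [show x = (⟨x, hx⟩ : inter U s).1 from rfl, extend_of_mem,
    show f (⟨x, hx⟩ : inter U s).1 = (interMap (V := V) f k h s ⟨x, hx⟩).1 from rfl, extend_of_mem]
  rfl

theorem cechD_cechD_one (f : Cochain U A 1) : cechD U A 2 (cechD U A 1 f) = 0 :=
  cochain_ext fun s x hx => by
    rw [eta_vec₄ s, extend_cechD_two _ (hx 0) (hx 1) (hx 2) (hx 3),
      extend_cechD_one _ (hx 1) (hx 2) (hx 3), extend_cechD_one _ (hx 0) (hx 2) (hx 3),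
      extend_cechD_one _ (hx 0) (hx 1) (hx 3), extend_cechD_one _ (hx 0) (hx 1) (hx 2), extend_zero]
    abel

theorem cechD_cechD_two (f : Cochain U A 2) : cechD U A 3 (cechD U A 2 f) = 0 :=
  cochain_ext fun s x hx => by
    rw [eta_vec₅ s, extend_cechD_three _ (hx 0) (hx 1) (hx 2) (hx 3) (hx 4),
      extend_cechD_two _ (hx 1) (hx 2) (hx 3) (hx 4),
      extend_cechD_two _ (hx 0) (hx 2) (hx 3) (hx 4),
      extend_cechD_two _ (hx 0) (hx 1) (hx 3) (hx 4),
      extend_cechD_two _ (hx 0) (hx 1) (hx 2) (hx 4),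
      extend_cechD_two _ (hx 0) (hx 1) (hx 2) (hx 3), extend_zero]
    abel

theorem isLocallyConstant_extend {p q : ℕ} {f : Cochain V ℤ p} (hf : f ∈ locConst V ℤ p)
    {s : Fin q → ι} {t : Fin (p + 1) → κ} {g : X → Y} (hg : Continuous g)
    (h : ∀ x ∈ inter U s, g x ∈ inter V t) :
    IsLocallyConstant fun x : inter U s => extend f t (g x.1) := by
  have : (fun x : inter U s => extend f t (g x.1)) =
      f t ∘ fun x : inter U s => (⟨g x.1, h x.1 x.2⟩ : inter V t) :=
    funext fun x => extend_of_mem f t ⟨g x.1, h x.1 x.2⟩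
  rw [this]
  exact (hf t).comp_continuous ((hg.comp continuous_subtype_val).subtype_mk _)

end Cochains

/-! ### The prism homotopy between two refinement maps. -/

section Prism

variable {X : Type u} [TopologicalSpace X] {ι κ : Type u} {U : ι → Opens X} {V : κ → Opens X}
  (p q : ι → κ)

/-- The prism operator, from 2-cochains to 1-cochains, of two refinement maps. -/
def prism₁ (f : Cochain V ℤ 2) : Cochain U ℤ 1 := fun s x =>
  extend f ![p (s 0), q (s 0), q (s 1)] x.1 - extend f ![p (s 0), p (s 1), q (s 1)] x.1

/-- The prism operator, from 3-cochains to 2-cochains, of two refinement maps. -/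
def prism₂ (f : Cochain V ℤ 3) : Cochain U ℤ 2 := fun s x =>
  extend f ![p (s 0), q (s 0), q (s 1), q (s 2)] x.1 -
    extend f ![p (s 0), p (s 1), q (s 1), q (s 2)] x.1 +
    extend f ![p (s 0), p (s 1), p (s 2), q (s 2)] x.1

variable {p q}

theorem prism₁_mem (hp : ∀ i, ∀ x ∈ U i, x ∈ V (p i)) (hq : ∀ i, ∀ x ∈ U i, x ∈ V (q i))
    {f : Cochain V ℤ 2} (hf : f ∈ locConst V ℤ 2) :
    prism₁ p q f ∈ locConst U ℤ 1 := fun s =>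
  (isLocallyConstant_extend hf continuous_id fun x hx =>
    mem_inter_vec₃.2 ⟨hp _ x (hx 0), hq _ x (hx 0), hq _ x (hx 1)⟩).sub
  (isLocallyConstant_extend hf continuous_id fun x hx =>
    mem_inter_vec₃.2 ⟨hp _ x (hx 0), hp _ x (hx 1), hq _ x (hx 1)⟩)

theorem prism₂_mem (hp : ∀ i, ∀ x ∈ U i, x ∈ V (p i)) (hq : ∀ i, ∀ x ∈ U i, x ∈ V (q i))
    {f : Cochain V ℤ 3} (hf : f ∈ locConst V ℤ 3) :
    prism₂ p q f ∈ locConst U ℤ 2 := fun s =>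
  ((isLocallyConstant_extend hf continuous_id fun x hx =>
    mem_inter_vec₄.2 ⟨hp _ x (hx 0), hq _ x (hx 0), hq _ x (hx 1), hq _ x (hx 2)⟩).sub
  (isLocallyConstant_extend hf continuous_id fun x hx =>
    mem_inter_vec₄.2 ⟨hp _ x (hx 0), hp _ x (hx 1), hq _ x (hx 1), hq _ x (hx 2)⟩)).add
  (isLocallyConstant_extend hf continuous_id fun x hx =>
    mem_inter_vec₄.2 ⟨hp _ x (hx 0), hp _ x (hx 1), hp _ x (hx 2), hq _ x (hx 2)⟩)

theorem extend_prism₁ (f : Cochain V ℤ 2) {a b : ι} {x : X} (ha : x ∈ U a) (hb : x ∈ U b) :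
    extend (prism₁ (U := U) p q f) ![a, b] x =
      extend f ![p a, q a, q b] x - extend f ![p a, p b, q b] x :=
  extend_of_mem _ _ ⟨x, mem_inter_vec₂.2 ⟨ha, hb⟩⟩

theorem extend_prism₂ (f : Cochain V ℤ 3) {a b c : ι} {x : X} (ha : x ∈ U a) (hb : x ∈ U b)
    (hc : x ∈ U c) : extend (prism₂ (U := U) p q f) ![a, b, c] x =
      extend f ![p a, q a, q b, q c] x - extend f ![p a, p b, q b, q c] x +
        extend f ![p a, p b, p c, q c] x :=
  extend_of_mem _ _ ⟨x, mem_inter_vec₃.2 ⟨ha, hb, hc⟩⟩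

/-- On cochains `f` of degree 2 the difference of `q^*` and `p^*` is `δh + hδ`, where `h δf` is
expanded. -/
theorem cechD_prism₁ (hp : ∀ i, ∀ x ∈ U i, x ∈ V (p i)) (hq : ∀ i, ∀ x ∈ U i, x ∈ V (q i))
    (f : Cochain V ℤ 2) :
    cochainMap ℤ id q hq 2 f - cochainMap ℤ id p hp 2 f =
      cechD U ℤ 1 (prism₁ p q f) + prism₂ p q (cechD V ℤ 2 f) :=
  cochain_ext fun s x hx => by
    have p0 := hp _ x (hx 0); have p1 := hp _ x (hx 1); have p2 := hp _ x (hx 2)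
    have q0 := hq _ x (hx 0); have q1 := hq _ x (hx 1); have q2 := hq _ x (hx 2)
    have x0 : x ∈ U (s 0) := hx 0
    have x1 : x ∈ U (s 1) := hx 1
    have x2 : x ∈ U (s 2) := hx 2
    have e : ∀ k : ι → κ, k ∘ ![s 0, s 1, s 2] = ![k (s 0), k (s 1), k (s 2)] := fun k => by
      funext i; fin_cases i <;> rfl
    rw [eta_vec₃ s] at hx ⊢
    rw [extend_sub, extend_add, extend_cochainMap _ _ _ _ hx, extend_cochainMap _ _ _ _ hx, e, e]
    rw [extend_cechD_one _ x0 x1 x2, extend_prism₂ _ x0 x1 x2,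
      extend_prism₁ _ x1 x2, extend_prism₁ _ x0 x2, extend_prism₁ _ x0 x1]
    rw [extend_cechD_two _ p0 q0 q1 q2, extend_cechD_two _ p0 p1 q1 q2,
      extend_cechD_two _ p0 p1 p2 q2]
    simp only [id]
    abel

/-- The homotopy formula one degree higher. Its second term is built from the coboundary of `f`,
which vanishes here. -/
theorem cechD_prism₂ (hp : ∀ i, ∀ x ∈ U i, x ∈ V (p i)) (hq : ∀ i, ∀ x ∈ U i, x ∈ V (q i))
    (f : Cochain V ℤ 3) (hf : cechD V ℤ 3 f = 0) :
    cochainMap ℤ id q hq 3 f - cochainMap ℤ id p hp 3 f = cechD U ℤ 2 (prism₂ p q f) :=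
  cochain_ext fun s x hx => by
    have p0 := hp _ x (hx 0); have p1 := hp _ x (hx 1); have p2 := hp _ x (hx 2)
    have p3 := hp _ x (hx 3); have q3 := hq _ x (hx 3)
    have q0 := hq _ x (hx 0); have q1 := hq _ x (hx 1); have q2 := hq _ x (hx 2)
    have x0 : x ∈ U (s 0) := hx 0
    have x1 : x ∈ U (s 1) := hx 1
    have x2 : x ∈ U (s 2) := hx 2
    have x3 : x ∈ U (s 3) := hx 3
    have e : ∀ k : ι → κ, k ∘ ![s 0, s 1, s 2, s 3] = ![k (s 0), k (s 1), k (s 2), k (s 3)] :=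
      fun k => by funext i; fin_cases i <;> rfl
    -- The four simplices that triangulate the prism over a 3-simplex. In the alternating sum of
    -- their cocycle relations the inner faces cancel; the top, the bottom and the side walls
    -- remain.
    have h0 := extend_cechD_three f p0 q0 q1 q2 q3
    have h1 := extend_cechD_three f p0 p1 q1 q2 q3
    have h2 := extend_cechD_three f p0 p1 p2 q2 q3
    have h3 := extend_cechD_three f p0 p1 p2 p3 q3
    rw [hf, extend_zero] at h0 h1 h2 h3
    rw [eta_vec₄ s] at hx ⊢
    rw [extend_sub, extend_cochainMap _ _ _ _ hx, extend_cochainMap _ _ _ _ hx, e, e]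
    rw [extend_cechD_two _ x0 x1 x2 x3, extend_prism₂ _ x1 x2 x3,
      extend_prism₂ _ x0 x2 x3, extend_prism₂ _ x0 x1 x3,
      extend_prism₂ _ x0 x1 x2]
    simp only [id]
    linear_combination -h0 + h1 - h2 + h3

end Prism

/-! ### Acyclicity of smooth cochains. -/

section Fine

variable {E : Type*} [NormedAddCommGroup E] [NormedSpace ℝ E] [FiniteDimensional ℝ E]
  {X : Type u} [TopologicalSpace X] [ChartedSpace E X] [IsManifold 𝓘(ℝ, E) ∞ X] [T2Space X]
  [SecondCountableTopology X] {ι : Type u} {U : ι → Opens X}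

theorem contMDiffAt_extend {E : Type*} [NormedAddCommGroup E] [NormedSpace ℝ E]
    {X : Type u} [TopologicalSpace X] [ChartedSpace E X] {U : ι → Opens X} {p : ℕ}
    {f : Cochain U ℝ p} (hf : RelGerbe.SmoothCochain (E := E) f) {s x} (hx : x ∈ inter U s) :
    ContMDiffAt 𝓘(ℝ, E) 𝓘(ℝ, ℝ) ∞ (extend f s) x := by
  have h := (hf s) ⟨x, hx⟩
  rw [show f s = fun x : inter U s => extend f s x.1 from
    funext fun x => (extend_of_mem f s x).symm] at h
  exact contMDiffAt_subtype_iff.1 h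

/-- The sheaf of smooth functions is acyclic for Čech cohomology. -/
theorem exists_cechD_eq (hU : ∀ x, ∃ i, x ∈ U i) {p : ℕ} (f : Cochain U ℝ (p + 1))
    (hf : RelGerbe.SmoothCochain (E := E) f) (hd : cechD U ℝ (p + 1) f = 0) :
    ∃ g : Cochain U ℝ p, RelGerbe.SmoothCochain (E := E) g ∧ cechD U ℝ p g = f := by
  have : LocallyCompactSpace X := Manifold.locallyCompact_of_finiteDimensional 𝓘(ℝ, E)
  obtain ⟨ρ, hρ⟩ := SmoothPartitionOfUnity.exists_isSubordinate 𝓘(ℝ, E) isClosed_univ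
    (fun i => (U i : Set X)) (fun i => (U i).isOpen)
    (fun x _ => Set.mem_iUnion.2 (hU x))
  have mem_cons : ∀ {q : ℕ} {k : ι} {s : Fin q → ι} {x : X}, x ∈ U k → x ∈ inter U s →
      x ∈ inter U (Fin.cons k s : Fin (q + 1) → ι) := fun hk hs i => by
    refine Fin.cases ?_ (fun i => ?_) i
    exacts [hk, hs i]
  -- The usual contracting homotopy `∑ ρ_k f_{k s}`. Each summand is smooth after extension by zero,
  -- because the support of `ρ_k` is contained in `U_k`.
  let g : Cochain U ℝ p := fun s x => ∑ᶠ k, ρ k x.1 • extend f (Fin.cons k s : Fin (p + 2) → ι) x.1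
  refine ⟨g, fun s x => ?_, cochain_ext fun s x hx => ?_⟩
  · refine (contMDiffAt_subtype_iff (f := fun y => ∑ᶠ k, ρ k y •
      extend f (Fin.cons k s : Fin (p + 2) → ι) y)).2 (ρ.contMDiffAt_finsum fun k hk => ?_)
    exact contMDiffAt_extend hf (mem_cons (hρ k hk) x.2)
  · have h1 : ∀ i : Fin (p + 2), extend g (s ∘ i.succAbove) x = ∑ k ∈ ρ.finsupport x, ρ k x •
        extend f (Fin.cons k (s ∘ i.succAbove) : Fin (p + 2) → ι) x := fun i => by
      rw [ρ.sum_finsupport_smul_eq_finsum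
        (φ := fun k y => extend f (Fin.cons k (s ∘ i.succAbove) : Fin (p + 2) → ι) y)]
      exact extend_of_mem g (s ∘ i.succAbove) ⟨x, fun a => hx (i.succAbove a)⟩
    have h2 : ∀ k ∈ ρ.finsupport x, ∑ i : Fin (p + 2), (-1 : ℤ) ^ (i : ℕ) •
        extend f (Fin.cons k (s ∘ i.succAbove) : Fin (p + 2) → ι) x = extend f s x := fun k hk => by
      have hk' : x ∈ U k := hρ k (subset_tsupport _ ((ρ.mem_finsupport x).1 hk))
      -- The cocycle condition on the simplex `(k, s)` isolates `f_s`: the face omitting `k` is `s`,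
      -- and every other face is `k` followed by a face of `s`, with the opposite sign.
      have h := extend_cechD f (Fin.cons k s : Fin (p + 3) → ι) (mem_cons hk' hx)
      rw [hd, extend_zero, Fin.sum_univ_succ] at h
      have e0 : (Fin.cons k s : Fin (p + 3) → ι) ∘ Fin.succAbove 0 = s := by
        funext i; simp
      have e1 : ∀ i : Fin (p + 2), (Fin.cons k s : Fin (p + 3) → ι) ∘ Fin.succAbove i.succ =
          (Fin.cons k (s ∘ i.succAbove) : Fin (p + 2) → ι) := fun i => by
        funext a
        refine Fin.cases ?_ (fun a => ?_) a <;> simp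
      simp only [e0, e1, Fin.val_zero, pow_zero, one_smul, Fin.val_succ, pow_succ, mul_neg, mul_one,
        neg_smul, Finset.sum_neg_distrib] at h
      linarith
    rw [extend_cechD g s hx]
    simp only [h1, Finset.smul_sum]
    rw [Finset.sum_comm]
    have h3 : ∀ k ∈ ρ.finsupport x, ∑ i : Fin (p + 2), (-1 : ℤ) ^ (i : ℕ) • ρ k x •
        extend f (Fin.cons k (s ∘ i.succAbove) : Fin (p + 2) → ι) x =
        ρ k x • extend f s x := fun k hk => by
      rw [← h2 k hk, Finset.smul_sum]
      exact Finset.sum_congr rfl fun i _ => smul_comm _ _ _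
    rw [Finset.sum_congr rfl h3, ← Finset.sum_smul, ρ.sum_finsupport x (Set.mem_univ x), one_smul]

end Fine

end RelativeGerbe

end

noncomputable section

namespace RelativeGerbe

/-! ### Direct limits over a system with several parallel restriction maps. -/

section Limits

variable {C : Type*} (A : C → Type*) [∀ c, AddCommGroup (A c)] {R : C → C → Type*}
  (res : ∀ {c' c : C}, R c' c → A c →+ A c')

theorem Lim.of_res {c' c : C} (m : R c' c) (x : A c) :
    Lim.of A res c' (res m x) = Lim.of A res c x := by
  classical
  refine (QuotientAddGroup.eq.2 ?_)
  refine AddSubgroup.subset_closure ⟨c', c, m, x, ?_⟩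
  rw [sub_eq_add_neg, add_comm]

/-- An element is a finite sum of classes from various stages, and directedness moves the summands
to a single stage. -/
theorem Lim.exists_of [Nonempty C] (dir : ∀ c c', ∃ d, Nonempty (R d c) ∧ Nonempty (R d c'))
    (z : Lim A res) : ∃ c x, Lim.of A res c x = z := by
  classical
  obtain ⟨z, rfl⟩ := QuotientAddGroup.mk_surjective z
  induction z using DirectSum.induction_on with
  | zero => exact ⟨Classical.arbitrary C, 0, map_zero _⟩
  | of c x => exact ⟨c, x, by unfold Lim.of; congr!⟩
  | add z w hz hw =>
    obtain ⟨c, x, hx⟩ := hz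
    obtain ⟨c', x', hx'⟩ := hw
    obtain ⟨d, ⟨m⟩, ⟨m'⟩⟩ := dir c c'
    refine ⟨d, res m x + res m' x', ?_⟩
    rw [map_add, Lim.of_res, Lim.of_res, hx, hx']
    rfl

/-- The homomorphism from a direct limit induced by a compatible family of homomorphisms. -/
def Lim.lift {B : Type*} [AddCommGroup B] (g : ∀ c, A c →+ B)
    (hg : ∀ {c' c : C} (m : R c' c) (x : A c), g c' (res m x) = g c x) : Lim A res →+ B := by
  classical
  refine QuotientAddGroup.lift _ (DirectSum.toAddMonoid g) ?_
  refine (AddSubgroup.closure_le _).2 ?_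
  rintro _ ⟨c', c, m, x, rfl⟩
  change DirectSum.toAddMonoid g _ = 0
  rw [map_sub]
  have h : ∀ c x, DirectSum.toAddMonoid g (DirectSum.of A c x) = g c x := fun c x =>
    DirectSum.toAddMonoid_of g c x
  refine sub_eq_zero.2 ((Eq.trans ?_ (h c x)).trans ((hg m x).symm.trans ((h c' _).symm.trans ?_)))
  · congr!
  · congr!

theorem Lim.lift_of {B : Type*} [AddCommGroup B] (g : ∀ c, A c →+ B)
    (hg : ∀ {c' c : C} (m : R c' c) (x : A c), g c' (res m x) = g c x) (c : C) (x : A c) :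
    Lim.lift A res g hg (Lim.of A res c x) = g c x := by
  classical
  refine Eq.trans ?_ (DirectSum.toAddMonoid_of g c x)
  change DirectSum.toAddMonoid g (DirectSum.of A c x) = _
  congr!

/-- If parallel refinements induce the same restriction map, then an element is zero in the direct
limit only if a restriction of it is zero. -/
theorem Lim.exists_res_eq_zero (dir : ∀ c c', ∃ d, Nonempty (R d c) ∧ Nonempty (R d c'))
    (refl : ∀ c, ∃ m : R c c, ∀ x, res m x = x)
    (comp : ∀ {c c' c'' : C} (m : R c' c) (n : R c'' c'), ∃ l : R c'' c, ∀ x,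
      res l x = res n (res m x))
    (par : ∀ {c c' : C} (m n : R c' c) (x), res m x = res n x) {c : C} {x : A c}
    (hx : Lim.of A res c x = 0) : ∃ (c' : C) (m : R c' c), res m x = 0 := by
  classical
  -- Since parallel refinements act identically, only the existence of a refinement matters. The
  -- system therefore descends to a directed preorder, with an arbitrary refinement chosen for each
  -- relation, and the standard criterion for vanishing in a directed limit applies.
  let _ : Preorder C :=
    { le := fun c c' => Nonempty (R c' c)
      le_refl := fun c => ⟨(refl c).choose⟩
      le_trans := fun c c' c'' ⟨m⟩ ⟨n⟩ => ⟨(comp m n).choose⟩ }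
  have : IsDirectedOrder C := ⟨fun c c' => dir c c'⟩
  let f : ∀ c c' : C, c ≤ c' → A c →+ A c' := fun c c' h => res (Classical.choice h)
  have : DirectedSystem A fun c c' h => f c c' h :=
    { map_self := fun c x => by
        obtain ⟨m, hm⟩ := refl c
        exact (par _ m x).trans (hm x)
      map_map := fun c c' c'' h h' x => by
        obtain ⟨l, hl⟩ := comp (Classical.choice h) (Classical.choice h')
        exact (hl x).symm.trans (par _ _ _) }
  have h := Lim.lift_of A res (B := AddCommGroup.DirectLimit A f)
    (fun c => AddCommGroup.DirectLimit.of A f c) (fun {c' c} m x => by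
      have := AddCommGroup.DirectLimit.of_f (G := A) (f := f) (i := c) (j := c') ⟨m⟩ x
      rw [← this]
      exact congrArg _ (par _ _ _)) c x
  rw [hx, map_zero] at h
  obtain ⟨c', h', h0⟩ := AddCommGroup.DirectLimit.of.zero_exact c x h.symm
  exact ⟨c', _, h0⟩

end Limits

/-! ### Cohomology of the mapping cone and its limit. -/

section Relative

variable {EM : Type*} [NormedAddCommGroup EM] [NormedSpace ℝ EM]
  {M : Type u} [TopologicalSpace M] [ChartedSpace EM M]
  {EN : Type*} [NormedAddCommGroup EN] [NormedSpace ℝ EN]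
  {N : Type u} [TopologicalSpace N] [ChartedSpace EN N]
  {Φ : C^∞⟮𝓘(ℝ, EM), M; 𝓘(ℝ, EN), N⟯}

theorem relD_relD_one (c : RelCover Φ) {A : Type*} [AddCommGroup A] (w : RelCochain c A 1) :
    relD c A 2 (relD c A 1 w) = 0 := by
  refine Prod.ext ?_ (cechD_cechD_two w.2)
  change c.pull A 3 (cechD c.V A 2 w.2) - cechD c.U A 2 (c.pull A 2 w.2 - cechD c.U A 1 w.1) = 0
  rw [map_sub, cechD_cechD_one, sub_zero]
  exact sub_self _

theorem smoothCochain_pull (c : RelCover Φ) {p : ℕ} {b : Cochain c.V ℝ p}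
    (hb : RelGerbe.SmoothCochain (E := EN) b) :
    RelGerbe.SmoothCochain (E := EM) (c.pull ℝ p b) := fun s =>
  (hb (Sigma.fst ∘ s)).comp (mapInter Φ Sigma.fst c.map_mem s).contMDiff

/-- The mapping cone of the complexes of smooth cochains is acyclic. -/
theorem exists_relD_eq [FiniteDimensional ℝ EM] [IsManifold 𝓘(ℝ, EM) ∞ M] [T2Space M]
    [SecondCountableTopology M] [FiniteDimensional ℝ EN] [IsManifold 𝓘(ℝ, EN) ∞ N] [T2Space N]
    [SecondCountableTopology N] (c : RelCover Φ) {p : ℕ} (w : RelCochain c ℝ (p + 1))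
    (h1 : RelGerbe.SmoothCochain (E := EM) w.1) (h2 : RelGerbe.SmoothCochain (E := EN) w.2)
    (hw : relD c ℝ (p + 1) w = 0) :
    ∃ v : RelCochain c ℝ p, RelGerbe.SmoothCochain (E := EM) v.1 ∧
      RelGerbe.SmoothCochain (E := EN) v.2 ∧ relD c ℝ p v = w := by
  obtain ⟨b, hb, hbw⟩ := exists_cechD_eq (E := EN) c.cover_V w.2 h2 (congrArg Prod.snd hw)
  have hw1 : c.pull ℝ (p + 2) w.2 - cechD c.U ℝ (p + 1) w.1 = 0 := congrArg Prod.fst hw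
  -- The first component of `hw`, with `w.2 = δb` inserted, says that `Φ^* b - w.1` is closed. A
  -- primitive `a` of it is what the cone differential asks for.
  obtain ⟨a, ha, haw⟩ := exists_cechD_eq (E := EM) c.cover_U (c.pull ℝ (p + 1) b - w.1)
    (fun s => (smoothCochain_pull c hb s).sub (h1 s)) (by
      rw [map_sub, ← hw1, ← hbw]
      rfl)
  refine ⟨(a, b), ha, hb, Prod.ext ?_ hbw⟩
  change c.pull ℝ (p + 1) b - cechD c.U ℝ p a = w.1
  rw [haw, sub_sub_cancel]

/-- The index maps of a refinement commute with the maps `r`, so the prism operators on `M` and `N`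
are compatible with `Φ^*`. This turns the two separate homotopies into one for the mapping cone. -/
theorem prism₂_pull {c c' : RelCover Φ} (m n : Refinement c' c) (β : Cochain c.V ℤ 3) :
    prism₂ (U := c'.U) m.idx n.idx (c.pull ℤ 3 β) =
      c'.pull ℤ 2 (prism₂ (U := c'.V) m.f n.f β) :=
  cochain_ext fun s x hx => by
    have x0 : x ∈ c'.U (s 0) := hx 0
    have x1 : x ∈ c'.U (s 1) := hx 1
    have x2 : x ∈ c'.U (s 2) := hx 2
    have hm : ∀ i, x ∈ c'.U i → x ∈ c.U (m.idx i) := fun i => m.U_le i x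
    have hn : ∀ i, x ∈ c'.U i → x ∈ c.U (n.idx i) := fun i => n.U_le i x
    have m0 := hm _ x0; have m1 := hm _ x1; have m2 := hm _ x2
    have n0 := hn _ x0; have n1 := hn _ x1; have n2 := hn _ x2
    have e : ∀ (α : Type u) (γ : Type u) (k : α → γ) (a b c d : α),
        k ∘ ![a, b, c, d] = ![k a, k b, k c, k d] :=
      fun α γ k a b c d => by funext i; fin_cases i <;> rfl
    have e' : ∀ (α : Type u) (γ : Type u) (k : α → γ) (a b c : α),
        k ∘ ![a, b, c] = ![k a, k b, k c] :=
      fun α γ k a b c => by funext i; fin_cases i <;> rfl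
    rw [RelCover.pull, RelCover.pull, extend_cochainMap _ _ _ _ hx, eta_vec₃ s,
      extend_prism₂ _ x0 x1 x2, e', extend_prism₂ _ (c'.map_mem _ x x0) (c'.map_mem _ x x1)
        (c'.map_mem _ x x2),
      extend_cochainMap _ _ _ _ (mem_inter_vec₄.2 ⟨m0, n0, n1, n2⟩),
      extend_cochainMap _ _ _ _ (mem_inter_vec₄.2 ⟨m0, m1, n1, n2⟩),
      extend_cochainMap _ _ _ _ (mem_inter_vec₄.2 ⟨m0, m1, m2, n2⟩), e, e, e]
    rfl

/-- Parallel refinements act in the same way on the cohomology of the mapping cone. -/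
theorem cochainRes_sub_mem {c c' : RelCover Φ} (m n : Refinement c' c) {z : RelCochain c ℤ 2}
    (hz : z ∈ intCocycles c 2) :
    cochainRes n ℤ 2 z - cochainRes m ℤ 2 z ∈ intCoboundaries c' 1 := by
  obtain ⟨⟨h1, h2⟩, hd⟩ := hz
  have h1 : z.1 ∈ locConst c.U ℤ 2 := h1
  have h2 : z.2 ∈ locConst c.V ℤ 3 := h2
  have hp : prism₁ m.idx n.idx z.1 ∈ locConst c'.U ℤ 1 := prism₁_mem m.U_le n.U_le h1
  have key := cechD_prism₁ (U := c'.U) (V := c.U) (p := m.idx) (q := n.idx) m.U_le n.U_le z.1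
  have hd : relD c ℤ 2 z = 0 := hd
  have hβ : cechD c.V ℤ 3 z.2 = 0 := congrArg Prod.snd hd
  have hα : c.pull ℤ 3 z.2 - cechD c.U ℤ 2 z.1 = 0 := congrArg Prod.fst hd
  -- The minus sign compensates the `-δ` in the first component of the cone differential. The term
  -- of the homotopy formula that involves `δ z.1 = Φ^* z.2` is supplied by the pull-back of the
  -- prism of `z.2`.
  refine ⟨(-prism₁ m.idx n.idx z.1, prism₂ m.f n.f z.2),
    ⟨(locConst c'.U ℤ 1).neg_mem hp, prism₂_mem m.V_le n.V_le h2⟩, Prod.ext ?_ ?_⟩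
  · change c'.pull ℤ 2 (prism₂ m.f n.f z.2) - cechD c'.U ℤ 1 (-prism₁ m.idx n.idx z.1) = _
    refine Eq.trans ?_ key.symm
    rw [← sub_eq_zero.1 hα, prism₂_pull, map_neg]
    abel
  · exact (cechD_prism₂ m.V_le n.V_le z.2 hβ).symm

theorem cohomologyRes_eq {c c' : RelCover Φ} (m n : Refinement c' c) (x : intCohomology c 1) :
    cohomologyRes m 1 x = cohomologyRes n 1 x := by
  obtain ⟨z, rfl⟩ := QuotientAddGroup.mk_surjective x
  refine QuotientAddGroup.eq.2 ?_
  have := cochainRes_sub_mem m n z.2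
  rw [sub_eq_neg_add] at this
  exact this

theorem exists_common_refinement (c c' : RelCover Φ) :
    ∃ d, Nonempty (Refinement d c) ∧ Nonempty (Refinement d c') :=
  ⟨c.inf c', ⟨Refinement.infLeft c c'⟩, ⟨Refinement.infRight c c'⟩⟩

instance : Nonempty (RelCover Φ) := ⟨RelCover.whole Φ⟩

theorem H3.mk_add {c : RelCover Φ} (z z' : intCocycles c 2) :
    H3.mk (z + z') = H3.mk z + H3.mk z' :=
  map_add ((Lim.of (fun c : RelCover Φ => intCohomology c 1) (fun m => cohomologyRes m 1) c).comp
    (QuotientAddGroup.mk' _)) z z'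

theorem H3.mk_res {c c' : RelCover Φ} (m : Refinement c' c) (z : intCocycles c 2) :
    H3.mk (cocycleRes m 2 z) = H3.mk z :=
  Lim.of_res (fun c : RelCover Φ => intCohomology c 1) (fun m => cohomologyRes m 1) m
    (QuotientAddGroup.mk z)

theorem H3.mk_eq_of_sub_mem {c : RelCover Φ} {z z' : intCocycles c 2}
    (h : z'.1 - z.1 ∈ intCoboundaries c 1) : H3.mk z = H3.mk z' := by
  refine congrArg (Lim.of (fun c : RelCover Φ => intCohomology c 1) _ c) (QuotientAddGroup.eq.2 ?_)
  rw [sub_eq_neg_add] at h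
  exact h

theorem H3.exists_mk_eq (h : H3 Φ) : ∃ (c : RelCover Φ) (z : intCocycles c 2), H3.mk z = h := by
  obtain ⟨c, x, rfl⟩ := Lim.exists_of _ _ exists_common_refinement h
  obtain ⟨z, rfl⟩ := QuotientAddGroup.mk_surjective x
  exact ⟨c, z, rfl⟩

/-- The equality of parallel restrictions enters here: it lets a class that is zero in the limit be
killed by one refinement. Nothing similar is needed, or available in general, for the groups of
gerbes. -/
theorem H3.exists_res_mem {c : RelCover Φ} {z : intCocycles c 2} (h : H3.mk z = 0) :
    ∃ (c' : RelCover Φ) (m : Refinement c' c), (cocycleRes m 2 z).1 ∈ intCoboundaries c' 1 := by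
  obtain ⟨c', m, hm⟩ := Lim.exists_res_eq_zero (fun c : RelCover Φ => intCohomology c 1)
    (fun m => cohomologyRes m 1) exists_common_refinement
    (fun c => ⟨Refinement.id c, fun x => by
      obtain ⟨z, rfl⟩ := QuotientAddGroup.mk_surjective x
      rfl⟩)
    (fun m n => ⟨m.comp n, fun x => by
      obtain ⟨z, rfl⟩ := QuotientAddGroup.mk_surjective x
      rfl⟩)
    cohomologyRes_eq h
  have h0 : (QuotientAddGroup.mk (cocycleRes m 2 z) : intCohomology c' 1) = 0 := hm
  exact ⟨c', m, AddSubgroup.mem_addSubgroupOf.1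
    ((QuotientAddGroup.eq_zero_iff (cocycleRes m 2 z)).1 h0)⟩

theorem Ger.mk_restrict {c c' : RelCover Φ} (m : Refinement c' c) (G : RelGerbe c) :
    Ger.mk (G.restrict m) = Ger.mk G :=
  Lim.of_res (GerOn (Φ := Φ)) (fun m => GerOn.restrict m) m (GerOn.mk G)

theorem Ger.exists_mk_eq (x : Ger Φ) : ∃ (c : RelCover Φ) (G : RelGerbe c), Ger.mk G = x := by
  obtain ⟨c, x, rfl⟩ := Lim.exists_of _ _ exists_common_refinement x
  induction x using Quot.ind with | mk G
  exact ⟨c, G, rfl⟩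

end Relative

end RelativeGerbe

end

/-! ### Pointwise smooth sections of Hermitian line bundles and smooth logarithms. -/

noncomputable section

namespace RelativeGerbe

open HermitianLine

namespace HermitianLine

variable {A B C : HermitianLine}

/-- The space is a line, so the coefficients for two choices of vectors differ by a product of inner
products. The middle one is reversed because `B` enters through its dual. -/
theorem inner_vec₃_eq (a : A) (b : B) (c : C) (a' : A) (b' : B) (c' : C)
    (τ : (A.tensor B.dual).tensor C) (ha : ‖a‖ = 1) (hb : ‖b‖ = 1) (hc : ‖c‖ = 1) :
    inner ℂ (vec₃ a' b' c') τ =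
      (inner ℂ a' a * inner ℂ b b' * inner ℂ c' c * inner ℂ (vec₃ a b c) τ : ℂ) := by
  have h : ‖vec₃ a b c‖ = 1 := by rw [norm_vec₃, ha, hb, hc]; norm_num
  rw [← inner_mul_inner h _ τ, inner_vec₃]

theorem inner_vec₂_eq (a : A) (b : B) (c : C) (a' : A) (b' : B) (c' : C)
    (τ : (A.tensor B.dual).dual.tensor C) (ha : ‖a‖ = 1) (hb : ‖b‖ = 1) (hc : ‖c‖ = 1) :
    inner ℂ (vec₂ a' b' c') τ =
      (inner ℂ a a' * inner ℂ b' b * inner ℂ c' c * inner ℂ (vec₂ a b c) τ : ℂ) := by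
  have h : ‖vec₂ a b c‖ = 1 := by rw [norm_vec₂, ha, hb, hc]; norm_num
  rw [← inner_mul_inner h _ τ, inner_vec₂]

theorem inner_vec₂_smul (a : A) (b : B) (c : C) (τ : (A.tensor B.dual).dual.tensor C)
    (r r' r'' : ℂ) :
    inner ℂ (vec₂ (r • a) (r' • b) (r'' • c)) τ =
      (r * conj r' * conj r'' * inner ℂ (vec₂ a b c) τ : ℂ) := by
  rw [inner_vec₂_eq A.unit B.unit C.unit _ _ _ τ A.norm_unit B.norm_unit C.norm_unit,
    inner_vec₂_eq A.unit B.unit C.unit a b c τ A.norm_unit B.norm_unit C.norm_unit]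
  simp only [inner_smul_left, inner_smul_right]
  ring

end HermitianLine

section Sections

variable {E : Type*} [NormedAddCommGroup E] [NormedSpace ℝ E]
  {X : Type u} [TopologicalSpace X] [ChartedSpace E X]
  {F : Type*} [NormedAddCommGroup F] [NormedSpace ℝ F]
  {Y : Type u} [TopologicalSpace Y] [ChartedSpace F Y]

theorem smoothAt_conj {f : X → ℂ} {x : X} (hf : ContMDiffAt 𝓘(ℝ, E) 𝓘(ℝ, ℂ) ∞ f x) :
    ContMDiffAt 𝓘(ℝ, E) 𝓘(ℝ, ℂ) ∞ (fun x => conj (f x)) x :=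
  (Complex.conjCLE.contDiff.contMDiff (n := ∞)).contMDiffAt.comp x hf

theorem smoothAt_mul {f g : X → ℂ} {x : X} (hf : ContMDiffAt 𝓘(ℝ, E) 𝓘(ℝ, ℂ) ∞ f x)
    (hg : ContMDiffAt 𝓘(ℝ, E) 𝓘(ℝ, ℂ) ∞ g x) :
    ContMDiffAt 𝓘(ℝ, E) 𝓘(ℝ, ℂ) ∞ (fun x => f x * g x) x :=
  ((contDiff_mul (𝕜 := ℝ) (𝔸 := ℂ)).contMDiff (n := ∞)).contMDiffAt.comp x (hf.prodMk_space hg)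

theorem smoothAt_inner_comm {A : X → HermitianLine} {a b : ∀ x, A x} {x : X}
    (h : ContMDiffAt 𝓘(ℝ, E) 𝓘(ℝ, ℂ) ∞ (fun x => inner ℂ (a x) (b x)) x) :
    ContMDiffAt 𝓘(ℝ, E) 𝓘(ℝ, ℂ) ∞ (fun x => inner ℂ (b x) (a x)) x :=
  (smoothAt_conj h).congr_of_eventuallyEq (Filter.Eventually.of_forall fun _ =>
    (inner_conj_symm _ _).symm)

namespace HermitianLineBundle

/-- Smoothness at a point of a (set-theoretic) section of a line bundle. -/
def SmoothAt (L : HermitianLineBundle E X) (v : ∀ x, L.fiber x) (x : X) : Prop :=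
  ∀ e ∈ L.frames, x ∈ e.1 →
    ContMDiffAt 𝓘(ℝ, E) 𝓘(ℝ, ℂ) ∞ (fun y => inner ℂ (e.2 y) (v y)) x

variable {L L' : HermitianLineBundle E X} {v w : ∀ x, L.fiber x} {x : X}

theorem smoothAt_frame {e} (he : e ∈ L.frames) (hx : x ∈ e.1) : L.SmoothAt e.2 x :=
  fun e' he' hx' => (L.smooth_transition e' he' e he).contMDiffAt
    ((e'.1.isOpen.inter e.1.isOpen).mem_nhds ⟨hx', hx⟩)

/-- The inner product of smooth sections is smooth. -/
theorem SmoothAt.inner (hv : L.SmoothAt v x) (hw : L.SmoothAt w x) :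
    ContMDiffAt 𝓘(ℝ, E) 𝓘(ℝ, ℂ) ∞ (fun y => inner ℂ (v y) (w y)) x := by
  obtain ⟨e, he, hx⟩ := L.exists_frame x
  refine (smoothAt_mul (smoothAt_inner_comm (hv e he hx)) (hw e he hx)).congr_of_eventuallyEq ?_
  filter_upwards [e.1.isOpen.mem_nhds hx] with y hy
  exact (inner_mul_inner (L.norm_frame e he y hy) _ _).symm

theorem SmoothAt.tmul {v : ∀ x, L.fiber x} {w : ∀ x, L'.fiber x} (hv : L.SmoothAt v x)
    (hw : L'.SmoothAt w x) : (L.tensor L').SmoothAt (fun x => HermitianLine.tmul (v x) (w x)) x := by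
  rintro _ ⟨a, ha, b, hb, rfl⟩ hx
  exact smoothAt_mul (hv a ha hx.1) (hw b hb hx.2)

theorem SmoothAt.covec (hv : L.SmoothAt v x) : L.dual.SmoothAt (fun x => HermitianLine.covec (v x)) x := by
  rintro _ ⟨a, ha, rfl⟩ hx
  exact (smoothAt_inner_comm (hv a ha hx)).congr_of_eventuallyEq
    (Filter.Eventually.of_forall fun y => inner_covec _ _)

theorem SmoothAt.smul {f : X → ℂ} (hf : ContMDiffAt 𝓘(ℝ, E) 𝓘(ℝ, ℂ) ∞ f x)
    (hv : L.SmoothAt v x) : L.SmoothAt (fun x => f x • v x) x := fun e he hx =>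
  (smoothAt_mul hf (hv e he hx)).congr_of_eventuallyEq
    (Filter.Eventually.of_forall fun _ => inner_smul_right _ _ _)

theorem SmoothAt.pullback {L : HermitianLineBundle F Y} {v : ∀ y, L.fiber y}
    (f : C^∞⟮𝓘(ℝ, E), X; 𝓘(ℝ, F), Y⟯) {x : X} (hv : L.SmoothAt v (f x)) :
    (L.pullback f).SmoothAt (fun x => v (f x)) x := by
  rintro _ ⟨a, ha, rfl⟩ hx
  exact (hv a ha hx).comp x f.contMDiff.contMDiffAt

theorem smoothAt_one : (HermitianLineBundle.trivial (E := E) (X := X)).SmoothAt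
    (fun _ => HermitianLine.one) x :=
  smoothAt_frame (L := HermitianLineBundle.trivial) (e := (⊤, fun _ => HermitianLine.one)) rfl
    (Set.mem_univ x)

theorem exists_unitary_near (L : HermitianLineBundle E X) (x : X) :
    ∃ (O : Opens X) (v : ∀ x, L.fiber x), x ∈ O ∧ ∀ y ∈ O, ‖v y‖ = 1 ∧ L.SmoothAt v y := by
  obtain ⟨e, he, hx⟩ := L.exists_frame x
  exact ⟨e.1, e.2, hx, fun y hy => ⟨L.norm_frame e he y hy, smoothAt_frame he hy⟩⟩

end HermitianLineBundle

theorem UnitarySection.smoothAt {L : HermitianLineBundle E X} (σ : UnitarySection L) (x : X) :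
    L.SmoothAt σ.val x :=
  fun e he hx => (σ.smooth e he).contMDiffAt (e.1.isOpen.mem_nhds hx)

/-- A unitary section from its values. -/
def UnitarySection.ofSmoothAt {L : HermitianLineBundle E X} (v : ∀ x, L.fiber x)
    (hv : ∀ x, ‖v x‖ = 1 ∧ L.SmoothAt v x) : UnitarySection L where
  val := v
  norm_eq x := (hv x).1
  smooth e he x hx := ((hv x).2 e he hx).contMDiffWithinAt

/-- In a local unitary frame `e` one has `⟪e', φ v⟫ = ⟪e', φ e⟫ ⟪e, v⟫`, a product of smooth
functions. -/
theorem BundleIso.smoothAt_map {L L' : HermitianLineBundle E X} (φ : BundleIso L L')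
    {v : ∀ x, L.fiber x} {x : X} (hv : L.SmoothAt v x) :
    L'.SmoothAt (fun x => φ.map x (v x)) x := fun e' he' hx' => by
  obtain ⟨e, he, hx⟩ := L.exists_frame x
  have h := (φ.smooth e he e' he').contMDiffAt
    ((e.1.isOpen.inter e'.1.isOpen).mem_nhds ⟨hx, hx'⟩)
  refine (smoothAt_mul h (hv e he hx)).congr_of_eventuallyEq ?_
  filter_upwards [e.1.isOpen.mem_nhds hx] with y hy
  rw [← LinearIsometryEquiv.inner_map_map (φ.map y) (e.2 y) (v y), inner_mul_inner]
  rw [LinearIsometryEquiv.norm_map, L.norm_frame e he y hy]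

/-- For an isometry, `⟪e, φ⁻¹ v⟫ = ⟪φ e, v⟫`. Smoothness of the inverse thus follows from that of
`φ`, and an isomorphism need not carry it as data. -/
theorem BundleIso.smoothAt_symm {L L' : HermitianLineBundle E X} (φ : BundleIso L L')
    {v : ∀ x, L'.fiber x} {x : X} (hv : L'.SmoothAt v x) :
    L.SmoothAt (fun x => (φ.map x).symm (v x)) x := fun e he hx => by
  refine ((φ.smoothAt_map (HermitianLineBundle.smoothAt_frame he hx)).inner hv).congr_of_eventuallyEq
    (Filter.Eventually.of_forall fun y => ?_)
  change inner ℂ (e.2 y) ((φ.map y).symm (v y)) = inner ℂ (φ.map y (e.2 y)) (v y)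
  rw [← LinearIsometryEquiv.inner_map_map (φ.map y), LinearIsometryEquiv.apply_symm_apply]

variable {ι : Type u} {U : ι → Opens X}

theorem smoothAt_coefL {L : ∀ s : Fin 2 → ι, HermitianLineBundle E (inter U s)} {s : Fin 3 → ι}
    (θ : UnitarySection (deltaL U L s)) {x : inter U s}
    {a : ∀ y, (L (s ∘ Fin.succAbove 0)).fiber y} {b : ∀ y, (L (s ∘ Fin.succAbove 1)).fiber y}
    {c : ∀ y, (L (s ∘ Fin.succAbove 2)).fiber y}
    (ha : (L (s ∘ Fin.succAbove 0)).SmoothAt a (restr (E := E) U s (Fin.succAbove 0) x))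
    (hb : (L (s ∘ Fin.succAbove 1)).SmoothAt b (restr (E := E) U s (Fin.succAbove 1) x))
    (hc : (L (s ∘ Fin.succAbove 2)).SmoothAt c (restr (E := E) U s (Fin.succAbove 2) x)) :
    ContMDiffAt 𝓘(ℝ, E) 𝓘(ℝ, ℂ) ∞ (fun x => coefL θ x (a (restr (E := E) U s _ x))
      (b (restr (E := E) U s _ x)) (c (restr (E := E) U s _ x))) x :=
  HermitianLineBundle.SmoothAt.inner (L := deltaL U L s)
    (((ha.pullback (restr U s (Fin.succAbove 0))).tmul
      (hb.pullback (restr U s (Fin.succAbove 1))).covec).tmul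
        (hc.pullback (restr U s (Fin.succAbove 2)))) (θ.smoothAt x)

theorem smoothAt_coefE {B : ∀ i, HermitianLineBundle E (U i)} {s : Fin 2 → ι}
    {L : HermitianLineBundle E (inter U s)} (ψ : UnitarySection ((deltaE U B s).dual.tensor L))
    {x : inter U s} {a : ∀ y, (B (s 1)).fiber y} {b : ∀ y, (B (s 0)).fiber y} {c : ∀ y, L.fiber y}
    (ha : (B (s 1)).SmoothAt a (restrVertex (E := E) U s 1 x))
    (hb : (B (s 0)).SmoothAt b (restrVertex (E := E) U s 0 x)) (hc : L.SmoothAt c x) :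
    ContMDiffAt 𝓘(ℝ, E) 𝓘(ℝ, ℂ) ∞ (fun x => coefE ψ x (a (restrVertex (E := E) U s _ x))
      (b (restrVertex (E := E) U s _ x)) (c x)) x :=
  HermitianLineBundle.SmoothAt.inner (L := (deltaE U B s).dual.tensor L)
    (((ha.pullback (restrVertex U s 1)).tmul (hb.pullback (restrVertex U s 0)).covec).covec.tmul
      hc) (ψ.smoothAt x)

theorem norm_coefL {L : ∀ s : Fin 2 → ι, HermitianLineBundle E (inter U s)} {s : Fin 3 → ι}
    (θ : UnitarySection (deltaL U L s)) (x : inter U s) {a b c} (ha : ‖a‖ = 1) (hb : ‖b‖ = 1)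
    (hc : ‖c‖ = 1) : ‖coefL θ x a b c‖ = 1 := by
  have h : ‖vec₃ a b c‖ = 1 := by rw [norm_vec₃, ha, hb, hc]; norm_num
  exact (norm_inner_of_unit h _).trans (θ.norm_eq x)

theorem norm_coefE {B : ∀ i, HermitianLineBundle E (U i)} {s : Fin 2 → ι}
    {L : HermitianLineBundle E (inter U s)} (ψ : UnitarySection ((deltaE U B s).dual.tensor L))
    (x : inter U s) {a b c} (ha : ‖a‖ = 1) (hb : ‖b‖ = 1) (hc : ‖c‖ = 1) :
    ‖coefE ψ x a b c‖ = 1 := by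
  have h : ‖vec₂ a b c‖ = 1 := by rw [norm_vec₂, ha, hb, hc]; norm_num
  exact (norm_inner_of_unit h _).trans (ψ.norm_eq x)

theorem coefE_smul {B : ∀ i, HermitianLineBundle E (U i)} {s : Fin 2 → ι}
    {L : HermitianLineBundle E (inter U s)} (ψ : UnitarySection ((deltaE U B s).dual.tensor L))
    (x : inter U s) (a b c) (r r' r'' : ℂ) :
    coefE ψ x (r • a) (r' • b) (r'' • c) = r * conj r' * conj r'' * coefE ψ x a b c :=
  inner_vec₂_smul a b c _ r r' r''

theorem coefL_eq {L : ∀ s : Fin 2 → ι, HermitianLineBundle E (inter U s)} {s : Fin 3 → ι}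
    (θ : UnitarySection (deltaL U L s)) (x : inter U s) (a b c a' b' c') (ha : ‖a‖ = 1)
    (hb : ‖b‖ = 1) (hc : ‖c‖ = 1) : coefL θ x a' b' c' =
      inner ℂ a' a * inner ℂ b b' * inner ℂ c' c * coefL θ x a b c :=
  inner_vec₃_eq a b c a' b' c' _ ha hb hc

theorem coefE_eq {B : ∀ i, HermitianLineBundle E (U i)} {s : Fin 2 → ι}
    {L : HermitianLineBundle E (inter U s)} (ψ : UnitarySection ((deltaE U B s).dual.tensor L))
    (x : inter U s) (a b c a' b' c') (ha : ‖a‖ = 1) (hb : ‖b‖ = 1) (hc : ‖c‖ = 1) :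
    coefE ψ x a' b' c' = inner ℂ a a' * inner ℂ b' b * inner ℂ c' c * coefE ψ x a b c :=
  inner_vec₂_eq a b c a' b' c' _ ha hb hc

end Sections

/-! ### The exponential `exp(2πi a)` and local logarithms. -/

section Logarithm

variable {E : Type*} [NormedAddCommGroup E] [NormedSpace ℝ E]
  {X : Type u} [TopologicalSpace X] [ChartedSpace E X]

/-- The function `exp(2πi a)`. -/
def expc (a : ℝ) : ℂ := Complex.exp (2 * Real.pi * Complex.I * a)

theorem expc_add (a b : ℝ) : expc (a + b) = expc a * expc b := by
  rw [expc, expc, expc, ← Complex.exp_add]; push_cast; ring_nf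

theorem expc_neg (a : ℝ) : expc (-a) = (expc a)⁻¹ := by
  rw [expc, expc, ← Complex.exp_neg]; push_cast; ring_nf

theorem expc_zero : expc 0 = 1 := by simp [expc]

theorem expc_sub (a b : ℝ) : expc (a - b) = expc a * (expc b)⁻¹ := by
  rw [sub_eq_add_neg, expc_add, expc_neg]

theorem expc_ne_zero (a : ℝ) : expc a ≠ 0 := Complex.exp_ne_zero _

theorem norm_expc (a : ℝ) : ‖expc a‖ = 1 := by
  rw [expc, show (2 * Real.pi * Complex.I * a : ℂ) = ((2 * Real.pi * a : ℝ) : ℂ) * Complex.I by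
    push_cast; ring, Complex.norm_exp_ofReal_mul_I]

theorem conj_expc (a : ℝ) : conj (expc a) = (expc a)⁻¹ := by
  rw [Complex.inv_def, Complex.normSq_eq_norm_sq, norm_expc]; simp

theorem expc_intCast (n : ℤ) : expc n = 1 := by
  rw [expc, Complex.exp_eq_one_iff]
  exact ⟨n, by push_cast; ring⟩

theorem exists_int_of_expc_eq_one {a : ℝ} (h : expc a = 1) : ∃ n : ℤ, a = n := by
  obtain ⟨n, hn⟩ := Complex.exp_eq_one_iff.1 h
  refine ⟨n, ?_⟩
  have h2 : (2 * Real.pi * Complex.I : ℂ) ≠ 0 := Complex.two_pi_I_ne_zero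
  have : (a : ℂ) = n := mul_left_cancel₀ h2 (by rw [hn]; ring)
  exact_mod_cast this

theorem contMDiff_expc {a : X → ℝ} {x : X} (ha : ContMDiffAt 𝓘(ℝ, E) 𝓘(ℝ, ℝ) ∞ a x) :
    ContMDiffAt 𝓘(ℝ, E) 𝓘(ℝ, ℂ) ∞ (fun x => expc (a x)) x := by
  have h : ContDiff ℝ ∞ expc := by
    unfold expc
    exact (contDiff_const.mul Complex.ofRealCLM.contDiff).cexp
  exact h.contMDiff.contMDiffAt.comp x ha

theorem expc_arg {z : ℂ} (hz : ‖z‖ = 1) : expc (Complex.arg z / (2 * Real.pi)) = z := by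
  have h := Complex.norm_mul_exp_arg_mul_I z
  rw [hz, Complex.ofReal_one, one_mul] at h
  rw [expc, show (2 * Real.pi * Complex.I * (Complex.arg z / (2 * Real.pi) : ℝ) : ℂ) =
    Complex.arg z * Complex.I by
      have : (Real.pi : ℂ) ≠ 0 := by exact_mod_cast Real.pi_ne_zero
      push_cast; field_simp, h]

/-- Smooth `U(1)`-valued functions have local logarithms. -/
theorem exists_log_near {f : X → ℂ} (hf : ContMDiff 𝓘(ℝ, E) 𝓘(ℝ, ℂ) ∞ f) (hn : ∀ x, ‖f x‖ = 1)
    (x : X) : ∃ (O : Opens X) (a : X → ℝ), x ∈ O ∧ ∀ y ∈ O,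
      ContMDiffAt 𝓘(ℝ, E) 𝓘(ℝ, ℝ) ∞ a y ∧ expc (a y) = f y := by
  have hc : Continuous fun y => f y * (f x)⁻¹ := hf.continuous.mul continuous_const
  have hx0 : f x ≠ 0 := fun h => by simpa [h] using hn x
  -- Dividing by `f x` moves the value at `x` to `1`, away from the branch cut of the argument; the
  -- constant `arg (f x)` is added back afterwards.
  refine ⟨⟨(fun y => f y * (f x)⁻¹) ⁻¹' Complex.slitPlane, Complex.isOpen_slitPlane.preimage hc⟩,
    fun y => (Complex.arg (f y * (f x)⁻¹) / (2 * Real.pi) + Complex.arg (f x) / (2 * Real.pi)),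
    by change f x * (f x)⁻¹ ∈ Complex.slitPlane; rw [mul_inv_cancel₀ hx0]; exact Complex.one_mem_slitPlane,
    fun y hy => ⟨?_, ?_⟩⟩
  · have h1 : ContDiffAt ℝ ∞ (fun z : ℂ => Complex.arg (z * (f x)⁻¹) / (2 * Real.pi) +
        Complex.arg (f x) / (2 * Real.pi)) (f y) := by
      simp only [← Complex.log_im]
      refine ContDiffAt.add (ContDiffAt.div_const ?_ _) contDiffAt_const
      refine Complex.imCLM.contDiff.contDiffAt.comp (f y)
        (f := fun z : ℂ => Complex.log (z * (f x)⁻¹)) ?_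
      have h2 : ContDiffAt ℝ ∞ Complex.log (f y * (f x)⁻¹) :=
        (Complex.contDiffAt_log hy).restrict_scalars ℝ
      exact h2.comp (f y) (contDiffAt_id.mul contDiffAt_const)
    exact h1.contMDiffAt.comp y (hf y)
  · rw [expc_add, expc_arg (hn x), expc_arg (by rw [norm_mul, norm_inv, hn, hn]; norm_num),
      mul_assoc, inv_mul_cancel₀ hx0, mul_one]

end Logarithm

end RelativeGerbe

end

noncomputable section

namespace RelativeGerbe

open HermitianLine

/-! ### Local properties that a fine cover can be made to satisfy. -/

section LocalProp

variable {X : Type u} [TopologicalSpace X] {ι : Type u} {U : ι → Opens X} {n : ℕ}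

/-- A property of open sets, depending on `n` indices, which is inherited by open subsets and holds
locally on the intersections of `n` members of the family `U`. -/
structure LocalProp (U : ι → Opens X) {n : ℕ} (P : (Fin n → ι) → Opens X → Prop) : Prop where
  bot : ∀ s, P s ⊥
  mono : ∀ s O O', O ≤ O' → P s O' → P s O
  loc : ∀ s, ∀ y ∈ inter U s, ∃ O : Opens X, y ∈ O ∧ P s O

theorem LocalProp.and {P Q : (Fin n → ι) → Opens X → Prop} (hP : LocalProp U P)
    (hQ : LocalProp U Q) : LocalProp U fun s O => P s O ∧ Q s O where
  bot s := ⟨hP.bot s, hQ.bot s⟩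
  mono s O O' h h' := ⟨hP.mono s O O' h h'.1, hQ.mono s O O' h h'.2⟩
  loc s y hy := by
    obtain ⟨O, hO, h⟩ := hP.loc s y hy
    obtain ⟨O', hO', h'⟩ := hQ.loc s y hy
    exact ⟨O ⊓ O', ⟨hO, hO'⟩, hP.mono _ _ _ inf_le_left h, hQ.mono _ _ _ inf_le_right h'⟩

theorem LocalProp.comp {P : (Fin n → ι) → Opens X → Prop} (hP : LocalProp U P) {k : ℕ}
    (τ : Fin n → Fin k) : LocalProp U fun s O => P (s ∘ τ) O where
  bot s := hP.bot _
  mono s := hP.mono _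
  loc s y hy := hP.loc _ y fun k => hy (τ k)

theorem LocalProp.true : LocalProp U fun (_ : Fin n → ι) _ => True where
  bot _ := trivial
  mono _ _ _ _ _ := trivial
  loc _ _ _ := ⟨⊤, trivial, trivial⟩

/-- The refinement theorem speaks of triples only. A property of fewer indices is read off from the
triple obtained by repeating indices along `ρ`, whose intersection contains the given one. -/
theorem LocalProp.of_comp {ι' : Type u} {U' : ι' → Opens X} {P : (Fin n → ι) → Opens X → Prop}
    (hP : LocalProp U P) {f : ι' → ι} (τ : Fin n → Fin 3) (ρ : Fin 3 → Fin n) (h : ρ ∘ τ = id)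
    (H : ∀ s : Fin 3 → ι', P ((f ∘ s) ∘ τ) (inter U' s)) (s : Fin n → ι') :
    P (f ∘ s) (inter U' s) := by
  have h1 := H (s ∘ ρ)
  rw [show (f ∘ s ∘ ρ) ∘ τ = f ∘ s ∘ (ρ ∘ τ) from rfl, h] at h1
  exact hP.mono _ _ (inter U' (s ∘ ρ)) (fun x hx k => hx (ρ k)) h1

variable {E : Type*} [NormedAddCommGroup E] [NormedSpace ℝ E] [ChartedSpace E X]

/-- Local frames provide the sections. The set `W s` is where the bundle lives: the whole
intersection for the bundles `L_{jj'}`, a single member of the cover for the bundles `E_i`. The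
section is total on `W s`, but constrained only over `O`. -/
theorem localProp_section {W : (Fin n → ι) → Opens X} (hW : ∀ s, ∀ x ∈ inter U s, x ∈ W s)
    (L : ∀ s, HermitianLineBundle E (W s)) :
    LocalProp U fun s O => ∃ σ : ∀ x, (L s).fiber x,
      ∀ x, x.1 ∈ O → ‖σ x‖ = 1 ∧ (L s).SmoothAt σ x where
  bot s := ⟨fun x => 0, fun x hx => False.elim hx⟩
  mono s O O' h := fun ⟨σ, hσ⟩ => ⟨σ, fun x hx => hσ x (h hx)⟩
  loc s y hy := by
    obtain ⟨O, v, hO, hv⟩ := (L s).exists_unitary_near ⟨y, hW s y hy⟩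
    refine ⟨⟨Subtype.val '' (O : Set (W s)), (W s).isOpen.isOpenMap_subtype_val _ O.isOpen⟩,
      ⟨_, hO, rfl⟩, v, ?_⟩
    rintro x ⟨x', hx', h⟩
    exact hv x (Subtype.ext h ▸ hx')

theorem localProp_log {W : (Fin n → ι) → Opens X} (hW : ∀ s, ∀ x ∈ inter U s, x ∈ W s)
    (f : ∀ s, W s → ℂ) (hf : ∀ s, ContMDiff 𝓘(ℝ, E) 𝓘(ℝ, ℂ) ∞ (f s)) (hn : ∀ s x, ‖f s x‖ = 1) :
    LocalProp U fun s O => ∃ a : W s → ℝ, ∀ x, x.1 ∈ O →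
      ContMDiffAt 𝓘(ℝ, E) 𝓘(ℝ, ℝ) ∞ a x ∧ expc (a x) = f s x where
  bot s := ⟨fun x => 0, fun x hx => False.elim hx⟩
  mono s O O' h := fun ⟨σ, hσ⟩ => ⟨σ, fun x hx => hσ x (h hx)⟩
  loc s y hy := by
    obtain ⟨O, v, hO, hv⟩ := exists_log_near (hf s) (hn s) ⟨y, hW s y hy⟩
    refine ⟨⟨Subtype.val '' (O : Set (W s)), (W s).isOpen.isOpenMap_subtype_val _ O.isOpen⟩,
      ⟨_, hO, rfl⟩, v, ?_⟩
    rintro x ⟨x', hx', h⟩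
    exact hv x (Subtype.ext h ▸ hx')

end LocalProp

/-! ### Refinements adapted to properties of one, two and three indices. -/

section Refine

variable {EM : Type*} [NormedAddCommGroup EM] [NormedSpace ℝ EM]
  {M : Type u} [TopologicalSpace M] [ChartedSpace EM M]
  {EN : Type*} [NormedAddCommGroup EN] [NormedSpace ℝ EN]
  {N : Type u} [TopologicalSpace N] [ChartedSpace EN N]
  {Φ : C^∞⟮𝓘(ℝ, EM), M; 𝓘(ℝ, EN), N⟯}
  [T2Space M] [LocallyCompactSpace M] [SecondCountableTopology M]
  [T2Space N] [LocallyCompactSpace N] [SecondCountableTopology N]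

theorem exists_refinement_double_of_localProp (c : RelCover Φ)
    {P₁ : (Fin 1 → c.double.J) → Opens N → Prop} (h₁ : LocalProp c.double.V P₁)
    {P₂ : (Fin 2 → c.double.J) → Opens N → Prop} (h₂ : LocalProp c.double.V P₂)
    {P₃ : (Fin 3 → c.double.J) → Opens N → Prop} (h₃ : LocalProp c.double.V P₃)
    {Q₁ : (Fin 1 → Σ j, c.double.K j) → Opens M → Prop} (k₁ : LocalProp c.double.U Q₁)
    {Q₂ : (Fin 2 → Σ j, c.double.K j) → Opens M → Prop} (k₂ : LocalProp c.double.U Q₂) :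
    ∃ (c' : RelCover Φ) (m : Refinement c' c),
      (∀ s, P₁ (m.mapDouble.f ∘ s) (inter c'.double.V s)) ∧
      (∀ s, P₂ (m.mapDouble.f ∘ s) (inter c'.double.V s)) ∧
      (∀ s, P₃ (m.mapDouble.f ∘ s) (inter c'.double.V s)) ∧
      (∀ s, Q₁ (m.mapDouble.idx ∘ s) (inter c'.double.U s)) ∧
      ∀ s, Q₂ (m.mapDouble.idx ∘ s) (inter c'.double.U s) := by
  have hP := ((h₁.comp ![(0 : Fin 3)]).and (h₂.comp ![(0 : Fin 3), 1])).and h₃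
  have hQ := (k₁.comp ![(0 : Fin 3)]).and (k₂.comp ![(0 : Fin 3), 1])
  obtain ⟨c', m, H, H'⟩ := exists_refinement_double c _ hP.bot hP.mono hP.loc _ hQ.bot hQ.mono
    hQ.loc
  have e1 : ![(0 : Fin 1), 0, 0] ∘ ![(0 : Fin 3)] = id := by funext i; fin_cases i; rfl
  have e2 : ![(0 : Fin 2), 1, 1] ∘ ![(0 : Fin 3), 1] = id := by funext i; fin_cases i <;> rfl
  exact ⟨c', m, h₁.of_comp _ _ e1 fun s => (H s).1.1, h₂.of_comp _ _ e2 fun s => (H s).1.2,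
    fun s => (H s).2, k₁.of_comp _ _ e1 fun s => (H' s).1, k₂.of_comp _ _ e2 fun s => (H' s).2⟩

theorem exists_refinement_of_localProp (c : RelCover Φ)
    {P₁ : (Fin 1 → c.J) → Opens N → Prop} (h₁ : LocalProp c.V P₁)
    {P₂ : (Fin 2 → c.J) → Opens N → Prop} (h₂ : LocalProp c.V P₂)
    {Q₁ : (Fin 1 → Σ j, c.K j) → Opens M → Prop} (k₁ : LocalProp c.U Q₁) :
    ∃ (c' : RelCover Φ) (m : Refinement c' c),
      (∀ s, P₁ (m.f ∘ s) (inter c'.V s)) ∧ (∀ s, P₂ (m.f ∘ s) (inter c'.V s)) ∧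
      ∀ s, Q₁ (m.idx ∘ s) (inter c'.U s) := by
  have hP := (h₁.comp ![(0 : Fin 3)]).and (h₂.comp ![(0 : Fin 3), 1])
  have hQ := k₁.comp ![(0 : Fin 3)]
  obtain ⟨c', m, H, H'⟩ := exists_refinement c _ hP.bot hP.mono hP.loc _ hQ.bot hQ.mono hQ.loc
  have e1 : ![(0 : Fin 1), 0, 0] ∘ ![(0 : Fin 3)] = id := by funext i; fin_cases i; rfl
  have e2 : ![(0 : Fin 2), 1, 1] ∘ ![(0 : Fin 3), 1] = id := by funext i; fin_cases i <;> rfl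
  exact ⟨c', m, h₁.of_comp _ _ e1 fun s => (H s).1, h₂.of_comp _ _ e2 fun s => (H s).2,
    k₁.of_comp _ _ e1 H'⟩

end Refine

/-! ### Integral, real and smooth cochains of the mapping cone. -/

section Frames

variable {EM : Type*} [NormedAddCommGroup EM] [NormedSpace ℝ EM]
  {M : Type u} [TopologicalSpace M] [ChartedSpace EM M]
  {EN : Type*} [NormedAddCommGroup EN] [NormedSpace ℝ EN]
  {N : Type u} [TopologicalSpace N] [ChartedSpace EN N]
  {Φ : C^∞⟮𝓘(ℝ, EM), M; 𝓘(ℝ, EN), N⟯} {c c' : RelCover Φ}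

/-- The inclusion of integral into real cochains. -/
def castReal (c : RelCover Φ) (p : ℕ) (z : RelCochain c ℤ p) : RelCochain c ℝ p :=
  (fun s x => (z.1 s x : ℝ), fun s x => (z.2 s x : ℝ))

theorem castReal_injective (c : RelCover Φ) (p : ℕ) : Function.Injective (castReal c p) :=
  fun z z' h => Prod.ext
    (funext fun s => funext fun x => Int.cast_injective (congrFun (congrFun (congrArg Prod.fst h) s) x))
    (funext fun s => funext fun x => Int.cast_injective (congrFun (congrFun (congrArg Prod.snd h) s) x))

theorem castReal_add (p : ℕ) (z z' : RelCochain c ℤ p) :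
    castReal c p (z + z') = castReal c p z + castReal c p z' :=
  Prod.ext (funext fun s => funext fun x => Int.cast_add _ _)
    (funext fun s => funext fun x => Int.cast_add _ _)

theorem castReal_sub (p : ℕ) (z z' : RelCochain c ℤ p) :
    castReal c p (z - z') = castReal c p z - castReal c p z' :=
  Prod.ext (funext fun s => funext fun x => Int.cast_sub _ _)
    (funext fun s => funext fun x => Int.cast_sub _ _)

theorem castReal_zero (p : ℕ) : castReal c p 0 = 0 :=
  Prod.ext (funext fun s => funext fun x => Int.cast_zero)
    (funext fun s => funext fun x => Int.cast_zero)

theorem cechD_intCast {X : Type u} [TopologicalSpace X] {ι : Type u} {U : ι → Opens X} {p : ℕ}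
    (f : Cochain U ℤ p) (s : Fin (p + 2) → ι) (x : inter U s) :
    cechD U ℝ p (fun s x => (f s x : ℝ)) s x = (cechD U ℤ p f s x : ℤ) := by
  change ∑ k : Fin (p + 2), (-1 : ℤ) ^ (k : ℕ) • ((f (s ∘ k.succAbove) (face U s k x) : ℤ) : ℝ) =
    ((∑ k : Fin (p + 2), (-1 : ℤ) ^ (k : ℕ) • f (s ∘ k.succAbove) (face U s k x) : ℤ) : ℝ)
  rw [Int.cast_sum]
  refine Finset.sum_congr rfl fun k _ => ?_
  rw [zsmul_eq_mul, smul_eq_mul, Int.cast_mul]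

theorem relD_castReal (p : ℕ) (z : RelCochain c ℤ p) :
    relD c ℝ p (castReal c p z) = castReal c (p + 1) (relD c ℤ p z) :=
  Prod.ext (funext fun s => funext fun x => (congrArg _ (cechD_intCast z.1 s x)).trans
    (Int.cast_sub _ _).symm) (funext fun s => funext fun x => cechD_intCast z.2 s x)

/-- Smoothness of relative cochains. -/
def SmoothRel {p : ℕ} (w : RelCochain c ℝ p) : Prop :=
  RelGerbe.SmoothCochain (E := EM) w.1 ∧ RelGerbe.SmoothCochain (E := EN) w.2

theorem SmoothRel.res {p : ℕ} {w : RelCochain c ℝ p} (hw : SmoothRel w) (m : Refinement c' c) :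
    SmoothRel (cochainRes m ℝ p w) :=
  ⟨fun s => (hw.1 (m.idx ∘ s)).comp
      (mapInter (E := EM) (F := EM) (V := c.U) ContMDiffMap.id m.idx m.U_le s).contMDiff,
    fun s => (hw.2 (m.f ∘ s)).comp
      (mapInter (E := EN) (F := EN) (V := c.V) ContMDiffMap.id m.f m.V_le s).contMDiff⟩

theorem SmoothRel.add {p : ℕ} {w w' : RelCochain c ℝ p} (hw : SmoothRel w) (hw' : SmoothRel w') :
    SmoothRel (w + w') := ⟨fun s => (hw.1 s).add (hw'.1 s), fun s => (hw.2 s).add (hw'.2 s)⟩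

theorem SmoothRel.sub {p : ℕ} {w w' : RelCochain c ℝ p} (hw : SmoothRel w) (hw' : SmoothRel w') :
    SmoothRel (w - w') := ⟨fun s => (hw.1 s).sub (hw'.1 s), fun s => (hw.2 s).sub (hw'.2 s)⟩

theorem smoothCochain_of_isLocallyConstant {E : Type*} [NormedAddCommGroup E] [NormedSpace ℝ E]
    {X : Type u} [TopologicalSpace X] [ChartedSpace E X] {ι : Type u} {U : ι → Opens X} {p : ℕ}
    {f : Cochain U ℤ p} (hf : f ∈ locConst U ℤ p) :
    RelGerbe.SmoothCochain (E := E) (U := U) (p := p) fun s x => (f s x : ℝ) := fun s x => by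
  have h := (hf s).eventually_eq x
  refine contMDiffAt_const (c := (f s x : ℝ)) |>.congr_of_eventuallyEq ?_
  filter_upwards [h] with y hy
  rw [hy]

theorem SmoothRel.castReal {p : ℕ} {z : RelCochain c ℤ p} (hz : z ∈ intCochains c p) :
    SmoothRel (castReal c p z) :=
  ⟨smoothCochain_of_isLocallyConstant hz.1, smoothCochain_of_isLocallyConstant hz.2⟩

/-- The componentwise exponential of a relative cochain is `1`. -/
def ExpOne {p : ℕ} (w : RelCochain c ℝ p) : Prop :=
  (∀ s x, expc (w.1 s x) = 1) ∧ ∀ s x, expc (w.2 s x) = 1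

/-- The inclusion of `ℤ` in `ℝ` is a closed embedding and `ℤ` is discrete. -/
theorem isLocallyConstant_of_cast {X : Type*} [TopologicalSpace X] {f : X → ℝ} (hf : Continuous f)
    {n : X → ℤ} (h : ∀ x, f x = n x) : IsLocallyConstant n := by
  rw [IsLocallyConstant.iff_continuous, Int.isClosedEmbedding_coe_real.continuous_iff]
  exact hf.congr h

/-- Exactness of the exponential sequence at the sheaf of smooth functions, on the level of
cochains. Integrality holds pointwise; continuity makes the integers locally constant. -/
theorem exists_castReal_eq {p : ℕ} {w : RelCochain c ℝ p} (hw : SmoothRel w) (h : ExpOne w) :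
    ∃ z ∈ intCochains c p, castReal c p z = w := by
  choose α hα using fun s x => exists_int_of_expc_eq_one (h.1 s x)
  choose β hβ using fun s x => exists_int_of_expc_eq_one (h.2 s x)
  exact ⟨(α, β), ⟨fun s => isLocallyConstant_of_cast (hw.1 s).continuous (hα s),
    fun s => isLocallyConstant_of_cast (hw.2 s).continuous (hβ s)⟩,
    Prod.ext (funext fun s => funext fun x => (hα s x).symm)
      (funext fun s => funext fun x => (hβ s x).symm)⟩

theorem smoothCochain_cechD {E : Type*} [NormedAddCommGroup E] [NormedSpace ℝ E]
    {X : Type u} [TopologicalSpace X] [ChartedSpace E X] {ι : Type u} {U : ι → Opens X} {p : ℕ}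
    {f : Cochain U ℝ p} (hf : RelGerbe.SmoothCochain (E := E) f) :
    RelGerbe.SmoothCochain (E := E) (cechD U ℝ p f) := fun s => by
  have h : ContMDiff 𝓘(ℝ, E) 𝓘(ℝ, ℝ) ∞ fun x => ∑ k : Fin (p + 2),
      ((-1 : ℝ) ^ (k : ℕ)) * f (s ∘ k.succAbove) (face U s k x) :=
    contMDiff_finsetSum fun k _ => contMDiff_const.mul
      ((hf (s ∘ k.succAbove)).comp (restr (E := E) U s k.succAbove).contMDiff)
  refine h.congr fun x => ?_
  change ∑ k : Fin (p + 2), (-1 : ℤ) ^ (k : ℕ) • f (s ∘ k.succAbove) (face U s k x) = _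
  refine Finset.sum_congr rfl fun k _ => ?_
  rw [zsmul_eq_mul]
  push_cast
  rfl

theorem SmoothRel.relD {p : ℕ} {w : RelCochain c ℝ p} (hw : SmoothRel w) :
    SmoothRel (relD c ℝ p w) :=
  ⟨fun s => (smoothCochain_pull c hw.2 s).sub (smoothCochain_cechD hw.1 s),
    smoothCochain_cechD hw.2⟩

theorem cechD_cechD_zero {X : Type u} [TopologicalSpace X] {ι : Type u} {U : ι → Opens X}
    {A : Type*} [AddCommGroup A] (f : Cochain U A 0) : cechD U A 1 (cechD U A 0 f) = 0 :=
  cochain_ext fun s x hx => by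
    rw [eta_vec₃ s, extend_cechD_one _ (hx 0) (hx 1) (hx 2), extend_cechD_zero _ (hx 1) (hx 2),
      extend_cechD_zero _ (hx 0) (hx 2), extend_cechD_zero _ (hx 0) (hx 1), extend_zero]
    abel

theorem relD_relD_zero (c : RelCover Φ) {A : Type*} [AddCommGroup A] (w : RelCochain c A 0) :
    relD c A 1 (relD c A 0 w) = 0 := by
  refine Prod.ext ?_ (cechD_cechD_one w.2)
  change c.pull A 2 (cechD c.V A 1 w.2) - cechD c.U A 1 (c.pull A 1 w.2 - cechD c.U A 0 w.1) = 0
  rw [map_sub, cechD_cechD_zero, sub_zero]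
  exact sub_self _

end Frames

end RelativeGerbe

end

/-! ### Frames of a relative gerbe and their Dixmier–Douady cocycles. -/

noncomputable section

namespace RelativeGerbe

open HermitianLine

/-- `(f ∘ g)^* L ≅ g^* f^* L`. -/
def BundleIso.pullbackComp {E₁ E₂ E₃ : Type*} [NormedAddCommGroup E₁] [NormedSpace ℝ E₁]
    [NormedAddCommGroup E₂] [NormedSpace ℝ E₂] [NormedAddCommGroup E₃] [NormedSpace ℝ E₃]
    {X Y Z : Type u} [TopologicalSpace X] [ChartedSpace E₁ X] [TopologicalSpace Y]
    [ChartedSpace E₂ Y] [TopologicalSpace Z] [ChartedSpace E₃ Z] (L : HermitianLineBundle E₃ Z)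
    (f : C^∞⟮𝓘(ℝ, E₂), Y; 𝓘(ℝ, E₃), Z⟯) (g : C^∞⟮𝓘(ℝ, E₁), X; 𝓘(ℝ, E₂), Y⟯) :
    BundleIso (L.pullback (f.comp g)) ((L.pullback f).pullback g) where
  map x := LinearIsometryEquiv.refl ℂ _
  smooth := by
    rintro _ ⟨a, ha, rfl⟩ _ ⟨_, ⟨a', ha', rfl⟩, rfl⟩
    exact ((L.smooth_transition a' ha' a ha).comp (f.comp g).contMDiff.contMDiffOn
      fun x hx => hx).mono fun x hx => ⟨hx.2, hx.1⟩

section Coboundary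

variable {X : Type u} [TopologicalSpace X] {ι : Type u} {U : ι → Opens X}

theorem expc_cechD_two (b : Cochain U ℝ 2) (v : Fin 4 → ι) (x : inter U v) :
    expc (cechD U ℝ 2 b v x) =
      expc (b (v ∘ Fin.succAbove 0) (face U v 0 x)) *
        (expc (b (v ∘ Fin.succAbove 1) (face U v 1 x)))⁻¹ *
        expc (b (v ∘ Fin.succAbove 2) (face U v 2 x)) *
        (expc (b (v ∘ Fin.succAbove 3) (face U v 3 x)))⁻¹ := by
  have h : cechD U ℝ 2 b v x = b (v ∘ Fin.succAbove 0) (face U v 0 x) -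
      b (v ∘ Fin.succAbove 1) (face U v 1 x) + b (v ∘ Fin.succAbove 2) (face U v 2 x) -
      b (v ∘ Fin.succAbove 3) (face U v 3 x) := by
    change ∑ k : Fin 4, (-1 : ℤ) ^ (k : ℕ) • b (v ∘ k.succAbove) (face U v k x) = _
    simp only [Fin.sum_univ_succ, Fin.sum_univ_zero]
    norm_num [pow_succ]
    try ring_nf
    rfl
  rw [h, expc_sub, expc_add, expc_sub]

theorem expc_cechD_one (b : Cochain U ℝ 1) (v : Fin 3 → ι) (x : inter U v) :
    expc (cechD U ℝ 1 b v x) =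
      expc (b (v ∘ Fin.succAbove 0) (face U v 0 x)) *
        (expc (b (v ∘ Fin.succAbove 1) (face U v 1 x)))⁻¹ *
        expc (b (v ∘ Fin.succAbove 2) (face U v 2 x)) := by
  have h : cechD U ℝ 1 b v x = b (v ∘ Fin.succAbove 0) (face U v 0 x) -
      b (v ∘ Fin.succAbove 1) (face U v 1 x) + b (v ∘ Fin.succAbove 2) (face U v 2 x) := by
    change ∑ k : Fin 3, (-1 : ℤ) ^ (k : ℕ) • b (v ∘ k.succAbove) (face U v k x) = _
    simp only [Fin.sum_univ_succ, Fin.sum_univ_zero]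
    norm_num [pow_succ]
    try ring_nf
    rfl
  rw [h, expc_add, expc_sub]

theorem expc_cechD_zero (b : Cochain U ℝ 0) (v : Fin 2 → ι) (x : inter U v) :
    expc (cechD U ℝ 0 b v x) =
      expc (b (v ∘ Fin.succAbove 0) (face U v 0 x)) *
        (expc (b (v ∘ Fin.succAbove 1) (face U v 1 x)))⁻¹ := by
  have h : cechD U ℝ 0 b v x = b (v ∘ Fin.succAbove 0) (face U v 0 x) -
      b (v ∘ Fin.succAbove 1) (face U v 1 x) := by
    change ∑ k : Fin 2, (-1 : ℤ) ^ (k : ℕ) • b (v ∘ k.succAbove) (face U v k x) = _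
    simp only [Fin.sum_univ_succ, Fin.sum_univ_zero]
    norm_num [pow_succ]
    try ring_nf
    rfl
  rw [h, expc_sub]

end Coboundary

section Frames

variable {EM : Type*} [NormedAddCommGroup EM] [NormedSpace ℝ EM]
  {M : Type u} [TopologicalSpace M] [ChartedSpace EM M]
  {EN : Type*} [NormedAddCommGroup EN] [NormedSpace ℝ EN]
  {N : Type u} [TopologicalSpace N] [ChartedSpace EN N]
  {Φ : C^∞⟮𝓘(ℝ, EM), M; 𝓘(ℝ, EN), N⟯} {c c' : RelCover Φ}

namespace RelGerbe

/-- Unitary sections `σ` of the bundles `L_{jj'}` and `λ` of the bundles `E_i` of a relative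
gerbe. -/
structure Frame (G : RelGerbe c) where
  σ : ∀ s, UnitarySection (G.gerbe.L s)
  lam : ∀ i, UnitarySection (G.quasi.B i)

namespace Frame

variable {G G' : RelGerbe c}

/-- The cochain `t = (δσ) θ⁻¹`. -/
def t (F : Frame G) (v : Fin 3 → c.J) (x : inter c.V v) : ℂ :=
  (coefL (G.gerbe.θ v) x ((F.σ _).val _) ((F.σ _).val _) ((F.σ _).val _))⁻¹

/-- The cochain `s = ψ⁻¹ ((δλ)⁻¹ ⊗ Φ^* σ)`. -/
def s (F : Frame G) (v : Fin 2 → Σ j, c.K j) (x : inter c.U v) : ℂ :=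
  (coefE (G.quasi.ψ v) x ((F.lam (v 1)).val _) ((F.lam (v 0)).val _)
    ((F.σ (Sigma.fst ∘ v)).val (mapInter Φ Sigma.fst c.map_mem v x)))⁻¹

/-- The smooth real cochain `w = (a, b)` is a logarithm of `(s, t)`. -/
def IsLog (F : Frame G) (w : RelCochain c ℝ 1) : Prop :=
  SmoothRel w ∧ (∀ v x, expc (w.2 v x) = F.t v x) ∧ ∀ v x, expc (w.1 v x) = F.s v x

theorem norm_t (F : Frame G) (v x) : ‖F.t v x‖ = 1 := by
  rw [t, norm_inv, norm_coefL _ _ ((F.σ _).norm_eq _) ((F.σ _).norm_eq _) ((F.σ _).norm_eq _),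
    inv_one]

theorem norm_s (F : Frame G) (v x) : ‖F.s v x‖ = 1 :=
  (norm_inv _).trans (inv_eq_one.2 (norm_coefE _ _ ((F.lam _).norm_eq _) ((F.lam _).norm_eq _)
    ((F.σ _).norm_eq _)))

/-- On the unit circle inversion is complex conjugation, which is smooth. -/
theorem smoothAt_inv_of_norm {E : Type*} [NormedAddCommGroup E] [NormedSpace ℝ E]
    {X : Type u} [TopologicalSpace X] [ChartedSpace E X] {f : X → ℂ} {x : X}
    (hf : ContMDiffAt 𝓘(ℝ, E) 𝓘(ℝ, ℂ) ∞ f x) (hn : ∀ x, ‖f x‖ = 1) :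
    ContMDiffAt 𝓘(ℝ, E) 𝓘(ℝ, ℂ) ∞ (fun x => (f x)⁻¹) x :=
  (smoothAt_conj hf).congr_of_eventuallyEq (Filter.Eventually.of_forall fun y => by
    change (f y)⁻¹ = conj (f y)
    rw [Complex.inv_def, Complex.normSq_eq_norm_sq, hn]; simp)

theorem contMDiff_t (F : Frame G) (v) : ContMDiff 𝓘(ℝ, EN) 𝓘(ℝ, ℂ) ∞ (F.t v) := fun x =>
  smoothAt_inv_of_norm (smoothAt_coefL (G.gerbe.θ v) ((F.σ _).smoothAt _) ((F.σ _).smoothAt _)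
    ((F.σ _).smoothAt _)) fun x =>
      norm_coefL _ _ ((F.σ _).norm_eq _) ((F.σ _).norm_eq _) ((F.σ _).norm_eq _)

theorem contMDiff_s (F : Frame G) (v) : ContMDiff 𝓘(ℝ, EM) 𝓘(ℝ, ℂ) ∞ (F.s v) := fun x =>
  smoothAt_inv_of_norm (smoothAt_coefE (G.quasi.ψ v)
    (c := fun x => (F.σ (Sigma.fst ∘ v)).val (mapInter Φ Sigma.fst c.map_mem v x))
    ((F.lam _).smoothAt _) ((F.lam _).smoothAt _)
    (((F.σ (Sigma.fst ∘ v)).smoothAt _).pullback (mapInter Φ Sigma.fst c.map_mem v))) fun x =>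
      norm_coefE _ _ ((F.lam _).norm_eq _) ((F.lam _).norm_eq _) ((F.σ _).norm_eq _)

/-- The cochain `(s, t)` is a cocycle. -/
theorem IsLog.expOne {F : Frame G} {w : RelCochain c ℝ 1} (h : F.IsLog w) :
    ExpOne (relD c ℝ 1 w) := by
  obtain ⟨-, ht, hs⟩ := h
  refine ⟨fun v x => ?_, fun v x => ?_⟩
  · change expc (w.2 (Sigma.fst ∘ v) (mapInter Φ Sigma.fst c.map_mem v x) -
      cechD c.U ℝ 1 w.1 v x) = 1
    -- The condition `δψ = θ`, tested on the vectors of the frame, reads `δs = Φ^* t`.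
    have key := G.quasi.delta_eq v x (fun a => (F.lam (v a)).val _)
      (fun k => (F.σ (Sigma.fst ∘ v ∘ k)).val (mapInter Φ Sigma.fst c.map_mem (v ∘ k)
        (restr (E := EM) c.U v k x))) (fun a => (F.lam _).norm_eq _) (fun k => (F.σ _).norm_eq _)
    have key' : (F.s (v ∘ Fin.succAbove 0) (face c.U v 0 x))⁻¹ *
        (F.s (v ∘ Fin.succAbove 1) (face c.U v 1 x))⁻¹⁻¹ *
        (F.s (v ∘ Fin.succAbove 2) (face c.U v 2 x))⁻¹ =
        (F.t (Sigma.fst ∘ v) (mapInter Φ Sigma.fst c.map_mem v x))⁻¹ := by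
      simp only [s, t, inv_inv]
      exact key
    rw [expc_sub, expc_cechD_one, ht, hs, hs, hs, ← inv_inj, mul_inv, ← key', inv_inv]
    have n0 : F.s (v ∘ Fin.succAbove 0) (face c.U v 0 x) ≠ 0 := by rw [← hs]; exact expc_ne_zero _
    have n1 : F.s (v ∘ Fin.succAbove 1) (face c.U v 1 x) ≠ 0 := by rw [← hs]; exact expc_ne_zero _
    have n2 : F.s (v ∘ Fin.succAbove 2) (face c.U v 2 x) ≠ 0 := by rw [← hs]; exact expc_ne_zero _
    field_simp
  · change expc (cechD c.V ℝ 2 w.2 v x) = 1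
    -- The condition `δθ = 1`, tested on the vectors of the frame, reads `δt = 1`.
    have key := G.gerbe.cocycle v x (fun k => (F.σ (v ∘ k)).val _) (fun k => (F.σ _).norm_eq _)
    have key' : (F.t (v ∘ Fin.succAbove 0) (face c.V v 0 x))⁻¹ *
        (F.t (v ∘ Fin.succAbove 1) (face c.V v 1 x))⁻¹⁻¹ *
        (F.t (v ∘ Fin.succAbove 2) (face c.V v 2 x))⁻¹ *
        (F.t (v ∘ Fin.succAbove 3) (face c.V v 3 x))⁻¹⁻¹ = 1 := by
      simp only [t, inv_inv]
      exact key
    rw [expc_cechD_two, ht, ht, ht, ht, ← inv_inj, inv_one, ← key']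
    simp only [mul_inv, inv_inv]

/-- The cochain `d(a, b)` has exponential `1`, so it is integral. It is closed because `d d = 0`
over `ℝ` and integral cochains embed in real ones. -/
theorem IsLog.exists_cocycle {F : Frame G} {w : RelCochain c ℝ 1} (h : F.IsLog w) :
    ∃ z : intCocycles c 2, relD c ℝ 1 w = castReal c 2 z.1 := by
  obtain ⟨z, hz, hzw⟩ := exists_castReal_eq h.1.relD h.expOne
  refine ⟨⟨z, hz, ?_⟩, hzw.symm⟩
  refine castReal_injective c 3 ?_
  rw [← relD_castReal, hzw, relD_relD_one, castReal_zero]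

theorem isDDCocycle_iff {z : intCocycles c 2} : G.IsDDCocycle z ↔
    ∃ (F : Frame G) (w : RelCochain c ℝ 1), F.IsLog w ∧ relD c ℝ 1 w = castReal c 2 z.1 :=
  ⟨fun ⟨σ, lam, a, b, ha, hb, ht, hs, h⟩ => ⟨⟨σ, lam⟩, (a, b), ⟨⟨ha, hb⟩, ht, hs⟩, h⟩,
    fun ⟨F, w, ⟨⟨ha, hb⟩, ht, hs⟩, h⟩ => ⟨F.σ, F.lam, w.1, w.2, ha, hb, ht, hs, h⟩⟩

/-- The image of a frame under an isomorphism. -/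
def map (F : Frame G) (i : Iso G G') : Frame G' where
  σ v := .ofSmoothAt (fun x => (i.φ v).map x ((F.σ v).val x)) fun x =>
    ⟨by rw [LinearIsometryEquiv.norm_map, (F.σ v).norm_eq],
      (i.φ v).smoothAt_map ((F.σ v).smoothAt x)⟩
  lam j := .ofSmoothAt (fun x => (i.ε j).map x ((F.lam j).val x)) fun x =>
    ⟨by rw [LinearIsometryEquiv.norm_map, (F.lam j).norm_eq],
      (i.ε j).smoothAt_map ((F.lam j).smoothAt x)⟩

/-- The preimage of a frame under an isomorphism. -/
def comap (F : Frame G') (i : Iso G G') : Frame G where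
  σ v := .ofSmoothAt (fun x => ((i.φ v).map x).symm ((F.σ v).val x)) fun x =>
    ⟨by rw [LinearIsometryEquiv.norm_map, (F.σ v).norm_eq],
      (i.φ v).smoothAt_symm ((F.σ v).smoothAt x)⟩
  lam j := .ofSmoothAt (fun x => ((i.ε j).map x).symm ((F.lam j).val x)) fun x =>
    ⟨by rw [LinearIsometryEquiv.norm_map, (F.lam j).norm_eq],
      (i.ε j).smoothAt_symm ((F.lam j).smoothAt x)⟩

theorem t_map (F : Frame G) (i : Iso G G') (v x) : (F.map i).t v x = F.t v x :=
  congrArg (·⁻¹) (i.coefL_eq v x _ _ _)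

theorem s_map (F : Frame G) (i : Iso G G') (v x) : (F.map i).s v x = F.s v x :=
  congrArg (·⁻¹) (i.coefE_eq v x _ _ _)

theorem map_comap (F : Frame G') (i : Iso G G') : (F.comap i).map i = F := by
  obtain ⟨σ, lam⟩ := F
  unfold comap map UnitarySection.ofSmoothAt
  congr
  · funext v
    rcases h : σ v with ⟨val, _, _⟩
    congr
    funext x
    simp [h]
  · funext v
    rcases h : lam v with ⟨val, _, _⟩
    congr
    funext x
    simp [h]

/-- An isomorphism carries frames to frames in both directions and preserves all coefficients, hence
also the pairs `(s, t)`, and the same logarithms serve. This lets the notion descend to isomorphism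
classes. -/
theorem isDDCocycle_congr (i : Iso G G') (z : intCocycles c 2) :
    G.IsDDCocycle z ↔ G'.IsDDCocycle z := by
  rw [isDDCocycle_iff, isDDCocycle_iff]
  refine ⟨fun ⟨F, w, ⟨hw, ht, hs⟩, h⟩ => ⟨F.map i, w, ⟨hw, ?_, ?_⟩, h⟩,
    fun ⟨F, w, ⟨hw, ht, hs⟩, h⟩ => ⟨F.comap i, w, ⟨hw, ?_, ?_⟩, h⟩⟩
  · exact fun v x => (ht v x).trans (F.t_map i v x).symm
  · exact fun v x => (hs v x).trans (F.s_map i v x).symm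
  · refine fun v x => (ht v x).trans ?_
    rw [← (F.comap i).t_map i, map_comap]
  · refine fun v x => (hs v x).trans ?_
    rw [← (F.comap i).s_map i, map_comap]

/-- The tensor product of frames. -/
def tensor (F : Frame G) (F' : Frame G') : Frame (G.tensor G') where
  σ v := .ofSmoothAt (L := (G.gerbe.L v).tensor (G'.gerbe.L v))
    (fun x => tmul ((F.σ v).val x) ((F'.σ v).val x)) fun x =>
    ⟨(norm_tmul _ _).trans (by rw [(F.σ v).norm_eq, (F'.σ v).norm_eq, one_mul]),
      ((F.σ v).smoothAt x).tmul ((F'.σ v).smoothAt x)⟩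
  lam j := .ofSmoothAt (L := (G.quasi.B j).tensor (G'.quasi.B j))
    (fun x => tmul ((F.lam j).val x) ((F'.lam j).val x)) fun x =>
    ⟨(norm_tmul _ _).trans (by rw [(F.lam j).norm_eq, (F'.lam j).norm_eq, one_mul]),
      ((F.lam j).smoothAt x).tmul ((F'.lam j).smoothAt x)⟩

theorem t_tensor (F : Frame G) (F' : Frame G') (v x) :
    (F.tensor F').t v x = F.t v x * F'.t v x :=
  (congrArg (·⁻¹) (coefL_tensor G G' v x _ _ _ _ _ _)).trans (mul_inv _ _)

theorem s_tensor (F : Frame G) (F' : Frame G') (v x) :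
    (F.tensor F').s v x = F.s v x * F'.s v x :=
  (congrArg (·⁻¹) (coefE_tensor G G' v x _ _ _ _ _ _)).trans (mul_inv _ _)

theorem IsLog.tensor {F : Frame G} {F' : Frame G'} {w w' : RelCochain c ℝ 1} (h : F.IsLog w)
    (h' : F'.IsLog w') : (F.tensor F').IsLog (w + w') :=
  ⟨h.1.add h'.1, fun v x => (expc_add _ _).trans (by rw [h.2.1, h'.2.1, t_tensor]),
    fun v x => (expc_add _ _).trans (by rw [h.2.2, h'.2.2, s_tensor])⟩

/-- The restriction of a frame to a refinement. -/
def restrict (F : Frame G) (m : Refinement c' c) : Frame (G.restrict m) where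
  σ v := .ofSmoothAt (L := (G.gerbe.L (m.f ∘ v)).pullback
      (mapInter (E := EN) (F := EN) (V := c.V) ContMDiffMap.id m.f m.V_le v))
    (fun x => (F.σ (m.f ∘ v)).val _)
    fun x => ⟨(F.σ (m.f ∘ v)).norm_eq _, ((F.σ (m.f ∘ v)).smoothAt _).pullback _⟩
  lam j := .ofSmoothAt (L := restrictB m G.quasi.B j) (fun x => (F.lam (m.idx j)).val _)
    fun x => ⟨(F.lam (m.idx j)).norm_eq _, ((F.lam (m.idx j)).smoothAt _).pullback _⟩

theorem IsLog.restrict {F : Frame G} {w : RelCochain c ℝ 1} (h : F.IsLog w)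
    (m : Refinement c' c) : (F.restrict m).IsLog (cochainRes m ℝ 1 w) :=
  ⟨h.1.res m, fun v x => h.2.1 (m.f ∘ v)
      (mapInter (E := EN) (F := EN) (V := c.V) ContMDiffMap.id m.f m.V_le v x),
    fun v x => h.2.2 (m.idx ∘ v)
      (mapInter (E := EM) (F := EM) (V := c.U) ContMDiffMap.id m.idx m.U_le v x)⟩

end Frame

theorem IsDDCocycle.restrict {G : RelGerbe c} {z : intCocycles c 2} (h : G.IsDDCocycle z)
    (m : Refinement c' c) : (G.restrict m).IsDDCocycle (cocycleRes m 2 z) := by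
  rw [Frame.isDDCocycle_iff] at h ⊢
  obtain ⟨F, w, hw, hz⟩ := h
  refine ⟨F.restrict m, _, hw.restrict m, ?_⟩
  rw [← cochainRes_relD, hz]
  rfl

theorem IsDDCocycle.tensor {G G' : RelGerbe c} {z z' : intCocycles c 2} (h : G.IsDDCocycle z)
    (h' : G'.IsDDCocycle z') : (G.tensor G').IsDDCocycle (z + z') := by
  rw [Frame.isDDCocycle_iff] at h h' ⊢
  obtain ⟨F, w, hw, hz⟩ := h
  obtain ⟨F', w', hw', hz'⟩ := h'
  refine ⟨F.tensor F', _, hw.tensor hw', ?_⟩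
  rw [map_add, hz, hz', ← castReal_add]
  rfl

theorem coefL_restrict (G : RelGerbe c) (m : Refinement c' c) (s : Fin 3 → c'.J)
    (x : inter c'.V s) (a b d) : coefL ((G.restrict m).gerbe.θ s) x a b d =
      coefL (G.gerbe.θ (m.f ∘ s)) (mapInter (E := EN) (F := EN) (V := c.V) ContMDiffMap.id m.f
        m.V_le s x) a b d := rfl

theorem coefE_restrict (G : RelGerbe c) (m : Refinement c' c) (s : Fin 2 → Σ j, c'.K j)
    (x : inter c'.U s) (a b)
    (d : ((G.restrict m).gerbe.L (Sigma.fst ∘ s)).fiber (mapInter Φ Sigma.fst c'.map_mem s x)) :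
    coefE ((G.restrict m).quasi.ψ s) x a b d =
      coefE (G.quasi.ψ (m.idx ∘ s)) (mapInter (E := EM) (F := EM) (V := c.U) ContMDiffMap.id m.idx
        m.U_le s x) a b d := rfl

/-- Restriction along a composite of refinements. -/
def Iso.restrictComp {c'' : RelCover Φ} (G : RelGerbe c) (m : Refinement c' c)
    (n : Refinement c'' c') : Iso (G.restrict (m.comp n)) ((G.restrict m).restrict n) where
  φ s := BundleIso.pullbackComp (G.gerbe.L (m.f ∘ n.f ∘ s))
    (mapInter (E := EN) (F := EN) (V := c.V) ContMDiffMap.id m.f m.V_le (n.f ∘ s))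
    (mapInter (E := EN) (F := EN) (V := c'.V) ContMDiffMap.id n.f n.V_le s)
  ε i := BundleIso.pullbackComp (G.quasi.B (m.idx (n.idx i)))
    (restrictOpens (E := EM) (F := EM) ContMDiffMap.id _ _ (m.U_le (n.idx i)))
    (restrictOpens (E := EM) (F := EM) ContMDiffMap.id _ _ (n.U_le i))
  coefL_eq s x a b d := by
    let x' : inter c'.V (n.f ∘ s) :=
      mapInter (E := EN) (F := EN) (V := c'.V) ContMDiffMap.id n.f n.V_le s x
    let x'' : inter c.V (m.f ∘ n.f ∘ s) :=
      mapInter (E := EN) (F := EN) (V := c.V) ContMDiffMap.id m.f m.V_le (n.f ∘ s) x'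
    let a' : (G.gerbe.L ((m.f ∘ n.f ∘ s) ∘ Fin.succAbove 0)).fiber
      (restr (E := EN) c.V (m.f ∘ n.f ∘ s) (Fin.succAbove 0) x'') := a
    let b' : (G.gerbe.L ((m.f ∘ n.f ∘ s) ∘ Fin.succAbove 1)).fiber
      (restr (E := EN) c.V (m.f ∘ n.f ∘ s) (Fin.succAbove 1) x'') := b
    let d' : (G.gerbe.L ((m.f ∘ n.f ∘ s) ∘ Fin.succAbove 2)).fiber
      (restr (E := EN) c.V (m.f ∘ n.f ∘ s) (Fin.succAbove 2) x'') := d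
    have h2 := coefL_restrict G m (n.f ∘ s) x' a' b' d'
    have h1 := coefL_restrict (G.restrict m) n s x a' b' d'
    have h3 := coefL_restrict G (m.comp n) s x a' b' d'
    exact (h1.trans h2).trans h3.symm
  coefE_eq s x a b d := by
    let x' : inter c'.U (n.idx ∘ s) :=
      mapInter (E := EM) (F := EM) (V := c'.U) ContMDiffMap.id n.idx n.U_le s x
    let x'' : inter c.U (m.idx ∘ n.idx ∘ s) :=
      mapInter (E := EM) (F := EM) (V := c.U) ContMDiffMap.id m.idx m.U_le (n.idx ∘ s) x'
    let a' : (G.quasi.B ((m.idx ∘ n.idx ∘ s) 1)).fiber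
      (restrVertex (E := EM) c.U (m.idx ∘ n.idx ∘ s) 1 x'') := a
    let b' : (G.quasi.B ((m.idx ∘ n.idx ∘ s) 0)).fiber
      (restrVertex (E := EM) c.U (m.idx ∘ n.idx ∘ s) 0 x'') := b
    let d' : (G.gerbe.L (Sigma.fst ∘ m.idx ∘ n.idx ∘ s)).fiber
      (mapInter Φ Sigma.fst c.map_mem (m.idx ∘ n.idx ∘ s) x'') := d
    have h2 := coefE_restrict G m (n.idx ∘ s) x' a' b' d'
    have h1 := coefE_restrict (G.restrict m) n s x a' b' d'
    have h3 := coefE_restrict G (m.comp n) s x a' b' d'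
    exact (h1.trans h2).trans h3.symm

end RelGerbe

namespace GerOn

theorem restrict_comp {c'' : RelCover Φ} (m : Refinement c' c) (n : Refinement c'' c')
    (x : GerOn c) : restrict (m.comp n) x = restrict n (restrict m x) := by
  induction x using Quot.ind with | mk G
  exact sound (RelGerbe.Iso.restrictComp G m n)

/-- The cocycle `z` is a Dixmier–Douady cocycle of an isomorphism class of relative gerbes. -/
def IsDD (x : GerOn c) (z : intCocycles c 2) : Prop :=
  Quot.lift (fun G : RelGerbe c => G.IsDDCocycle z)
    (fun _ _ ⟨i⟩ => propext (RelGerbe.Frame.isDDCocycle_congr i z)) x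

theorem IsDD.restrict {x : GerOn c} {z : intCocycles c 2} (h : x.IsDD z) (m : Refinement c' c) :
    (restrict m x).IsDD (cocycleRes m 2 z) := by
  induction x using Quot.ind with | mk G
  exact RelGerbe.IsDDCocycle.restrict h m

theorem IsDD.add {x y : GerOn c} {z z' : intCocycles c 2} (h : x.IsDD z) (h' : y.IsDD z') :
    (x + y).IsDD (z + z') := by
  induction x using Quot.ind with | mk G
  induction y using Quot.ind with | mk G'
  exact RelGerbe.IsDDCocycle.tensor h h'

end GerOn

end Frames

end RelativeGerbe

end

noncomputable section

namespace RelativeGerbe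

open HermitianLine

/-! ### Independence of the Dixmier–Douady class of frame and logarithm. -/

section Comparison

variable {EM : Type*} [NormedAddCommGroup EM] [NormedSpace ℝ EM]
  {M : Type u} [TopologicalSpace M] [ChartedSpace EM M]
  {EN : Type*} [NormedAddCommGroup EN] [NormedSpace ℝ EN]
  {N : Type u} [TopologicalSpace N] [ChartedSpace EN N]
  {Φ : C^∞⟮𝓘(ℝ, EM), M; 𝓘(ℝ, EN), N⟯} {c c' : RelCover Φ}

namespace RelGerbe

namespace Frame

variable {G : RelGerbe c}

/-- The frame `F'` is the product of the frame `F` with `exp(2πi g)`. -/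
def IsRatio (F F' : Frame G) (g : RelCochain c ℝ 0) : Prop :=
  (∀ s x, inner ℂ ((F.σ s).val x) ((F'.σ s).val x) = expc (g.2 s x)) ∧
  ∀ (s : Fin 1 → Σ j, c.K j) (x : inter c.U s),
    inner ℂ ((F.lam (s 0)).val (restrVertex (E := EM) c.U s 0 x))
      ((F'.lam (s 0)).val (restrVertex (E := EM) c.U s 0 x)) = expc (g.1 s x)

theorem inner_eq_inv {A : HermitianLine} {a b : A} {r : ℝ} (h : inner ℂ a b = expc r) :
    inner ℂ b a = (expc r)⁻¹ := by
  rw [← inner_conj_symm, h, conj_expc]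

theorem IsRatio.t_eq {F F' : Frame G} {g : RelCochain c ℝ 0} (h : IsRatio F F' g) (v x) :
    F'.t v x = expc ((relD c ℝ 0 g).2 v x) * F.t v x := by
  have key := coefL_eq (G.gerbe.θ v) x _ _ _ ((F'.σ _).val _) ((F'.σ _).val _) ((F'.σ _).val _)
    ((F.σ _).norm_eq (restr (E := EN) c.V v (Fin.succAbove 0) x))
    ((F.σ _).norm_eq (restr (E := EN) c.V v (Fin.succAbove 1) x))
    ((F.σ _).norm_eq (restr (E := EN) c.V v (Fin.succAbove 2) x))
  have h0 := inner_eq_inv (h.1 (v ∘ Fin.succAbove 0) (restr (E := EN) c.V v (Fin.succAbove 0) x))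
  have h1 := h.1 (v ∘ Fin.succAbove 1) (restr (E := EN) c.V v (Fin.succAbove 1) x)
  have h2 := inner_eq_inv (h.1 (v ∘ Fin.succAbove 2) (restr (E := EN) c.V v (Fin.succAbove 2) x))
  have key' := (key.trans (congrArg (· * _) (congrArg₂ _ (congrArg₂ _ h0 h1) h2)))
  have e : expc ((relD c ℝ 0 g).2 v x) = _ := expc_cechD_one g.2 v x
  rw [e]
  refine (congrArg (·⁻¹) key').trans ?_
  change _ = _ * (coefL _ _ _ _ _)⁻¹
  simp only [mul_inv, inv_inv]
  rfl

/-- In `s` the section `σ` enters directly and `δλ` inversely. This is the sign pattern of `Φ^* g.2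
- δ g.1`, the first component of the cone differential. -/
theorem IsRatio.s_eq {F F' : Frame G} {g : RelCochain c ℝ 0} (h : IsRatio F F' g) (v x) :
    F'.s v x = expc ((relD c ℝ 0 g).1 v x) * F.s v x := by
  have key := coefE_eq (G.quasi.ψ v) x _ _ _ ((F'.lam _).val _) ((F'.lam _).val _)
    ((F'.σ (Sigma.fst ∘ v)).val (mapInter Φ Sigma.fst c.map_mem v x))
    ((F.lam (v 1)).norm_eq (restrVertex (E := EM) c.U v 1 x))
    ((F.lam (v 0)).norm_eq (restrVertex (E := EM) c.U v 0 x))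
    ((F.σ (Sigma.fst ∘ v)).norm_eq (mapInter Φ Sigma.fst c.map_mem v x))
  have h0 := h.2 (v ∘ Fin.succAbove 0) (face c.U v 0 x)
  have h1 := inner_eq_inv (h.2 (v ∘ Fin.succAbove 1) (face c.U v 1 x))
  have h2 := inner_eq_inv (h.1 (Sigma.fst ∘ v) (mapInter Φ Sigma.fst c.map_mem v x))
  have key' := (key.trans (congrArg (· * _) (congrArg₂ _ (congrArg₂ _ h0 h1) h2)))
  have e : expc ((relD c ℝ 0 g).1 v x) = expc (g.2 (Sigma.fst ∘ v)
      (mapInter Φ Sigma.fst c.map_mem v x)) * (expc (cechD c.U ℝ 0 g.1 v x))⁻¹ := expc_sub _ _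
  rw [e, expc_cechD_zero]
  refine (congrArg (·⁻¹) key').trans ?_
  change _ = _ * (coefE _ _ _ _ _)⁻¹
  simp only [mul_inv, inv_inv]
  refine congrArg (· * _) ?_
  exact mul_comm _ _

/-- The product of a frame with `exp(2πi g)`. -/
def smul (F : Frame G) (g : RelCochain c ℝ 0) (hg : SmoothRel g) : Frame G where
  σ v := .ofSmoothAt (fun x => expc (g.2 v x) • (F.σ v).val x) fun x =>
    ⟨by rw [norm_smul, norm_expc, (F.σ v).norm_eq, one_mul],
      ((F.σ v).smoothAt x).smul (contMDiff_expc (hg.2 v x))⟩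
  lam i := .ofSmoothAt (fun x => expc (g.1 (fun _ => i) ⟨x.1, fun _ => x.2⟩) • (F.lam i).val x)
    fun x => ⟨by rw [norm_smul, norm_expc, (F.lam i).norm_eq, one_mul],
      ((F.lam i).smoothAt x).smul (contMDiff_expc
        (((hg.1 (fun _ => i)).comp (contMDiff_inclusion (U := c.U i)
          (V := inter c.U fun _ : Fin 1 => i) fun x hx _ => hx)) x))⟩

theorem isRatio_smul (F : Frame G) (g : RelCochain c ℝ 0) (hg : SmoothRel g) :
    IsRatio F (F.smul g hg) g := by
  have key : ∀ {A : HermitianLine} {a : A} (r : ℂ), ‖a‖ = 1 → inner ℂ a (r • a) = r := by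
    intro A a r ha
    rw [inner_smul_right, inner_self_eq_norm_sq_to_K, ha]
    simp
  refine ⟨fun s x => key _ ((F.σ s).norm_eq x), fun s x => ?_⟩
  obtain ⟨i, rfl⟩ : ∃ i, s = fun _ => i := ⟨s 0, funext fun k => congrArg s (Subsingleton.elim k 0)⟩
  exact key _ ((F.lam i).norm_eq _)

/-- The cochain `w' - w - dg` has exponential `1`, so it is an integral `n`. Applying `d` removes
`dg` and leaves the difference of the two cocycles as the coboundary of `n`. -/
theorem IsRatio.exists_int {F F' : Frame G} {g : RelCochain c ℝ 0} (h : IsRatio F F' g)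
    (hg : SmoothRel g) {w w' : RelCochain c ℝ 1} (hw : F.IsLog w) (hw' : F'.IsLog w') :
    ∃ n ∈ intCochains c 1, relD c ℝ 1 w' - relD c ℝ 1 w = castReal c 2 (relD c ℤ 1 n) := by
  have key : ExpOne (w' - w - relD c ℝ 0 g) := by
    refine ⟨fun s x => ?_, fun s x => ?_⟩
    · change expc (w'.1 s x - w.1 s x - (relD c ℝ 0 g).1 s x) = 1
      have h0 : F.s s x ≠ 0 := by rw [← hw.2.2]; exact expc_ne_zero _
      have h1 := expc_ne_zero ((relD c ℝ 0 g).1 s x)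
      rw [expc_sub, expc_sub, hw.2.2, hw'.2.2, h.s_eq]
      field_simp
    · change expc (w'.2 s x - w.2 s x - (relD c ℝ 0 g).2 s x) = 1
      have h0 : F.t s x ≠ 0 := by rw [← hw.2.1]; exact expc_ne_zero _
      have h1 := expc_ne_zero ((relD c ℝ 0 g).2 s x)
      rw [expc_sub, expc_sub, hw.2.1, hw'.2.1, h.t_eq]
      field_simp
  obtain ⟨n, hn, hnw⟩ := exists_castReal_eq ((hw'.1.sub hw.1).sub hg.relD) key
  refine ⟨n, hn, ?_⟩
  rw [← relD_castReal, hnw, map_sub, map_sub, relD_relD_zero, sub_zero]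

/-- Two unitary sections of a line bundle differ by a `U(1)`-valued function, which has logarithms
after refinement. Only single members on `M` and pairs on `N` have to be made small. -/
theorem exists_isRatio [T2Space M] [LocallyCompactSpace M] [SecondCountableTopology M]
    [T2Space N] [LocallyCompactSpace N] [SecondCountableTopology N] (F F' : Frame G) :
    ∃ (c' : RelCover Φ) (m : Refinement c' c) (g : RelCochain c' ℝ 0), SmoothRel g ∧
      IsRatio (F.restrict m) (F'.restrict m) g := by
  have hn : ∀ {A : HermitianLine} {a b : A}, ‖a‖ = 1 → ‖b‖ = 1 → ‖(inner ℂ a b : ℂ)‖ = 1 :=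
    fun ha hb => (norm_inner_of_unit ha _).trans hb
  obtain ⟨c', m, -, hP, hQ⟩ := exists_refinement_of_localProp c (.true (n := 1))
    (localProp_log (E := EN) (W := fun s => inter c.V s) (fun s x hx => hx)
      (fun s x => inner ℂ ((F.σ s).val x) ((F'.σ s).val x))
      (fun s x => ((F.σ s).smoothAt x).inner ((F'.σ s).smoothAt x))
      fun s x => hn ((F.σ s).norm_eq x) ((F'.σ s).norm_eq x))
    (localProp_log (E := EM) (n := 1) (U := c.U) (W := fun s => c.U (s 0)) (fun s x hx => hx 0)
      (fun s x => inner ℂ ((F.lam (s 0)).val x) ((F'.lam (s 0)).val x))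
      (fun s x => ((F.lam (s 0)).smoothAt x).inner ((F'.lam (s 0)).smoothAt x))
      fun s x => hn ((F.lam (s 0)).norm_eq x) ((F'.lam (s 0)).norm_eq x))
  choose b hb using hP
  choose a ha using hQ
  refine ⟨c', m, (fun s x => a s ⟨x.1, m.U_le _ _ (x.2 0)⟩, fun s x => b s
    (mapInter (E := EN) (F := EN) (V := c.V) ContMDiffMap.id m.f m.V_le s x)),
    ⟨fun s x => ?_, fun s x => ?_⟩, fun s x => ?_, fun s x => ?_⟩
  · exact ContMDiffAt.comp (g := a s) (f := (restrictOpens (E := EM) (F := EM) ContMDiffMap.id _ _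
      (m.U_le (s 0))).comp (restrVertex (E := EM) c'.U s 0)) x
        (ha s ⟨x.1, m.U_le _ _ (x.2 0)⟩ x.2).1 (ContMDiffMap.contMDiff _ x)
  · exact (hb s (mapInter (E := EN) (F := EN) (V := c.V) ContMDiffMap.id m.f m.V_le s x) x.2).1.comp x
      ((mapInter (E := EN) (F := EN) (V := c.V) ContMDiffMap.id m.f m.V_le s).contMDiff x)
  · exact (hb s (mapInter (E := EN) (F := EN) (V := c.V) ContMDiffMap.id m.f m.V_le s x)
      x.2).2.symm
  · exact (ha s ⟨x.1, m.U_le _ _ (x.2 0)⟩ x.2).2.symm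

end Frame

variable [T2Space M] [LocallyCompactSpace M] [SecondCountableTopology M]
  [T2Space N] [LocallyCompactSpace N] [SecondCountableTopology N]

/-- The Dixmier–Douady class does not depend on the choices. -/
theorem IsDDCocycle.mk_eq {G : RelGerbe c} {z z' : intCocycles c 2} (h : G.IsDDCocycle z)
    (h' : G.IsDDCocycle z') : H3.mk z = H3.mk z' := by
  rw [Frame.isDDCocycle_iff] at h h'
  obtain ⟨F, w, hw, hz⟩ := h
  obtain ⟨F', w', hw', hz'⟩ := h'
  obtain ⟨c', m, g, hg, hr⟩ := Frame.exists_isRatio F F'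
  obtain ⟨n, hn, hnw⟩ := hr.exists_int hg (hw.restrict m) (hw'.restrict m)
  rw [← H3.mk_res m z, ← H3.mk_res m z']
  refine H3.mk_eq_of_sub_mem ⟨n, hn, castReal_injective _ _ ?_⟩
  rw [← hnw, castReal_sub, ← cochainRes_relD, ← cochainRes_relD, hz, hz']
  rfl

end RelGerbe

theorem GerOn.IsDD.mk_eq [T2Space M] [LocallyCompactSpace M] [SecondCountableTopology M]
    [T2Space N] [LocallyCompactSpace N] [SecondCountableTopology N] {x : GerOn c}
    {z z' : intCocycles c 2} (h : x.IsDD z) (h' : x.IsDD z') : H3.mk z = H3.mk z' := by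
  induction x using Quot.ind with | mk G
  exact RelGerbe.IsDDCocycle.mk_eq h h'

end Comparison

end RelativeGerbe

end

noncomputable section

namespace RelativeGerbe

open HermitianLine

/-! ### The homomorphism `κ`. -/

section Kappa

variable {EM : Type*} [NormedAddCommGroup EM] [NormedSpace ℝ EM]
  {M : Type u} [TopologicalSpace M] [ChartedSpace EM M]
  {EN : Type*} [NormedAddCommGroup EN] [NormedSpace ℝ EN]
  {N : Type u} [TopologicalSpace N] [ChartedSpace EN N]
  {Φ : C^∞⟮𝓘(ℝ, EM), M; 𝓘(ℝ, EN), N⟯} {c c' : RelCover Φ}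

namespace RelGerbe

namespace Frame

variable {G : RelGerbe c} (m : Refinement c' c)

/-- The hypotheses have the form produced by the refinement lemmas: sections over the coarse sets
that are unitary and smooth over the fine ones. -/
theorem nonempty_restrict
    (hL : ∀ s : Fin 2 → c'.J, ∃ σ : ∀ x, (G.gerbe.L (m.f ∘ s)).fiber x,
      ∀ x, x.1 ∈ inter c'.V s → ‖σ x‖ = 1 ∧ (G.gerbe.L (m.f ∘ s)).SmoothAt σ x)
    (hB : ∀ s : Fin 1 → Σ j, c'.K j, ∃ e : ∀ x, (G.quasi.B (m.idx (s 0))).fiber x,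
      ∀ x, x.1 ∈ inter c'.U s → ‖e x‖ = 1 ∧ (G.quasi.B (m.idx (s 0))).SmoothAt e x) :
    Nonempty (Frame (G.restrict m)) := by
  choose σ hσ using hL
  choose e he using hB
  exact ⟨{
    σ := fun v => .ofSmoothAt (L := (G.gerbe.L (m.f ∘ v)).pullback
        (mapInter (E := EN) (F := EN) (V := c.V) ContMDiffMap.id m.f m.V_le v))
      (fun x => σ v _) fun x => ⟨(hσ v _ x.2).1, (hσ v _ x.2).2.pullback _⟩
    lam := fun i => .ofSmoothAt (L := restrictB m G.quasi.B i) (fun x => e (fun _ => i) _)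
      fun x => ⟨(he (fun _ => i) _ fun _ => x.2).1, (he (fun _ => i) _ fun _ => x.2).2.pullback _⟩ }⟩

theorem exists_isLog_restrict (F : Frame G)
    (ht : ∀ v : Fin 3 → c'.J, ∃ b : inter c.V (m.f ∘ v) → ℝ, ∀ x, x.1 ∈ inter c'.V v →
      ContMDiffAt 𝓘(ℝ, EN) 𝓘(ℝ, ℝ) ∞ b x ∧ expc (b x) = F.t (m.f ∘ v) x)
    (hs : ∀ v : Fin 2 → Σ j, c'.K j, ∃ a : inter c.U (m.idx ∘ v) → ℝ, ∀ x, x.1 ∈ inter c'.U v →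
      ContMDiffAt 𝓘(ℝ, EM) 𝓘(ℝ, ℝ) ∞ a x ∧ expc (a x) = F.s (m.idx ∘ v) x) :
    ∃ w, (F.restrict m).IsLog w := by
  choose b hb using ht
  choose a ha using hs
  refine ⟨(fun v x => a v (mapInter (E := EM) (F := EM) (V := c.U) ContMDiffMap.id m.idx m.U_le v x),
    fun v x => b v (mapInter (E := EN) (F := EN) (V := c.V) ContMDiffMap.id m.f m.V_le v x)),
    ⟨fun v x => ?_, fun v x => ?_⟩, fun v x => ?_, fun v x => ?_⟩
  · exact ContMDiffAt.comp (g := a v) x (ha v (mapInter (E := EM) (F := EM) (V := c.U)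
      ContMDiffMap.id m.idx m.U_le v x) x.2).1 (ContMDiffMap.contMDiff _ x)
  · exact ContMDiffAt.comp (g := b v) x (hb v (mapInter (E := EN) (F := EN) (V := c.V)
      ContMDiffMap.id m.f m.V_le v x) x.2).1 (ContMDiffMap.contMDiff _ x)
  · exact (hb v (mapInter (E := EN) (F := EN) (V := c.V) ContMDiffMap.id m.f m.V_le v x) x.2).2
  · exact (ha v (mapInter (E := EM) (F := EM) (V := c.U) ContMDiffMap.id m.idx m.U_le v x) x.2).2

end Frame

end RelGerbe

variable [T2Space M] [LocallyCompactSpace M] [SecondCountableTopology M]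
  [T2Space N] [LocallyCompactSpace N] [SecondCountableTopology N]

namespace GerOn

/-- Two successive refinements are needed, since `s` and `t` are defined only once a frame has been
found: the first yields unitary sections, the second logarithms. Both are doubles of refinements of
undoubled covers, so that the two copies remain available at the end. -/
theorem exists_isDD_double (x : GerOn c.double) :
    ∃ (c' : RelCover Φ) (m : Refinement c' c) (z : intCocycles c'.double 2),
      (restrict m.mapDouble x).IsDD z := by
  induction x using Quot.ind with | mk G
  obtain ⟨c₁, m₁, -, hL, -, hB, -⟩ := exists_refinement_double_of_localProp c (.true)
    (localProp_section (W := fun s => inter c.double.V s) (fun s x hx => hx) G.gerbe.L) .true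
    (localProp_section (W := fun s : Fin 1 → _ => c.double.U (s 0)) (fun s x hx => hx 0)
      fun s => G.quasi.B (s 0)) .true
  obtain ⟨F⟩ := RelGerbe.Frame.nonempty_restrict m₁.mapDouble hL hB
  obtain ⟨c₂, m₂, -, -, ht, -, hs⟩ := exists_refinement_double_of_localProp c₁ .true .true
    (localProp_log (E := EN) (W := fun s => inter c₁.double.V s) (fun s x hx => hx) F.t
      F.contMDiff_t F.norm_t) .true
    (localProp_log (E := EM) (W := fun s => inter c₁.double.U s) (fun s x hx => hx) F.s
      F.contMDiff_s F.norm_s)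
  obtain ⟨w, hw⟩ := F.exists_isLog_restrict m₂.mapDouble ht hs
  obtain ⟨z, hz⟩ := hw.exists_cocycle
  refine ⟨c₂, m₁.comp m₂, z, ?_⟩
  have h : restrict (m₁.comp m₂).mapDouble (mk G) = _ :=
    restrict_comp m₁.mapDouble m₂.mapDouble (mk G)
  change (restrict (m₁.comp m₂).mapDouble (mk G)).IsDD z
  rw [h]
  exact RelGerbe.Frame.isDDCocycle_iff.2 ⟨_, w, hw, hz⟩

/-- The class is pulled back along the folding of the double onto `c`, and the resulting cocycle is
restricted to one of the two copies. -/
theorem exists_isDD (x : GerOn c) : ∃ (c' : RelCover Φ) (m : Refinement c' c)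
    (z : intCocycles c' 2), (restrict m x).IsDD z := by
  obtain ⟨c', m, z, hz⟩ := exists_isDD_double
    (restrict (Refinement.copair (Refinement.id c) (Refinement.id c)) x)
  have h := hz.restrict (Refinement.inDouble true c')
  rw [← restrict_comp, ← restrict_comp] at h
  exact ⟨c', _, _, h⟩

/-- The Dixmier–Douady class does not depend on the refinement on which it is computed. -/
theorem mk_eq_of_isDD_restrict {c₁ c₂ : RelCover Φ} {x : GerOn c} (p : Refinement c₁ c)
    (q : Refinement c₂ c) {z₁ : intCocycles c₁ 2} {z₂ : intCocycles c₂ 2}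
    (h₁ : (restrict p x).IsDD z₁) (h₂ : (restrict q x).IsDD z₂) : H3.mk z₁ = H3.mk z₂ := by
  let p' := p.comp (Refinement.infLeft c₁ c₂)
  let q' := q.comp (Refinement.infRight c₁ c₂)
  -- On the common refinement `p'` and `q'` are parallel, and `copair` uses one on each copy of the
  -- double.
  obtain ⟨d, m, z, hz⟩ := exists_isDD_double (restrict (Refinement.copair p' q') x)
  rw [← restrict_comp] at hz
  -- Restricting the single cocycle `z` to the two copies gives cocycles for the two restrictions of
  -- `x`. They agree in the limit because each has the class of `z`; the given cocycles are then
  -- compared with them on one and the same cover.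
  have k₁ := hz.restrict (Refinement.inDouble true d)
  have k₂ := hz.restrict (Refinement.inDouble false d)
  have l₁ := h₁.restrict ((Refinement.infLeft c₁ c₂).comp m)
  have l₂ := h₂.restrict ((Refinement.infRight c₁ c₂).comp m)
  rw [← restrict_comp] at k₁ k₂ l₁ l₂
  have e₁ := IsDD.mk_eq k₁ l₁
  have e₂ := IsDD.mk_eq k₂ l₂
  rw [H3.mk_res, H3.mk_res] at e₁ e₂
  rw [← e₁, e₂]

/-- The Dixmier–Douady class of an isomorphism class of relative gerbes. -/
def ddClass (x : GerOn c) : H3 Φ := H3.mk (exists_isDD x).choose_spec.choose_spec.choose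

theorem ddClass_eq {x : GerOn c} (m : Refinement c' c) {z : intCocycles c' 2}
    (h : (restrict m x).IsDD z) : ddClass x = H3.mk z :=
  mk_eq_of_isDD_restrict _ m (exists_isDD x).choose_spec.choose_spec.choose_spec h

theorem ddClass_add (x y : GerOn c) : ddClass (x + y) = ddClass x + ddClass y := by
  obtain ⟨c₁, m₁, z₁, h₁⟩ := exists_isDD x
  obtain ⟨c₂, m₂, z₂, h₂⟩ := exists_isDD (restrict m₁ y)
  have h₁' := h₁.restrict m₂
  rw [← restrict_comp] at h₁' h₂
  have h := h₁'.add h₂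
  rw [← map_add] at h
  rw [ddClass_eq _ h, ddClass_eq _ h₁', ddClass_eq _ h₂, H3.mk_add]

theorem ddClass_restrict (m : Refinement c' c) (x : GerOn c) :
    ddClass (restrict m x) = ddClass x := by
  obtain ⟨c₁, m₁, z₁, h₁⟩ := exists_isDD (restrict m x)
  rw [ddClass_eq _ h₁]
  rw [← restrict_comp] at h₁
  rw [ddClass_eq _ h₁]

end GerOn

/-- The relative Dixmier–Douady class. -/
def kappa (Φ : C^∞⟮𝓘(ℝ, EM), M; 𝓘(ℝ, EN), N⟯) : Ger Φ →+ H3 Φ :=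
  Lim.lift (GerOn (Φ := Φ)) (fun m => GerOn.restrict m)
    (fun _ => AddMonoidHom.mk' GerOn.ddClass GerOn.ddClass_add) GerOn.ddClass_restrict

theorem kappa_mk (G : RelGerbe c) : kappa Φ (Ger.mk G) = GerOn.ddClass (GerOn.mk G) :=
  Lim.lift_of (GerOn (Φ := Φ)) (fun m => GerOn.restrict m) _ _ c (GerOn.mk G)

theorem kappa_mk_eq {G : RelGerbe c} {m : Refinement c' c} {z : intCocycles c' 2}
    (h : (G.restrict m).IsDDCocycle z) : kappa Φ (Ger.mk G) = H3.mk z :=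
  (kappa_mk G).trans (GerOn.ddClass_eq m h)

theorem kappa_mk_eq_of_isDDCocycle {G : RelGerbe c} {z : intCocycles c 2}
    (h : G.IsDDCocycle z) : kappa Φ (Ger.mk G) = H3.mk z :=
  (kappa_mk_eq (h.restrict (Refinement.id c))).trans (H3.mk_res _ z)

end Kappa

end RelativeGerbe

end

noncomputable section

namespace RelativeGerbe

open HermitianLine

/-! ### Realising cocycles by gerbes with trivial bundles. -/

section Trivialisation

variable {EM : Type*} [NormedAddCommGroup EM] [NormedSpace ℝ EM]
  {M : Type u} [TopologicalSpace M] [ChartedSpace EM M]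
  {EN : Type*} [NormedAddCommGroup EN] [NormedSpace ℝ EN]
  {N : Type u} [TopologicalSpace N] [ChartedSpace EN N]
  {Φ : C^∞⟮𝓘(ℝ, EM), M; 𝓘(ℝ, EN), N⟯} {c c' : RelCover Φ}

theorem HermitianLine.inner_self_of_norm {A : HermitianLine} {a : A} (ha : ‖a‖ = 1) :
    (inner ℂ a a : ℂ) = 1 := by
  rw [inner_self_eq_norm_sq_to_K, ha]; simp

theorem HermitianLine.inner_mul_inner_swap {A : HermitianLine} {a b : A} (ha : ‖a‖ = 1)
    (hb : ‖b‖ = 1) : (inner ℂ a b * inner ℂ b a : ℂ) = 1 := by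
  rw [inner_mul_inner hb, inner_self_of_norm ha]

/-- The vector `exp(2πi r) (1 ⊗ 1⁻¹ ⊗ 1)`. -/
def HermitianLine.phase₃ (r : ℝ) : (trivial.tensor trivial.dual).tensor trivial :=
  expc r • vec₃ one one one

theorem HermitianLine.norm_phase₃ (r : ℝ) : ‖phase₃ r‖ = 1 := by
  rw [phase₃, norm_smul, norm_expc, norm_vec₃, HermitianLine.norm_one, one_mul, one_mul, one_mul]

theorem HermitianLine.inner_phase₃ (u v w : trivial) (r : ℝ) :
    inner ℂ (vec₃ u v w) (phase₃ r) =
      (inner ℂ u one * inner ℂ one v * inner ℂ w one * expc r : ℂ) := by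
  rw [phase₃, inner_smul_right, inner_vec₃, mul_comm]

/-- The vector `exp(2πi r) ((1 ⊗ 1⁻¹)⁻¹ ⊗ 1)`. -/
def HermitianLine.phase₂ (r : ℝ) : (trivial.tensor trivial.dual).dual.tensor trivial :=
  expc r • vec₂ one one one

theorem HermitianLine.norm_phase₂ (r : ℝ) : ‖phase₂ r‖ = 1 := by
  rw [phase₂, norm_smul, norm_expc, norm_vec₂, HermitianLine.norm_one, one_mul, one_mul, one_mul]

theorem HermitianLine.inner_phase₂ (u v w : trivial) (r : ℝ) :
    inner ℂ (vec₂ u v w) (phase₂ r) =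
      (inner ℂ one u * inner ℂ v one * inner ℂ w one * expc r : ℂ) := by
  rw [phase₂, inner_smul_right, inner_vec₂, mul_comm]

/-- The trivial bundles, with the sections `exp(-2πi b)`. -/
def Gerbe.ofCochain {E : Type*} [NormedAddCommGroup E] [NormedSpace ℝ E] {X : Type u}
    [TopologicalSpace X] [ChartedSpace E X] {ι : Type u} {U : ι → Opens X} (b : Cochain U ℝ 2)
    (hb : RelGerbe.SmoothCochain (E := E) b) (hd : ∀ s x, expc (cechD U ℝ 2 b s x) = 1) :
    Gerbe E U where
  L _ := .trivial
  -- The sign is negative because `t` is the inverse of the coefficient of `θ`: the constant frame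
  -- then has `t = exp(2πi b)`.
  θ s := mkSectionL (fun x => phase₃ (-b s x)) (fun x => norm_phase₃ _) <| by
    rintro _ rfl _ rfl _ rfl
    refine ContMDiffOn.congr (f := fun x => expc (-b s x))
      (fun x _ => (contMDiff_expc (hb s x).neg).contMDiffWithinAt) fun x _ => ?_
    exact (inner_phase₃ one one one _).trans (by
      rw [inner_one_one, one_mul, one_mul, one_mul])
  cocycle s x ℓ hℓ := by
    -- For arbitrary test vectors the coefficients split into the coboundary of their inner products
    -- with `1`, which is closed, and the phases, whose coboundary is trivial by `hd`.
    refine cocycle_mul (c := fun v => inner ℂ (ℓ (v ∘ Fin.succAbove 0)) one *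
      inner ℂ one (ℓ (v ∘ Fin.succAbove 1)) * inner ℂ (ℓ (v ∘ Fin.succAbove 2)) one)
      (c' := fun v => expc (-b (s ∘ v) (restr (E := E) U s v x)))
      (cocycle_of_unit (fun e => inner ℂ one (ℓ e)) (fun e => norm_inner_one (hℓ e)) fun v =>
        (congrArg₂ _ (congrArg₂ _ (inner_conj_symm _ _).symm rfl) (inner_conj_symm _ _).symm)) ?_
      fun v => ?_
    · have h := hd s x
      rw [expc_cechD_two] at h
      rw [← inv_inj, inv_one, ← h]
      simp only [delta₂, expc_neg, mul_inv, inv_inv]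
      rfl
    · exact inner_phase₃ _ _ _ _

theorem Gerbe.coefL_ofCochain {E : Type*} [NormedAddCommGroup E] [NormedSpace ℝ E] {X : Type u}
    [TopologicalSpace X] [ChartedSpace E X] {ι : Type u} {U : ι → Opens X} {b : Cochain U ℝ 2}
    (hb : RelGerbe.SmoothCochain (E := E) b) (hd : ∀ s x, expc (cechD U ℝ 2 b s x) = 1) (s x)
    (u v w : HermitianLine.trivial) : coefL ((Gerbe.ofCochain b hb hd).θ s) x u v w =
      inner ℂ u one * inner ℂ one v * inner ℂ w one * expc (-b s x) :=
  inner_phase₃ _ _ _ _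

namespace RelGerbe

/-- The relative gerbe with trivial bundles defined by a real cochain `(a, b)`, for which
`exp(2πi d(a, b)) = 1`. -/
def ofCochain (w : RelCochain c ℝ 1) (hw : SmoothRel w) (hd : ExpOne (relD c ℝ 1 w)) :
    RelGerbe c where
  gerbe := .ofCochain w.2 hw.2 hd.2
  quasi :=
    { B := fun _ => .trivial
      ψ := fun s => mkSectionE (fun x => phase₂ (-w.1 s x)) (fun x => norm_phase₂ _) <| by
        rintro _ rfl _ rfl _ ⟨_, rfl, rfl⟩
        refine ContMDiffOn.congr (f := fun x => expc (-w.1 s x))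
          (fun x _ => (contMDiff_expc (hw.1 s x).neg).contMDiffWithinAt) fun x _ => ?_
        exact (inner_phase₂ one one one _).trans (by
          rw [inner_one_one, one_mul, one_mul, one_mul])
      delta_eq := fun s x e ℓ he hℓ => by
        let ℓ' : (Fin 2 → Fin 3) → HermitianLine.trivial := ℓ
        let e' : Fin 3 → HermitianLine.trivial := e
        refine delta₁_mul (p := fun v => inner ℂ one (e' (v 1)) * inner ℂ (e' (v 0)) one *
            inner ℂ (ℓ' v) one) (p' := fun v => expc (-w.1 (s ∘ v) (restr (E := EM) c.U s v x)))
          (delta₁_of_unit (fun a => inner ℂ one (e' a)) (fun a => norm_inner_one (he a))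
            (fun v => inner ℂ one (ℓ' v)) (fun v => norm_inner_one (hℓ v)) rfl fun v =>
              congrArg₂ _ (congrArg₂ _ rfl (inner_conj_symm _ _).symm) (inner_conj_symm _ _).symm)
          (z' := expc (-w.2 (Sigma.fst ∘ s) (mapInter Φ Sigma.fst c.map_mem s x))) ?_ ?_
          fun v => ?_
        · have h : expc (w.2 (Sigma.fst ∘ s) (mapInter Φ Sigma.fst c.map_mem s x) -
            cechD c.U ℝ 1 w.1 s x) = 1 := hd.1 s x
          rw [expc_sub, expc_cechD_one, mul_inv_eq_one₀ (by simp [expc_ne_zero])] at h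
          rw [expc_neg, h]
          simp only [delta₁, expc_neg, mul_inv, inv_inv]
          rfl
        · refine (Gerbe.coefL_ofCochain hw.2 hd.2 _ _ _ _ _).trans (congrArg (· * _) ?_)
          exact congrArg₂ _ (congrArg₂ _ (inner_conj_symm _ _).symm rfl) (inner_conj_symm _ _).symm
        · exact inner_phase₂ _ _ _ _ }

/-- The frame of the relative gerbe of a cochain. -/
def Frame.ofCochain (w : RelCochain c ℝ 1) (hw : SmoothRel w) (hd : ExpOne (relD c ℝ 1 w)) :
    Frame (RelGerbe.ofCochain w hw hd) where
  σ s := .ofSmoothAt (L := .trivial) (fun x => one) fun x =>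
    ⟨HermitianLine.norm_one, HermitianLineBundle.smoothAt_one⟩
  lam s := .ofSmoothAt (L := .trivial) (fun x => one) fun x =>
    ⟨HermitianLine.norm_one, HermitianLineBundle.smoothAt_one⟩

theorem Frame.isLog_ofCochain (w : RelCochain c ℝ 1) (hw : SmoothRel w)
    (hd : ExpOne (relD c ℝ 1 w)) : (Frame.ofCochain w hw hd).IsLog w := by
  refine ⟨hw, fun v x => ?_, fun v x => ?_⟩
  · have h := Gerbe.coefL_ofCochain hw.2 hd.2 v x one one one
    rw [inner_one_one, one_mul, one_mul, one_mul] at h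
    exact (inv_inv _).symm.trans (congrArg (·⁻¹) ((expc_neg _).symm.trans h.symm))
  · have h := inner_phase₂ one one one (-w.1 v x)
    rw [inner_one_one, one_mul, one_mul, one_mul] at h
    exact (inv_inv _).symm.trans (congrArg (·⁻¹) ((expc_neg _).symm.trans h.symm))

/-- Every cocycle is the Dixmier–Douady cocycle of a relative gerbe. -/
theorem exists_isDDCocycle [FiniteDimensional ℝ EM] [IsManifold 𝓘(ℝ, EM) ∞ M] [T2Space M]
    [SecondCountableTopology M] [FiniteDimensional ℝ EN] [IsManifold 𝓘(ℝ, EN) ∞ N] [T2Space N]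
    [SecondCountableTopology N] (z : intCocycles c 2) : ∃ G : RelGerbe c, G.IsDDCocycle z := by
  have hs := SmoothRel.castReal z.2.1
  -- Seen as a smooth real cocycle, the integral cocycle is a coboundary; its primitive `w` is the
  -- logarithm of the gerbe to be built.
  obtain ⟨w, h1, h2, hw⟩ := exists_relD_eq c (castReal c 2 z.1) hs.1 hs.2 (by
    rw [relD_castReal, show relD c ℤ 2 z.1 = 0 from z.2.2, castReal_zero])
  have hd : ExpOne (relD c ℝ 1 w) := by
    rw [hw]
    exact ⟨fun s x => expc_intCast _, fun s x => expc_intCast _⟩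
  exact ⟨ofCochain w ⟨h1, h2⟩ hd, Frame.isDDCocycle_iff.2
    ⟨_, w, Frame.isLog_ofCochain w ⟨h1, h2⟩ hd, hw⟩⟩

end RelGerbe

end Trivialisation

end RelativeGerbe

end

noncomputable section

namespace RelativeGerbe

open HermitianLine

/-! ### Trivial relative gerbes and the vanishing of the class. -/

section Kernel

variable {EM : Type*} [NormedAddCommGroup EM] [NormedSpace ℝ EM]
  {M : Type u} [TopologicalSpace M] [ChartedSpace EM M]
  {EN : Type*} [NormedAddCommGroup EN] [NormedSpace ℝ EN]
  {N : Type u} [TopologicalSpace N] [ChartedSpace EN N]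
  {Φ : C^∞⟮𝓘(ℝ, EM), M; 𝓘(ℝ, EN), N⟯} {c c' : RelCover Φ}

theorem coefL_eq_of_coef_one {E : Type*} [NormedAddCommGroup E] [NormedSpace ℝ E] {X : Type u}
    [TopologicalSpace X] [ChartedSpace E X] {ι : Type u} {U : ι → Opens X}
    {L : ∀ s : Fin 2 → ι, HermitianLineBundle E (inter U s)} {s : Fin 3 → ι}
    {θ : UnitarySection (deltaL U L s)} {x : inter U s} {a b c} (a' b' c') (ha : ‖a‖ = 1)
    (hb : ‖b‖ = 1) (hc : ‖c‖ = 1) (h : coefL θ x a b c = 1) :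
    coefL θ x a' b' c' = inner ℂ a' a * inner ℂ b b' * inner ℂ c' c := by
  rw [coefL_eq θ x a b c a' b' c' ha hb hc, h, mul_one]

theorem coefE_eq_of_coef_one {E : Type*} [NormedAddCommGroup E] [NormedSpace ℝ E] {X : Type u}
    [TopologicalSpace X] [ChartedSpace E X] {ι : Type u} {U : ι → Opens X}
    {B : ∀ i, HermitianLineBundle E (U i)} {s : Fin 2 → ι}
    {L : HermitianLineBundle E (inter U s)} {ψ : UnitarySection ((deltaE U B s).dual.tensor L)}
    {x : inter U s} {a b c} (a' b' c') (ha : ‖a‖ = 1) (hb : ‖b‖ = 1) (hc : ‖c‖ = 1)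
    (h : coefE ψ x a b c = 1) :
    coefE ψ x a' b' c' = inner ℂ a a' * inner ℂ b' b * inner ℂ c' c := by
  rw [coefE_eq ψ x a b c a' b' c' ha hb hc, h, mul_one]

theorem HermitianLine.norm_vec₂_one_one {A : HermitianLine} {a : A} (ha : ‖a‖ = 1) :
    ‖vec₂ one one a‖ = 1 := by
  rw [norm_vec₂, HermitianLine.norm_one, ha, one_mul, one_mul]

theorem HermitianLine.inner_vec₂_one_one {A : HermitianLine} (a b : A) :
    inner ℂ (vec₂ one one a) (vec₂ one one b) = (inner ℂ a b : ℂ) := by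
  rw [inner_vec₂, inner_one_one, one_mul, one_mul]

theorem HermitianLine.norm_tmul_covec {A B : HermitianLine} {a : A} {b : B} (ha : ‖a‖ = 1)
    (hb : ‖b‖ = 1) : ‖tmul a (covec b)‖ = 1 := by
  rw [norm_tmul, norm_covec, ha, hb, one_mul]

theorem HermitianLine.norm_smul_of_norm {A : HermitianLine} {a : A} {r : ℂ} (hr : ‖r‖ = 1)
    (ha : ‖a‖ = 1) : ‖r • a‖ = 1 := by
  rw [norm_smul, hr, ha, one_mul]

theorem HermitianLine.inner_tmul_normalize {A B : HermitianLine} {a : A} {b : B}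
    {v : A.tensor B} (h : ‖tmul a b‖ = 1) (hv : ‖v‖ = 1) :
    (inner ℂ (tmul ((inner ℂ (tmul a b) v : ℂ) • a) b) v : ℂ) = 1 := by
  have e : tmul ((inner ℂ (tmul a b) v : ℂ) • a) b = (inner ℂ (tmul a b) v : ℂ) • tmul a b := rfl
  rw [e, inner_smul_unit h, inner_self_of_norm hv]

/-- The arithmetic behind `Frame.isTrivial`. The numbers `y` and `z` compare a test vector of the
trivial bundle with `1`, `a` and `b` compare a test vector of `E` with `λ`, and `l` compares one of
`L` with `σ`; opposite inner products of unit vectors are inverse to each other. -/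
theorem coef_identity {y₁ y₀ z₀ a₁ b₁ a₀ b₀ l : ℂ} (hy : z₀ * y₀ = 1) (h₁ : a₁ * b₁ = 1)
    (h₀ : a₀ * b₀ = 1) : y₁ * z₀ * l = b₁ * a₀ * l * (a₁ * y₁ * (a₀ * y₀)⁻¹) := by
  obtain rfl := eq_inv_of_mul_eq_one_left hy
  obtain rfl := eq_inv_of_mul_eq_one_left h₁
  have := right_ne_zero_of_mul_eq_one hy
  have := right_ne_zero_of_mul_eq_one h₁
  have := left_ne_zero_of_mul_eq_one h₀
  field_simp

namespace RelGerbe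

namespace Frame

variable {G : RelGerbe c} (F : Frame G)

/-- The quasi-line bundle with trivial bundles defined by a frame for which `t = 1`. -/
def trivialQuasi (ht : ∀ v x, F.t v x = 1) : QuasiLineBundle G.gerbe where
  B _ := .trivial
  ψ s := mkSectionE (fun x => vec₂ one one ((F.σ s).val x))
    (fun x => norm_vec₂_one_one ((F.σ s).norm_eq x)) <| by
    rintro _ rfl _ rfl e he
    refine ((F.σ s).smooth e he).mono (fun x hx => hx.2) |>.congr fun x _ => ?_
    exact inner_vec₂_one_one _ _
  delta_eq s x e ℓ he hℓ := by
    have h : coefL (G.gerbe.θ s) x ((F.σ _).val _) ((F.σ _).val _) ((F.σ _).val _) = 1 :=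
      inv_eq_one.1 (ht s x)
    refine delta₁_of_unit (fun a => inner ℂ one (e a)) (fun a => norm_inner_one (he a))
      (fun v => inner ℂ ((F.σ (s ∘ v)).val (restr (E := EN) c.V s v x)) (ℓ v))
      (fun v => (norm_inner_of_unit ((F.σ (s ∘ v)).norm_eq _) _).trans (hℓ v)) ?_ fun v => ?_
    · refine (coefL_eq_of_coef_one _ _ _ ((F.σ _).norm_eq _) ((F.σ _).norm_eq _)
        ((F.σ _).norm_eq _) h).trans ?_
      exact congrArg₂ _ (congrArg₂ _ (inner_conj_symm _ _).symm rfl) (inner_conj_symm _ _).symm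
    · refine (inner_vec₂ _ _ _ _ _ _).trans ?_
      exact congrArg₂ _ (congrArg₂ _ rfl (inner_conj_symm _ _).symm) (inner_conj_symm _ _).symm

/-- From `t = 1` the sections `σ` themselves are the `ψ'` of a quasi-line bundle with trivial
underlying bundles. From `s = 1` one gets `ψ = (δλ)⁻¹ ⊗ Φ^* σ`, so that `λ`, tensored with the dual
of `1`, is the section `ξ`. -/
theorem isTrivial (ht : ∀ v x, F.t v x = 1) (hs : ∀ v x, F.s v x = 1) : G.IsTrivial := by
  refine ⟨F.trivialQuasi ht, fun i => .ofSmoothAt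
    (L := (G.quasi.B i).tensor (HermitianLineBundle.trivial.pullback _).dual)
    (fun x => tmul ((F.lam i).val x) (covec one)) fun x => ⟨norm_tmul_covec ((F.lam i).norm_eq x) HermitianLine.norm_one,
      ((F.lam i).smoothAt x).tmul (HermitianLineBundle.smoothAt_one.pullback _).covec⟩,
    fun s x e e' ℓ he he' hℓ => ?_⟩
  have h : coefE (G.quasi.ψ s) x ((F.lam (s 1)).val _) ((F.lam (s 0)).val _)
      ((F.σ (Sigma.fst ∘ s)).val (mapInter Φ Sigma.fst c.map_mem s x)) = 1 :=
    inv_eq_one.1 (hs s x)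
  have k := coefE_eq_of_coef_one (e 1) (e 0) ℓ ((F.lam _).norm_eq _) ((F.lam _).norm_eq _)
    ((F.σ _).norm_eq _) h
  let ε : Fin 2 → HermitianLine.trivial := e'
  have hε : ∀ a, ‖ε a‖ = 1 := he'
  have k1 : (inner ℂ (ε 0) one : ℂ) * inner ℂ one (ε 0) = 1 :=
    inner_mul_inner_swap (hε 0) HermitianLine.norm_one
  have k2 := inner_mul_inner_swap (he 1)
    ((F.lam (s 1)).norm_eq (restrVertex (E := EM) c.U s 1 x))
  have k3 := inner_mul_inner_swap (he 0)
    ((F.lam (s 0)).norm_eq (restrVertex (E := EM) c.U s 0 x))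
  have d : ∀ a : Fin 2, inner ℂ (tmul (e a) (covec (ε a)))
      (tmul ((F.lam (s a)).val (restrVertex (E := EM) c.U s a x)) (covec one)) =
      (inner ℂ (e a) ((F.lam (s a)).val (restrVertex (E := EM) c.U s a x)) *
        inner ℂ one (ε a) : ℂ) := fun a => by
    rw [inner_tmul, inner_covec]
  refine (inner_vec₂ _ _ _ _ _ _).trans (Eq.trans ?_ (congrArg₂ _ k.symm
    (congrArg₂ _ (d 1).symm (congrArg (·⁻¹) (d 0).symm))))
  exact coef_identity k1 k2 k3

end Frame

/-- A relative gerbe with a trivial Dixmier–Douady cocycle is trivial. -/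
theorem IsDDCocycle.isTrivial [FiniteDimensional ℝ EM] [IsManifold 𝓘(ℝ, EM) ∞ M] [T2Space M]
    [SecondCountableTopology M] [FiniteDimensional ℝ EN] [IsManifold 𝓘(ℝ, EN) ∞ N] [T2Space N]
    [SecondCountableTopology N] {G : RelGerbe c} {z : intCocycles c 2} (h : G.IsDDCocycle z)
    (hz : z.1 ∈ intCoboundaries c 1) : G.IsTrivial := by
  rw [Frame.isDDCocycle_iff] at h
  obtain ⟨F, w, hw, hwz⟩ := h
  obtain ⟨n, hn, hnz⟩ := hz
  have hs := (SmoothRel.castReal hn).sub hw.1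
  -- As `dw = z = dn`, the difference `n - w` is closed, hence of the form `dv`. Rescaling the frame
  -- by `exp(2πi v)` changes `(s, t)` into `exp(2πi (dv + w)) = exp(2πi n) = 1`.
  obtain ⟨v, h1, h2, hv⟩ := exists_relD_eq c (castReal c 1 n - w) hs.1 hs.2 (by
    rw [map_sub, relD_castReal, hwz, hnz, sub_self])
  refine (F.smul v ⟨h1, h2⟩).isTrivial (fun s x => ?_) fun s x => ?_
  · rw [(F.isRatio_smul v ⟨h1, h2⟩).t_eq, hv, ← hw.2.1, ← expc_add]
    change expc ((n.2 s x : ℝ) - w.2 s x + w.2 s x) = 1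
    rw [sub_add_cancel, expc_intCast]
  · rw [(F.isRatio_smul v ⟨h1, h2⟩).s_eq, hv, ← hw.2.2, ← expc_add]
    change expc ((n.1 s x : ℝ) - w.1 s x + w.1 s x) = 1
    rw [sub_add_cancel, expc_intCast]

/-- Correction of a unit vector by the inverse of its coefficient. -/
theorem coefE_normalize {E : Type*} [NormedAddCommGroup E] [NormedSpace ℝ E] {X : Type u}
    [TopologicalSpace X] [ChartedSpace E X] {ι : Type u} {U : ι → Opens X}
    {B : ∀ i, HermitianLineBundle E (U i)} {s : Fin 2 → ι}
    {L : HermitianLineBundle E (inter U s)} (ψ : UnitarySection ((deltaE U B s).dual.tensor L))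
    (x : inter U s) {a b c} (ha : ‖a‖ = 1) (hb : ‖b‖ = 1) (hc : ‖c‖ = 1) :
    coefE ψ x a b (coefE ψ x a b c • c) = 1 := by
  have h := coefE_smul ψ x a b c 1 1 (coefE ψ x a b c)
  rw [one_smul, one_smul, map_one, mul_one, one_mul, Complex.conj_mul', norm_coefE ψ x ha hb hc,
    Complex.ofReal_one, one_pow] at h
  exact h

/-- A trivial relative gerbe has, on a refinement, a Dixmier–Douady cocycle which is zero. -/
theorem IsTrivial.exists_isDDCocycle_zero
    [T2Space M] [LocallyCompactSpace M] [SecondCountableTopology M]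
    [T2Space N] [LocallyCompactSpace N] [SecondCountableTopology N] {G : RelGerbe c}
    (h : G.IsTrivial) : ∃ (c' : RelCover Φ) (m : Refinement c' c),
      (G.restrict m).IsDDCocycle 0 := by
  obtain ⟨Q, ξ, hξ⟩ := h
  obtain ⟨c', m, hμ, hσ, hlam⟩ := exists_refinement_of_localProp c
    (localProp_section (W := fun s : Fin 1 → _ => c.V (s 0)) (fun s x hx => hx 0)
      fun s => Q.B (s 0))
    (localProp_section (W := fun s => inter c.V s) (fun s x hx => hx) G.gerbe.L)
    (localProp_section (W := fun s : Fin 1 → _ => c.U (s 0)) (fun s x hx => hx 0)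
      fun s => G.quasi.B (s 0))
  choose μ' hμ' using hμ
  choose σ hσ using hσ
  choose lam' hlam' using hlam
  let μ : ∀ (j : c'.J) (x : c.V (m.f j)), (Q.B (m.f j)).fiber x := fun j => μ' fun _ => j
  have hμ : ∀ j x, x.1 ∈ c'.V j → ‖μ j x‖ = 1 ∧ (Q.B (m.f j)).SmoothAt (μ j) x :=
    fun j x hx => hμ' (fun _ => j) x fun _ => hx
  let lam : ∀ i (x : c.U (m.idx i)), (G.quasi.B (m.idx i)).fiber x := fun i => lam' fun _ => i
  have hlam : ∀ i x, x.1 ∈ c'.U i → ‖lam i x‖ = 1 ∧ (G.quasi.B (m.idx i)).SmoothAt (lam i) x :=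
    fun j x hx => hlam' (fun _ => j) x fun _ => hx
  -- The coefficient of `ψ'` along `μ` and `σ`. Multiplying `σ` by it makes the coefficient of `ψ'`
  -- equal to `1`.
  let r : ∀ s : Fin 2 → c'.J, inter c.V (m.f ∘ s) → ℂ := fun s x =>
    coefE (Q.ψ (m.f ∘ s)) x (μ (s 1) (restrVertex (E := EN) c.V (m.f ∘ s) 1 x))
      (μ (s 0) (restrVertex (E := EN) c.V (m.f ∘ s) 0 x)) (σ s x)
  have hr : ∀ s x, x.1 ∈ inter c'.V s → ‖r s x‖ = 1 := fun s x hx =>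
    norm_coefE _ _ (hμ _ (restrVertex (E := EN) c.V (m.f ∘ s) 1 x) (hx 1)).1
      (hμ _ (restrVertex (E := EN) c.V (m.f ∘ s) 0 x) (hx 0)).1 (hσ s x hx).1
  have hr' : ∀ s x, x.1 ∈ inter c'.V s → ContMDiffAt 𝓘(ℝ, EN) 𝓘(ℝ, ℂ) ∞ (r s) x := fun s x hx =>
    smoothAt_coefE (Q.ψ (m.f ∘ s)) (hμ _ (restrVertex (E := EN) c.V (m.f ∘ s) 1 x) (hx 1)).2
      (hμ _ (restrVertex (E := EN) c.V (m.f ∘ s) 0 x) (hx 0)).2 (hσ s x hx).2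
  have hr1 : ∀ s x, x.1 ∈ inter c'.V s →
      coefE (Q.ψ (m.f ∘ s)) x (μ (s 1) (restrVertex (E := EN) c.V (m.f ∘ s) 1 x))
        (μ (s 0) (restrVertex (E := EN) c.V (m.f ∘ s) 0 x)) (r s x • σ s x) = 1 := fun s x hx =>
    coefE_normalize _ _ (hμ _ (restrVertex (E := EN) c.V (m.f ∘ s) 1 x) (hx 1)).1
      (hμ _ (restrVertex (E := EN) c.V (m.f ∘ s) 0 x) (hx 0)).1 (hσ s x hx).1
  -- In the same way `λ` is multiplied by the coefficient of `ξ`. The frame `μ` is usable at `Φ x`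
  -- because `Φ` maps the fine member of the cover of `M` into the fine member over `N`.
  let q : ∀ i, c.U (m.idx i) → ℂ := fun i x => coefDiff (ξ (m.idx i)) x (lam i x)
    (μ i.1 (restrictOpens (E := EM) (F := EN) Φ _ _ (c.map_mem (m.idx i)) x))
  have hν : ∀ i x, x.1 ∈ c'.U i →
      ‖μ i.1 (restrictOpens (E := EM) (F := EN) Φ _ _ (c.map_mem (m.idx i)) x)‖ = 1 ∧ _ :=
    fun i x hx => hμ i.1 (restrictOpens (E := EM) (F := EN) Φ _ _ (c.map_mem (m.idx i)) x)
      (c'.map_mem i x.1 hx)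
  have hq : ∀ i x, x.1 ∈ c'.U i → ‖q i x‖ = 1 := fun i x hx =>
    (norm_inner_of_unit (norm_tmul_covec (hlam i x hx).1 (hν i x hx).1) _).trans
      ((ξ (m.idx i)).norm_eq x)
  have hq' : ∀ i x, x.1 ∈ c'.U i → ContMDiffAt 𝓘(ℝ, EM) 𝓘(ℝ, ℂ) ∞ (q i) x := fun i x hx =>
    HermitianLineBundle.SmoothAt.inner (L := G.differenceBundle Q (m.idx i))
      ((hlam i x hx).2.tmul ((hν i x hx).2.pullback (restrictOpens Φ _ _
        (c.map_mem (m.idx i)))).covec) ((ξ (m.idx i)).smoothAt x)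
  have hq1 : ∀ i x, x.1 ∈ c'.U i → coefDiff (ξ (m.idx i)) x (q i x • lam i x)
      (μ i.1 (restrictOpens (E := EM) (F := EN) Φ _ _ (c.map_mem (m.idx i)) x)) = 1 :=
    fun i x hx => inner_tmul_normalize (norm_tmul_covec (hlam i x hx).1 (hν i x hx).1)
      ((ξ (m.idx i)).norm_eq x)
  let F : Frame (G.restrict m) :=
    { σ := fun v => .ofSmoothAt (L := (G.gerbe.L (m.f ∘ v)).pullback
        (mapInter (E := EN) (F := EN) (V := c.V) ContMDiffMap.id m.f m.V_le v))
        (fun x => r v (mapInter (E := EN) (F := EN) (V := c.V) ContMDiffMap.id m.f m.V_le v x) •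
          σ v (mapInter (E := EN) (F := EN) (V := c.V) ContMDiffMap.id m.f m.V_le v x))
        fun x => ⟨norm_smul_of_norm (hr v _ x.2) (hσ v _ x.2).1,
          HermitianLineBundle.SmoothAt.pullback _ ((hσ v _ x.2).2.smul (hr' v _ x.2))⟩
      lam := fun i => .ofSmoothAt (L := restrictB m G.quasi.B i)
        (fun x => q i (restrictOpens (E := EM) (F := EM) ContMDiffMap.id _ _ (m.U_le i) x) •
          lam i (restrictOpens (E := EM) (F := EM) ContMDiffMap.id _ _ (m.U_le i) x))
        fun x => ⟨norm_smul_of_norm (hq i _ x.2) (hlam i _ x.2).1,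
          HermitianLineBundle.SmoothAt.pullback _ ((hlam i _ x.2).2.smul (hq' i _ x.2))⟩ }
  have ht : ∀ v x, F.t v x = 1 := fun v x => by
    let y := mapInter (E := EN) (F := EN) (V := c.V) ContMDiffMap.id m.f m.V_le v x
    -- All coefficients of `ψ'` are now `1`, and `δψ' = θ` forces those of `θ` to be `1`.
    have h := Q.delta_eq (m.f ∘ v) y
      (fun a => μ (v a) (restrVertex (E := EN) c.V (m.f ∘ v) a y))
      (fun k => r (v ∘ k) (restr (E := EN) c.V (m.f ∘ v) k y) •
        σ (v ∘ k) (restr (E := EN) c.V (m.f ∘ v) k y)) (fun a => (hμ _ _ (x.2 a)).1)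
      fun k => norm_smul_of_norm (hr (v ∘ k) (restr (E := EN) c.V (m.f ∘ v) k y) fun a => x.2 (k a))
        (hσ (v ∘ k) (restr (E := EN) c.V (m.f ∘ v) k y) fun a => x.2 (k a)).1
    have h' : delta₁ (fun _ => 1) = _ := (congrArg delta₁ (funext fun k =>
      (hr1 (v ∘ k) (restr (E := EN) c.V (m.f ∘ v) k y) fun a => x.2 (k a)).symm)).trans h
    refine inv_eq_one.2 (h'.symm.trans ?_)
    simp [delta₁]
  have hs : ∀ v x, F.s v x = 1 := fun v x => by
    let y := mapInter (E := EM) (F := EM) (V := c.U) ContMDiffMap.id m.idx m.U_le v x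
    let y' := mapInter Φ Sigma.fst c.map_mem (m.idx ∘ v) y
    have hy : y'.1 ∈ inter c'.V (Sigma.fst ∘ v) := fun a => c'.map_mem (v a) x.1 (x.2 a)
    -- With the coefficients of `ψ'` and of `ξ` equal to `1`, the gluing condition for `ξ` leaves
    -- only the coefficient of `ψ`, which must be `1`.
    have h := hξ (m.idx ∘ v) y
      (fun a => q (v a) (restrVertex (E := EM) c.U (m.idx ∘ v) a y) •
        lam (v a) (restrVertex (E := EM) c.U (m.idx ∘ v) a y))
      (fun a => μ (v a).1 (restrictOpens (E := EM) (F := EN) Φ _ _ (c.map_mem (m.idx (v a)))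
        (restrVertex (E := EM) c.U (m.idx ∘ v) a y)))
      (r (Sigma.fst ∘ v) y' • σ (Sigma.fst ∘ v) y')
      (fun a => norm_smul_of_norm (hq (v a) _ (x.2 a)) (hlam (v a) _ (x.2 a)).1)
      (fun a => (hν (v a) _ (x.2 a)).1) (norm_smul_of_norm (hr _ _ hy) (hσ _ _ hy).1)
    have h0 := hq1 (v 0) (restrVertex (E := EM) c.U (m.idx ∘ v) 0 y) (x.2 0)
    have h1 := hq1 (v 1) (restrVertex (E := EM) c.U (m.idx ∘ v) 1 y) (x.2 1)
    have h' := (hr1 (Sigma.fst ∘ v) y' hy).symm.trans (h.trans (congrArg₂ _ rfl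
      (congrArg₂ _ h1 (congrArg (·⁻¹) h0))))
    refine inv_eq_one.2 (Eq.trans ?_ h'.symm)
    rw [inv_one, mul_one, mul_one]
    rfl
  refine ⟨c', m, Frame.isDDCocycle_iff.2 ⟨F, 0, ⟨⟨fun s => contMDiff_const, fun s => contMDiff_const⟩,
    fun v x => ?_, fun v x => ?_⟩, ?_⟩⟩
  · rw [ht]
    exact expc_zero
  · rw [hs]
    exact expc_zero
  · rw [map_zero]
    exact (castReal_zero 2).symm

end RelGerbe

end Kernel

end RelativeGerbe

end

noncomputable section

namespace RelativeGerbe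

/-! ### Exactness of the sequence and the classification of relative gerbes. -/

section Classification

variable {EM : Type*} [NormedAddCommGroup EM] [NormedSpace ℝ EM]
  {M : Type u} [TopologicalSpace M] [ChartedSpace EM M]
  {EN : Type*} [NormedAddCommGroup EN] [NormedSpace ℝ EN]
  {N : Type u} [TopologicalSpace N] [ChartedSpace EN N]
  {Φ : C^∞⟮𝓘(ℝ, EM), M; 𝓘(ℝ, EN), N⟯} {c c' : RelCover Φ}

theorem Ger.mk_tensor (G G' : RelGerbe c) : Ger.mk (G.tensor G') = Ger.mk G + Ger.mk G' :=
  map_add (Lim.of (GerOn (Φ := Φ)) (fun m => GerOn.restrict m) c) (GerOn.mk G) (GerOn.mk G')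

theorem Ger.mk_dual (G : RelGerbe c) : Ger.mk G.dual = -Ger.mk G :=
  map_neg (Lim.of (GerOn (Φ := Φ)) (fun m => GerOn.restrict m) c) (GerOn.mk G)

theorem GerOn.mk_tensor_dual (G G' : RelGerbe c) :
    GerOn.mk (G.tensor G'.dual) = GerOn.mk G - GerOn.mk G' :=
  (sub_eq_add_neg (GerOn.mk G) (GerOn.mk G')).symm

variable [T2Space M] [SecondCountableTopology M] [LocallyCompactSpace M]
  [T2Space N] [SecondCountableTopology N] [LocallyCompactSpace N]

theorem exists_restrict_isDDCocycle (G : RelGerbe c) :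
    ∃ (c' : RelCover Φ) (m : Refinement c' c) (z : intCocycles c' 2),
      (G.restrict m).IsDDCocycle z :=
  GerOn.exists_isDD (GerOn.mk G)

theorem RelGerbe.IsTrivial.kappa_eq_zero {G : RelGerbe c} (h : G.IsTrivial) :
    kappa Φ (Ger.mk G) = 0 := by
  obtain ⟨c', m, hz⟩ := h.exists_isDDCocycle_zero
  rw [kappa_mk_eq hz]
  exact map_zero (Lim.of (fun c : RelCover Φ => intCohomology c 1) (fun m => cohomologyRes m 1) c')

/-- One refinement produces a cocycle, a further one turns it into a coboundary, and the restricted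
cocycle still belongs to the restricted gerbe. -/
theorem exists_isDD_of_ddClass_eq_zero {x : GerOn c} (h : x.ddClass = 0) :
    ∃ (c' : RelCover Φ) (m : Refinement c' c) (z : intCocycles c' 2),
      (GerOn.restrict m x).IsDD z ∧ z.1 ∈ intCoboundaries c' 1 := by
  obtain ⟨c₁, m₁, z, hz⟩ := GerOn.exists_isDD x
  rw [GerOn.ddClass_eq m₁ hz] at h
  obtain ⟨c₂, m₂, h₂⟩ := H3.exists_res_mem h
  refine ⟨c₂, m₁.comp m₂, _, ?_, h₂⟩
  rw [GerOn.restrict_comp]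
  exact hz.restrict m₂

variable [FiniteDimensional ℝ EM] [IsManifold 𝓘(ℝ, EM) ∞ M] [FiniteDimensional ℝ EN]
  [IsManifold 𝓘(ℝ, EN) ∞ N]

theorem kappa_mk_eq_zero_iff (G : RelGerbe c) : kappa Φ (Ger.mk G) = 0 ↔
    ∃ (c' : RelCover Φ) (m : Refinement c' c), (G.restrict m).IsTrivial := by
  refine ⟨fun h => ?_, fun ⟨c', m, h⟩ => ?_⟩
  · rw [kappa_mk] at h
    obtain ⟨c', m, z, hz, h0⟩ := exists_isDD_of_ddClass_eq_zero h
    exact ⟨c', m, RelGerbe.IsDDCocycle.isTrivial hz h0⟩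
  · rw [← Ger.mk_restrict m]
    exact h.kappa_eq_zero

/-- Restriction does not change the class in `Ger(Φ)`, so triviality on some refinement is enough to
lie in `Ger₀(Φ)`. Closure of `Ger₀(Φ)` under the group operations thus needs no direct verification.
-/
theorem coe_ker_kappa : ((kappa Φ).ker : Set (Ger Φ)) = Ger0 Φ := by
  ext x
  constructor
  · intro hx
    obtain ⟨c, G, rfl⟩ := Ger.exists_mk_eq x
    obtain ⟨c', m, h⟩ := (kappa_mk_eq_zero_iff G).1 hx
    exact ⟨c', G.restrict m, Ger.mk_restrict m G, h⟩
  · rintro ⟨c, G, rfl, h⟩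
    exact h.kappa_eq_zero

theorem kappa_mk_eq_iff (G : RelGerbe c) (G' : RelGerbe c') :
    kappa Φ (Ger.mk G) = kappa Φ (Ger.mk G') ↔ G.Equivalent G' := by
  have key : ∀ {d : RelCover Φ} (m : Refinement d c) (m' : Refinement d c'),
      kappa Φ (Ger.mk ((G.restrict m).tensor (G'.restrict m').dual)) =
        kappa Φ (Ger.mk G) - kappa Φ (Ger.mk G') := fun {d} m m' => by
    rw [Ger.mk_tensor, Ger.mk_dual, Ger.mk_restrict, Ger.mk_restrict, map_add, map_neg,
      sub_eq_add_neg]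
  refine ⟨fun h => ?_, fun ⟨d, m, m', h⟩ => ?_⟩
  · let m := Refinement.infLeft c c'
    let m' := Refinement.infRight c c'
    have h0 := key m m'
    rw [h, sub_self, kappa_mk] at h0
    obtain ⟨d, n, z, hz, h1⟩ := exists_isDD_of_ddClass_eq_zero h0
    refine ⟨d, m.comp n, m'.comp n, RelGerbe.IsDDCocycle.isTrivial (z := z) ?_ h1⟩
    -- Restricting the tensor product again gives a gerbe known only to be isomorphic to the desired
    -- one. It is the Dixmier–Douady cocycle, an invariant of the isomorphism class, that is carried
    -- across, and triviality is deduced afterwards.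
    have e : GerOn.restrict n (GerOn.mk ((G.restrict m).tensor (G'.restrict m').dual)) =
        GerOn.mk ((G.restrict (m.comp n)).tensor (G'.restrict (m'.comp n)).dual) := by
      rw [GerOn.mk_tensor_dual, GerOn.mk_tensor_dual, map_sub]
      exact congrArg₂ _ (GerOn.restrict_comp m n (GerOn.mk G)).symm
        (GerOn.restrict_comp m' n (GerOn.mk G')).symm
    rw [e] at hz
    exact hz
  · exact sub_eq_zero.1 ((key m m').symm.trans h.kappa_eq_zero)

theorem exists_kappa_mk_eq (h : H3 Φ) :
    ∃ (c : RelCover Φ) (G : RelGerbe c), kappa Φ (Ger.mk G) = h := by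
  obtain ⟨c, z, rfl⟩ := H3.exists_mk_eq h
  obtain ⟨G, hG⟩ := RelGerbe.exists_isDDCocycle z
  exact ⟨c, G, kappa_mk_eq_of_isDDCocycle hG⟩

end Classification

end RelativeGerbe

end

theorem mainTheorem2
    {EM : Type*} [NormedAddCommGroup EM] [NormedSpace ℝ EM] [FiniteDimensional ℝ EM]
    {M : Type u} [TopologicalSpace M] [ChartedSpace EM M] [IsManifold 𝓘(ℝ, EM) ∞ M]
    [T2Space M] [SecondCountableTopology M]
    {EN : Type*} [NormedAddCommGroup EN] [NormedSpace ℝ EN] [FiniteDimensional ℝ EN]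
    {N : Type u} [TopologicalSpace N] [ChartedSpace EN N] [IsManifold 𝓘(ℝ, EN) ∞ N]
    [T2Space N] [SecondCountableTopology N]
    (Φ : C^∞⟮𝓘(ℝ, EM), M; 𝓘(ℝ, EN), N⟯) :
    ∃ (K : AddSubgroup (RelativeGerbe.Ger Φ))
      (κ : RelativeGerbe.Ger Φ →+ RelativeGerbe.H3 Φ),
      -- `κ` is given by the relative Dixmier–Douady class (on a sufficiently fine cover)
      (∀ (c : RelativeGerbe.RelCover Φ) (G : RelativeGerbe.RelGerbe c)
        (z : RelativeGerbe.intCocycles c 2),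
        G.IsDDCocycle z → κ (RelativeGerbe.Ger.mk G) = RelativeGerbe.H3.mk z) ∧
      (∀ (c : RelativeGerbe.RelCover Φ) (G : RelativeGerbe.RelGerbe c),
        ∃ (c' : RelativeGerbe.RelCover Φ) (m : RelativeGerbe.Refinement c' c)
          (z : RelativeGerbe.intCocycles c' 2), (G.restrict m).IsDDCocycle z) ∧
      -- the short exact sequence `0 → Ger₀(Φ) → Ger(Φ) → H³(Φ, ℤ) → 0`
      (K : Set (RelativeGerbe.Ger Φ)) = RelativeGerbe.Ger0 Φ ∧
      Function.Injective K.subtype ∧ Function.Exact K.subtype κ ∧ Function.Surjective κ ∧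
      -- a relative gerbe has class zero iff it satisfies, on a refinement, the condition of `Ger₀`
      (∀ (c : RelativeGerbe.RelCover Φ) (G : RelativeGerbe.RelGerbe c),
        κ (RelativeGerbe.Ger.mk G) = 0 ↔
          ∃ (c' : RelativeGerbe.RelCover Φ) (m : RelativeGerbe.Refinement c' c),
            (G.restrict m).IsTrivial) ∧
      -- `H³(Φ, ℤ)` classifies relative gerbes up to equivalence
      (∀ (c c' : RelativeGerbe.RelCover Φ) (G : RelativeGerbe.RelGerbe c)
        (G' : RelativeGerbe.RelGerbe c'),
        κ (RelativeGerbe.Ger.mk G) = κ (RelativeGerbe.Ger.mk G') ↔ G.Equivalent G') ∧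
      (∀ h : RelativeGerbe.H3 Φ, ∃ (c : RelativeGerbe.RelCover Φ) (G : RelativeGerbe.RelGerbe c),
        κ (RelativeGerbe.Ger.mk G) = h) := by
  have : LocallyCompactSpace M := Manifold.locallyCompact_of_finiteDimensional 𝓘(ℝ, EM)
  have : LocallyCompactSpace N := Manifold.locallyCompact_of_finiteDimensional 𝓘(ℝ, EN)
  refine ⟨(RelativeGerbe.kappa Φ).ker, RelativeGerbe.kappa Φ,
    fun c G z h => RelativeGerbe.kappa_mk_eq_of_isDDCocycle h,
    fun c G => RelativeGerbe.exists_restrict_isDDCocycle G, RelativeGerbe.coe_ker_kappa,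
    Subtype.val_injective, fun x => ?_, fun h => ?_,
    fun c G => RelativeGerbe.kappa_mk_eq_zero_iff G,
    fun c c' G G' => RelativeGerbe.kappa_mk_eq_iff G G',
    fun h => RelativeGerbe.exists_kappa_mk_eq h⟩
  · exact ⟨fun hx => ⟨⟨x, hx⟩, rfl⟩, fun ⟨y, hy⟩ => hy ▸ y.2⟩
  · obtain ⟨c, G, hG⟩ := RelativeGerbe.exists_kappa_mk_eq h
    exact ⟨_, hG⟩
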